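/- **Triangular family.** For $\theta\in\Theta=(0,1)$ let $P_\theta$ be the law on $(0,1)$ with density $$f(y,\theta)=\tfrac{2y}{\theta}1_{(0,\theta]}(y)+\tfrac{2-2y}{1-\theta}1_{(\theta,1)}(y),$$ and let $G(u,\theta)=\sqrt{u\theta}\,1_{(0,\theta]}(u)+\bigl(1-\sqrt{(1-u)(1-\theta)}\bigr)1_{(\theta,1)}(u)$, applied coordinatewise to $u\in(0,1)^n$. Write $p(\mathbf y,\theta)=\prod_{i\le n} f(y_i,\theta)$, and $P^n_\theta$ for the law of $n$ i.i.d. observations from $P_\theta$. The total variation distance is $\|P-Q\|_{TV}=\sup_B|P(B)-Q(B)|$. 1. (Data-generating algorithm.) If $U$ is uniform on $(0,1)$, then $G(U,\theta)\sim P_\theta$. For $y,\theta\in(0,1)$ there is exactly one $u=G^{-1}(y,\theta)\in(0,1)$ with $G(u,\theta)=y$, and at this $u$ one has $\partial_\theta G(u,\theta)=g(y,\theta):=\frac{y}{2\theta}1_{(0,\theta]}(y)+\frac{1-y}{2(1-\theta)}1_{(\theta,1)}(y)$. 2. (Generalized fiducial distribution.) For $n\ge1$ and $\mathbf y\in(0,1)^n$,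 the Jacobian $J(\mathbf y,\theta)=\det(n^{-1}M^\top M)^{1/2}$, with $M=\nabla_\theta G(\mathbf u,\theta)|_{\mathbf u=G^{-1}(\mathbf y,\theta)}$, equals $$J(\mathbf y,\theta)=\Bigl(\tfrac1n\sum_i\bigl(\tfrac{y_i}{2\theta}\bigr)^2 1_{(0,\theta]}(y_i)+\tfrac1n\sum_i\bigl(\tfrac{1-y_i}{2(1-\theta)}\bigr)^2 1_{(\theta,1)}(y_i)\Bigr)^{1/2}.$$ The probability measure $r(\cdot\mid\mathbf y)$ on $(0,1)$ with density $p(\mathbf y,\theta)J(\mathbf y,\theta)\big/\int_0^1 p(\mathbf y,t)J(\mathbf y,t)\,dt$ is the generalized fiducial distribution (GFD): it is the weak limit, as $\varepsilon\downarrow0$, of the law of $Q_{\mathbf y}(U^*)$, where $Q_{\mathbf y}(\mathbf u)\in\arg\min_{\theta\in\Theta}\|\mathbf y-G(\mathbf u,\theta)\|_2$ is measurable and $U^*$ is uniform on $(0,1)^n$ conditioned on the event that the minimum is attained and is at most $\varepsilon$. Such a measurable choice $Q_{\mathbf y}$ exists, and the limit does not depend on it. 3. (Assumptions.) Fix $\theta_0\in(0,1)$,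 and let $$\dot\ell_{\theta_0}(y)=-\tfrac1{\theta_0}1_{(0,\theta_0]}(y)+\tfrac1{1-\theta_0}1_{(\theta_0,1)}(y),\qquad \pi_{\theta_0}(\theta)=\Bigl(\int g(y,\theta)^2\,dP_{\theta_0}(y)\Bigr)^{1/2}.$$ Then $\pi_{\theta_0}(\theta_0)=\sqrt{1/8}$, whatever $\theta_0$ is (a flat-prior analogue), and for some $D>0$: - (A1) the model is differentiable in quadratic mean at $\theta_0$ with score $\dot\ell_{\theta_0}$ and Fisher information $I_{\theta_0}=(\theta_0(1-\theta_0))^{-1}\ne0$; - (A2) $\sup_{\theta\in\Theta,\,|\theta-\theta_0|\le D}|J(\mathbf y,\theta)-\pi_{\theta_0}(\theta)|/J(\mathbf y,\theta)\to0$ in $P^n_{\theta_0}$-probability; - (A3) $\pi_{\theta_0}$ is continuous and positive at $\theta_0$; - (A4) $p=p^1p^2$ for densities $p^1(\cdot,\theta),p^2(\cdot,\theta)$ of finite measures, and there is an integrable $\gamma\ge0$ on $\Theta$ with $P^n_{\theta_0}\bigl(p^2(\mathbf y,\theta)J(\mathbf y,\theta)1_{\{|\theta-\theta_0|>D\}}\le\gamma(\theta)\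 \forall\theta\in\Theta\bigr)\to1$; - (A5) for every $\varepsilon>0$ there are tests $\delta_n$ and $c>0$ with $P^n_{\theta_0}\delta_n\to0$ and, whenever $|\theta-\theta_0|\ge\varepsilon$, both $P^n_\theta(1-\delta_n)$ and $\int(1-\delta_n)\,p^1(\mathbf y,\theta)\,d\mathbf y$ are at most $e^{-cn(|\theta-\theta_0|^2\wedge1)}$. 4. (Bernstein–von Mises.) For every $\theta_0\in(0,1)$, with $\Delta_{n,\theta_0}=n^{-1/2}\sum_{i\le n} I_{\theta_0}^{-1}\dot\ell_{\theta_0}(y_i)$, the law of $\sqrt n(\theta-\theta_0)$ under $r(\cdot\mid\mathbf y)$ satisfies $$\bigl\|\mathcal L_{r(\cdot\mid\mathbf y)}\bigl(\sqrt n(\theta-\theta_0)\bigr)-N(\Delta_{n,\theta_0},I_{\theta_0}^{-1})\bigr\|_{TV}\to0\quad\text{in }P^n_{\theta_0}\text{-probability}.$$ 5. (Modified GFD.) For $n\ge1$ and $\mathbf y\in(0,1)^n$, $$r^{\rm mod}=\min_i(1-y_i)^2\,\delta_0+\min_i y_i^2\,\delta_1+\bigl(1-\min_i y_i^2-\min_i(1-y_i)^2\bigr)\,r(\cdot\mid\mathbf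 y)$$ is a probability measure, and $\|r^{\rm mod}-r\|_{TV}\le\min_i y_i^2+\min_i(1-y_i)^2$. For an i.i.d. sequence $y_1,y_2,\dots$ from $P_{\theta_0}$ this bound tends to $0$ almost surely, and the conclusion of 4 also holds with $r^{\rm mod}$ in place of $r$. -/

import Mathlib

open MeasureTheory ProbabilityTheory Filter Topology Set
open scoped ENNReal NNReal

namespace Fiducial

noncomputable section

/-! ## Samples, laws, likelihoods (real observations, parameter set `Θ ⊆ ℝ`)

`f y θ` is a density, in one real observation `y`, with respect to Lebesgue measure. -/

/-- The law of one observation. -/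
def law (f : ℝ → ℝ → ℝ) (θ : ℝ) : Measure ℝ :=
  volume.withDensity (fun y => ENNReal.ofReal (f y θ))

/-- The law of `n` independent observations. -/
def sampleLaw (f : ℝ → ℝ → ℝ) (n : ℕ) (θ : ℝ) : Measure (Fin n → ℝ) :=
  Measure.pi (fun _ => law f θ)

/-- The joint density of `n` independent observations. -/
def likelihood (f : ℝ → ℝ → ℝ) (n : ℕ) (y : Fin n → ℝ) (θ : ℝ) : ℝ :=
  ∏ i, f (y i) θ

/-- Total variation distance `sup_B |μ(B) - ν(B)|` of finite measures, over measurable `B`. -/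
def tvDist (μ ν : Measure ℝ) : ℝ :=
  ⨆ B : {B : Set ℝ // MeasurableSet B}, |μ.real B.1 - ν.real B.1|

/-! ## Generalized fiducial distributions

`G u θ` is a data-generating algorithm for one observation, with `u` uniform on `(0,1)`;
a sample of size `n` is generated coordinatewise. -/

/-- The law of `n` independent uniform variables on `(0,1)`. -/
def uniformLaw (n : ℕ) : Measure (Fin n → ℝ) :=
  Measure.pi (fun _ => volume.restrict (Ioo (0 : ℝ) 1))

/-- The Euclidean distance between the data `y` and `(G(u₁,θ), …, G(uₙ,θ))`. -/
def misfit (G : ℝ → ℝ → ℝ) {n : ℕ} (y u : Fin n → ℝ) (θ : ℝ) : ℝ :=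
  ‖WithLp.toLp 2 (fun i => y i - G (u i) θ)‖

/-- `argmin_{θ ∈ Θ} ‖y - G(u,θ)‖`, a set which may be empty. -/
def argminSet (G : ℝ → ℝ → ℝ) (Θ : Set ℝ) {n : ℕ} (y u : Fin n → ℝ) : Set ℝ :=
  {θ | θ ∈ Θ ∧ IsMinOn (misfit G y u) Θ θ}

/-- `Q` is a version of the pseudo-inverse `u ↦ Q_y(u)`: a measurable choice of a point of the
argmin set, wherever that set is non-empty. -/
def IsPseudoInverse (G : ℝ → ℝ → ℝ) (Θ : Set ℝ) {n : ℕ} (y : Fin n → ℝ)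
    (Q : (Fin n → ℝ) → ℝ) : Prop :=
  Measurable Q ∧ ∀ u : Fin n → ℝ, (∀ i, u i ∈ Ioo (0 : ℝ) 1) →
    (argminSet G Θ y u).Nonempty → Q u ∈ argminSet G Θ y u

/-- The set of those `u` whose pseudo-inverse exists and reproduces `y` up to an error `ε`. -/
def nearSet (G : ℝ → ℝ → ℝ) (Θ : Set ℝ) {n : ℕ} (y : Fin n → ℝ) (ε : ℝ) :
    Set (Fin n → ℝ) :=
  {u | (∀ i, u i ∈ Ioo (0 : ℝ) 1) ∧ ∃ θ ∈ argminSet G Θ y u, misfit G y u θ ≤ ε}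

/-- `ν` is the generalized fiducial distribution given the data `y`: the weak limit, as
`ε → 0+`, of the law of `Q_y(U*)`, with `U*` uniform on `(0,1)ⁿ` conditioned on `nearSet`,
whatever version of the pseudo-inverse is used (and there is one). -/
def IsGFD (G : ℝ → ℝ → ℝ) (Θ : Set ℝ) {n : ℕ} (y : Fin n → ℝ) (ν : Measure ℝ) : Prop :=
  IsProbabilityMeasure ν ∧
  (∃ Q, IsPseudoInverse G Θ y Q) ∧
  ∀ Q, IsPseudoInverse G Θ y Q → ∀ g : BoundedContinuousFunction ℝ ℝ,
    Tendsto (fun ε : ℝ => ∫ u, g (Q u) ∂(cond (uniformLaw n) (nearSet G Θ y ε)))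
      (𝓝[>] 0) (𝓝 (∫ θ, g θ ∂ν))

/-- The solution `u = G⁻¹(y,θ) ∈ (0,1)` of `G(u,θ) = y`. -/
def dgaInverse (G : ℝ → ℝ → ℝ) (y θ : ℝ) : ℝ :=
  Function.invFunOn (fun u => G u θ) (Ioo (0 : ℝ) 1) y

/-- The gradient `∇_θ G(u,θ)` at `u = G⁻¹(y,θ)`, an `n × 1` matrix. -/
def dgaGradient (G : ℝ → ℝ → ℝ) (n : ℕ) (y : Fin n → ℝ) (θ : ℝ) : Matrix (Fin n) (Fin 1) ℝ :=
  Matrix.of fun i _ => deriv (fun t => G (dgaInverse G (y i) θ) t) θ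

/-- The Jacobian `J(y,θ) = det(n⁻¹ Mᵀ M)^{1/2}`, with `M = ∇_θ G(u,θ)` at `u = G⁻¹(y,θ)`. -/
def jacobian (G : ℝ → ℝ → ℝ) (n : ℕ) (y : Fin n → ℝ) (θ : ℝ) : ℝ :=
  √(Matrix.det ((n : ℝ)⁻¹ • ((dgaGradient G n y θ).transpose * dgaGradient G n y θ)))

/-- The measure on `Θ` with density
`r(θ|y) = p(y,θ) J(y,θ) / ∫_Θ p(y,t) J(y,t) dt`. -/
def fiducialMeasure (f G : ℝ → ℝ → ℝ) (Θ : Set ℝ) (n : ℕ) (y : Fin n → ℝ) : Measure ℝ :=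
  (volume.restrict Θ).withDensity fun θ => ENNReal.ofReal
    (likelihood f n y θ * jacobian G n y θ / ∫ t in Θ, likelihood f n y t * jacobian G n y t)

/-! ## The five assumptions -/

/-- Differentiability in quadratic mean at `θ₀`, with score function `ℓ`. -/
def IsDQM (f : ℝ → ℝ → ℝ) (θ₀ : ℝ) (ℓ : ℝ → ℝ) : Prop :=
  Measurable ℓ ∧ Integrable (fun y => ℓ y ^ 2 * f y θ₀) ∧
  (fun h : ℝ => ∫ y, (√(f y (θ₀ + h)) - √(f y θ₀) - 1 / 2 * h * ℓ y * √(f y θ₀)) ^ 2)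
    =o[𝓝 0] (fun h : ℝ => h ^ 2)

/-- The Fisher information `P_{θ₀} ℓ²`. -/
def fisherInfo (f : ℝ → ℝ → ℝ) (θ₀ : ℝ) (ℓ : ℝ → ℝ) : ℝ :=
  ∫ y, ℓ y ^ 2 * f y θ₀

/-- Convergence of the Jacobian:
`sup_{θ ∈ Θ, |θ - θ₀| ≤ D} |J(y,θ) - π(θ)| / J(y,θ) → 0` in `P_{θ₀}`-probability. The quotient
is taken in `[0,∞]`, so it is infinite where `J` vanishes and `π` does not. -/
def JacobianConverges (f : ℝ → ℝ → ℝ) (J : (n : ℕ) → (Fin n → ℝ) → ℝ → ℝ) (Θ : Set ℝ)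
    (θ₀ D : ℝ) (π : ℝ → ℝ) : Prop :=
  Measurable π ∧ (∀ θ, 0 ≤ π θ) ∧
  ∀ ε : ℝ, 0 < ε → Tendsto (fun n : ℕ => sampleLaw f n θ₀
      {y | ENNReal.ofReal ε ≤ ⨆ θ ∈ Θ ∩ Metric.closedBall θ₀ D,
        ENNReal.ofReal |J n y θ - π θ| / ENNReal.ofReal (J n y θ)}) atTop (𝓝 0)

/-- Mass of the limiting measure. -/
def LimitMass (π : ℝ → ℝ) (θ₀ : ℝ) : Prop :=
  ContinuousAt π θ₀ ∧ 0 < π θ₀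

/-- `q n y θ`, for `θ ∈ Θ`, are jointly measurable densities of finite measures of `y`. -/
def IsFiniteDensityFamily (q : (n : ℕ) → (Fin n → ℝ) → ℝ → ℝ) (Θ : Set ℝ) : Prop :=
  ∀ n, Measurable (fun z : (Fin n → ℝ) × ℝ => q n z.1 z.2) ∧
    ∀ θ ∈ Θ, (∀ y, 0 ≤ q n y θ) ∧ Integrable (fun y => q n y θ)

/-- Likelihood splitting `p = p¹ p²`, where
`P_{θ₀}(p²(y,θ) J(y,θ) 1{|θ - θ₀| > D} ≤ γ(θ) for all θ) → 1`
for the density `γ` of a finite measure on `Θ`. -/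
def LikelihoodSplits (f : ℝ → ℝ → ℝ) (J : (n : ℕ) → (Fin n → ℝ) → ℝ → ℝ) (Θ : Set ℝ)
    (θ₀ D : ℝ) (p₁ p₂ : (n : ℕ) → (Fin n → ℝ) → ℝ → ℝ) : Prop :=
  IsFiniteDensityFamily p₁ Θ ∧ IsFiniteDensityFamily p₂ Θ ∧
  (∀ n y, ∀ θ ∈ Θ, likelihood f n y θ = p₁ n y θ * p₂ n y θ) ∧
  ∃ γ : ℝ → ℝ, Measurable γ ∧ (∀ θ, 0 ≤ γ θ) ∧ IntegrableOn γ Θ ∧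
    Tendsto (fun n : ℕ => sampleLaw f n θ₀
      {y | ∀ θ ∈ Θ, D < |θ - θ₀| → p₂ n y θ * J n y θ ≤ γ θ}) atTop (𝓝 1)

/-- Exponentially consistent tests of `θ₀` against `|θ - θ₀| ≥ ε`, for the model and for the
measures with densities `p₁`. -/
def ExpConsistentTests (f : ℝ → ℝ → ℝ) (Θ : Set ℝ) (θ₀ : ℝ)
    (p₁ : (n : ℕ) → (Fin n → ℝ) → ℝ → ℝ) : Prop :=
  ∀ ε : ℝ, 0 < ε → ∃ δ : (n : ℕ) → (Fin n → ℝ) → ℝ, ∃ c : ℝ, 0 < c ∧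
    (∀ n, Measurable (δ n) ∧ ∀ y, δ n y ∈ Icc (0 : ℝ) 1) ∧
    Tendsto (fun n : ℕ => ∫ y, δ n y ∂(sampleLaw f n θ₀)) atTop (𝓝 0) ∧
    ∀ n : ℕ, ∀ θ ∈ Θ, ε ≤ |θ - θ₀| →
      ∫ y, (1 - δ n y) ∂(sampleLaw f n θ) ≤ Real.exp (-(c * n * min (|θ - θ₀| ^ 2) 1)) ∧
      ∫ y, (1 - δ n y) * p₁ n y θ ≤ Real.exp (-(c * n * min (|θ - θ₀| ^ 2) 1))

/-- All five assumptions at `θ₀`, with score function `ℓ` and limiting density `π`. -/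
def BvMAssumptions (f : ℝ → ℝ → ℝ) (J : (n : ℕ) → (Fin n → ℝ) → ℝ → ℝ) (Θ : Set ℝ)
    (θ₀ : ℝ) (ℓ π : ℝ → ℝ) : Prop :=
  (IsDQM f θ₀ ℓ ∧ fisherInfo f θ₀ ℓ ≠ 0) ∧
  ∃ D : ℝ, 0 < D ∧
    JacobianConverges f J Θ θ₀ D π ∧
    LimitMass π θ₀ ∧
    ∃ p₁ p₂ : (n : ℕ) → (Fin n → ℝ) → ℝ → ℝ,
      LikelihoodSplits f J Θ θ₀ D p₁ p₂ ∧ ExpConsistentTests f Θ θ₀ p₁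

/-! ## The Bernstein–von Mises property -/

/-- The centering `Δ_{n,θ₀} = n^{-1/2} ∑ I⁻¹ ℓ(yᵢ)`. -/
def centering (f : ℝ → ℝ → ℝ) (θ₀ : ℝ) (ℓ : ℝ → ℝ) (n : ℕ) (y : Fin n → ℝ) : ℝ :=
  1 / √(n : ℝ) * ∑ i, (fisherInfo f θ₀ ℓ)⁻¹ * ℓ (y i)

/-- For the data-dependent measures `ν n y` of the parameter `θ`, the law of
`√n (θ - θ₀)` and `N(Δ_{n,θ₀}, I⁻¹)` have total variation distance tending to `0` in
`P_{θ₀}`-probability. -/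
def BernsteinVonMises (f : ℝ → ℝ → ℝ) (ν : (n : ℕ) → (Fin n → ℝ) → Measure ℝ)
    (θ₀ : ℝ) (ℓ : ℝ → ℝ) : Prop :=
  ∀ ε : ℝ, 0 < ε → Tendsto (fun n : ℕ => sampleLaw f n θ₀
    {y | ε ≤ tvDist ((ν n y).map (fun θ => √(n : ℝ) * (θ - θ₀)))
      (gaussianReal (centering f θ₀ ℓ n y) (fisherInfo f θ₀ ℓ)⁻¹.toNNReal)}) atTop (𝓝 0)

/-! ## The triangular family on `(0,1)` -/

/-- The triangular density with mode `θ`. -/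
def triDensity (y θ : ℝ) : ℝ :=
  2 * y / θ * (Ioc 0 θ).indicator 1 y + (2 - 2 * y) / (1 - θ) * (Ioo θ 1).indicator 1 y

/-- The data-generating algorithm of the triangular family. -/
def triDGA (u θ : ℝ) : ℝ :=
  √(u * θ) * (Ioc 0 θ).indicator 1 u
    + (1 - √((1 - u) * (1 - θ))) * (Ioo θ 1).indicator 1 u

/-- The entry of the gradient matrix for one observation `y`. -/
def triGradient (y θ : ℝ) : ℝ :=
  y / (2 * θ) * (Ioc 0 θ).indicator 1 y + (1 - y) / (2 * (1 - θ)) * (Ioo θ 1).indicator 1 y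

/-- The score function of the triangular family. -/
def triScore (θ y : ℝ) : ℝ :=
  -(1 / θ) * (Ioc 0 θ).indicator 1 y + 1 / (1 - θ) * (Ioo θ 1).indicator 1 y

/-- The limiting density `π_{θ₀}(θ)`: the square root of the mean, under `P_{θ₀}`, of the squared
gradient entry at `θ`. -/
def triLimit (θ₀ θ : ℝ) : ℝ :=
  √(∫ y, triGradient y θ ^ 2 ∂(law triDensity θ₀))

/-- The generalized fiducial distribution of the triangular family, through its density. -/
def triGFD (n : ℕ) (y : Fin n → ℝ) : Measure ℝ :=
  fiducialMeasure triDensity triDGA (Ioo 0 1) n y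

/-- `min_i y_i²`. -/
def minSq {n : ℕ} (y : Fin n → ℝ) : ℝ := ⨅ i, y i ^ 2

/-- `min_i (1 - y_i)²`. -/
def minSqCompl {n : ℕ} (y : Fin n → ℝ) : ℝ := ⨅ i, (1 - y i) ^ 2

/-- The modified generalized fiducial distribution, with atoms at `0` and `1`. -/
def triModGFD (n : ℕ) (y : Fin n → ℝ) : Measure ℝ :=
  ENNReal.ofReal (minSqCompl y) • Measure.dirac 0 + ENNReal.ofReal (minSq y) • Measure.dirac 1
    + ENNReal.ofReal (1 - minSq y - minSqCompl y) • triGFD n y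

end

end Fiducial

/-!
Everything rests on three identities for the tent function
`tent y θ = min (y / θ) ((1 - y) / (1 - θ))`. On `(0,1)` the density of the triangular law is twice
the tent, the gradient entry `∂_θ G` at `u = G⁻¹(y,θ)` is half of it, and `G(·,θ)` is the inverse of
the distribution function (`triDGA_le_iff`, `hasDerivAt_triDGA`). The two branches of the tent
agree at `y = θ`, so the log-density is Lipschitz in the mode, uniformly in `y`, and is
differentiable in it off the null set `y = θ`.

*Assumptions.* Dominated convergence with this Lipschitz bound gives differentiability in quadratic
mean (`isDQM_tri`). The squared Jacobian is an empirical mean of bounded functions that are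
equicontinuous in `θ`, so it converges uniformly over a finite net and hence over a neighbourhood
of `θ₀` (`jacobianConverges_tri`). The number of observations below `θ₀` has a mean that separates
`θ₀` from every other mode linearly, and Hoeffding's inequality makes it an exponentially
consistent test (`expConsistentTests_tri`). As the Jacobian is bounded, the likelihood may be split
trivially.

*Bernstein–von Mises.* In the parameter `h = √n (θ - θ₀)`, the fiducial density divided by its
approximate value at `h = 0` is compared in `L¹(dh)` with the exponential of
`h ∑ ℓ(y_i) / √n - I h² / 2`, a multiple of the density of the limiting Gaussian law; the unknown
normalizing constant costs only a factor two (`tvDist_le_localError`). For `|h| ≤ M` the comparison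
is made in mean under `P_{θ₀}`. The log-likelihood ratio `L` of one observation is not twice
differentiable in the mode, but its second moment follows from the linear expansion in `L¹`, and
the normalization `E exp L = 1` turns this into an expansion of its mean
(`exists_logRem_moments_le`, `exists_integral_localDensity_le`). For `|h| > M` the fiducial mass is
bounded in mean, on the event that the counting test accepts, by a change of measure from `θ₀` to
`θ₀ + h / √n` and the error of second kind of the test (`lintegral_scaledDensity_tail_le`), while
the Gaussian tail is explicit once the centring is bounded.

*The weak limit.* For small `ε` let `A` be the set of `u` for which a minimizer `Q u` exists with
misfit at most `ε`. With `w(θ)` the gradient at `y`, the residual `y - G(u,θ)` is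
`y - G(u, Q u) + (Q u - θ) w(θ)` up to `O(ε²)`, where the first summand is almost orthogonal to
`w(θ)`. Hence, up to a relative error `O(ε)` in the radius, `u ∈ A` and `|θ - Q u| ≤ ε` hold
together exactly if the residual at `θ` lies in the cylinder about `w(θ)` of radius `ε`
(`exists_cylinder_constant`). Integrating a weight `ψ(θ)` over this set of pairs `(u, θ)` in the
two possible orders gives on one side about `2 ε ∫_A ψ(Q u) du`, and on the other
`∫ ψ(θ) P(residual ∈ cylinder) dθ`. The residual has density `p(y,θ)` at `0` and the volume of the
cylinder is proportional to `‖w(θ)‖ ε ^ n = √n J(y,θ) ε ^ n`, so the limit is proportional to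
`∫ ψ(θ) p(y,θ) J(y,θ) dθ` (`tendsto_integral_cylinderMass`, `tendsto_nearSet_integral_of_support`).
Minimizers near the ends of `(0,1)` carry little mass uniformly in `ε`
(`exists_measure_nearSet_le`). Only the defining property of `Q` enters, so the limit does not
depend on the choice; choosing the minimizer closest to `1/2` shows that a measurable one exists
(`exists_isPseudoInverse`).

*The modified distribution* differs from the fiducial distribution by at most the masses of the
two atoms in total variation, and these vanish because every triangular law charges all
neighbourhoods of `0` and of `1`.
-/

namespace Fiducial

noncomputable section

/-! ### The triangular family and its data-generating algorithm -/

/-- The tent function of height one with mode `θ`. On `(0,1)` the density of the triangular family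
is twice the tent function, and the gradient entry is half of it. -/
def tent (y θ : ℝ) : ℝ := min (y / θ) ((1 - y) / (1 - θ))

/-- The distribution function of the triangular law with mode `θ`, on `[0,1]`. -/
def triCDF (y θ : ℝ) : ℝ := if y ≤ θ then y ^ 2 / θ else 1 - (1 - y) ^ 2 / (1 - θ)

lemma tent_of_le {y θ : ℝ} (hθ : θ ∈ Ioo (0 : ℝ) 1) (h : y ≤ θ) : tent y θ = y / θ := by
  have h1 := hθ.1
  have h2 : 0 < 1 - θ := by linarith [hθ.2]
  refine min_eq_left ?_
  rw [div_le_div_iff₀ h1 h2]; nlinarith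

lemma tent_of_ge {y θ : ℝ} (hθ : θ ∈ Ioo (0 : ℝ) 1) (h : θ ≤ y) :
    tent y θ = (1 - y) / (1 - θ) := by
  have h1 := hθ.1
  have h2 : 0 < 1 - θ := by linarith [hθ.2]
  refine min_eq_right ?_
  rw [div_le_div_iff₀ h2 h1]; nlinarith

lemma tent_pos {y θ : ℝ} (hθ : θ ∈ Ioo (0 : ℝ) 1) (hy : y ∈ Ioo (0 : ℝ) 1) : 0 < tent y θ :=
  lt_min (div_pos hy.1 hθ.1) (div_pos (by linarith [hy.2]) (by linarith [hθ.2]))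

lemma tent_le_one {y θ : ℝ} (hθ : θ ∈ Ioo (0 : ℝ) 1) : tent y θ ≤ 1 := by
  have h1 := hθ.1
  have h2 : 0 < 1 - θ := by linarith [hθ.2]
  rcases le_total y θ with h | h
  · rw [tent_of_le hθ h, div_le_one h1]; exact h
  · rw [tent_of_ge hθ h, div_le_one h2]; linarith

lemma tent_nonpos {y θ : ℝ} (hθ : θ ∈ Ioo (0 : ℝ) 1) (hy : y ∉ Ioo (0 : ℝ) 1) :
    tent y θ ≤ 0 := by
  have h1 := hθ.1
  have h2 : 0 < 1 - θ := by linarith [hθ.2]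
  by_cases h : y ≤ 0
  · exact (min_le_left _ _).trans (div_nonpos_of_nonpos_of_nonneg h h1.le)
  · have : 1 ≤ y := by
      by_contra h'
      exact hy ⟨not_le.1 h, not_le.1 h'⟩
    exact (min_le_right _ _).trans (div_nonpos_of_nonpos_of_nonneg (by linarith) h2.le)

lemma triDensity_eq {y θ : ℝ} (hθ : θ ∈ Ioo (0 : ℝ) 1) :
    triDensity y θ = 2 * max 0 (tent y θ) := by
  have h1 := hθ.1
  have h2 : 0 < 1 - θ := by linarith [hθ.2]
  unfold triDensity
  rcases le_or_gt y θ with h | h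
  · have e2 : y ∉ Ioo θ 1 := fun h' => absurd h'.1 (not_lt.2 h)
    rw [tent_of_le hθ h]
    by_cases hy : 0 < y
    · rw [max_eq_right (div_pos hy h1).le]
      simp [indicator, e2, hy, h]; ring
    · rw [max_eq_left (div_nonpos_of_nonpos_of_nonneg (not_lt.1 hy) h1.le)]
      simp [indicator, e2, hy]
  · have e2 : y ∉ Ioc 0 θ := fun h' => absurd h'.2 (not_le.2 h)
    rw [tent_of_ge hθ h.le]
    by_cases hy : y < 1
    · rw [max_eq_right (div_pos (by linarith) h2).le]
      simp [indicator, e2, hy, h]; ring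
    · rw [max_eq_left (div_nonpos_of_nonpos_of_nonneg (by linarith) h2.le)]
      simp [indicator, e2, hy]

lemma triGradient_eq_density {y θ : ℝ} : triGradient y θ = triDensity y θ / 4 := by
  unfold triGradient triDensity
  rw [show y / (2 * θ) = (2 * y / θ) / 4 by rw [div_div, mul_comm (2 : ℝ) y, mul_comm θ 4,
      show (4 : ℝ) * θ = 2 * (2 * θ) by ring, mul_comm y 2, mul_div_mul_left _ _ two_ne_zero],
    show (1 - y) / (2 * (1 - θ)) = ((2 - 2 * y) / (1 - θ)) / 4 by
      rw [div_div, mul_comm (1 - θ) 4, show 2 - 2 * y = 2 * (1 - y) by ring,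
        show (4 : ℝ) * (1 - θ) = 2 * (2 * (1 - θ)) by ring, mul_div_mul_left _ _ two_ne_zero]]
  ring

lemma triGradient_eq {y θ : ℝ} (hθ : θ ∈ Ioo (0 : ℝ) 1) :
    triGradient y θ = max 0 (tent y θ) / 2 := by
  rw [triGradient_eq_density, triDensity_eq hθ]; ring

lemma triDensity_of_mem {y θ : ℝ} (hθ : θ ∈ Ioo (0 : ℝ) 1) (hy : y ∈ Ioo (0 : ℝ) 1) :
    triDensity y θ = 2 * tent y θ := by
  rw [triDensity_eq hθ, max_eq_right (tent_pos hθ hy).le]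

lemma triGradient_of_mem {y θ : ℝ} (hθ : θ ∈ Ioo (0 : ℝ) 1) (hy : y ∈ Ioo (0 : ℝ) 1) :
    triGradient y θ = tent y θ / 2 := by
  rw [triGradient_eq hθ, max_eq_right (tent_pos hθ hy).le]

lemma triDensity_pos {y θ : ℝ} (hθ : θ ∈ Ioo (0 : ℝ) 1) (hy : y ∈ Ioo (0 : ℝ) 1) :
    0 < triDensity y θ := by
  rw [triDensity_of_mem hθ hy]; linarith [tent_pos hθ hy]

lemma triDensity_nonneg {y θ : ℝ} (hθ : θ ∈ Ioo (0 : ℝ) 1) : 0 ≤ triDensity y θ := by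
  rw [triDensity_eq hθ]; positivity

lemma triDensity_le_two {y θ : ℝ} (hθ : θ ∈ Ioo (0 : ℝ) 1) : triDensity y θ ≤ 2 := by
  rw [triDensity_eq hθ]
  have := max_le zero_le_one (tent_le_one (y := y) hθ)
  linarith

lemma triDensity_of_notMem {y θ : ℝ} (hθ : θ ∈ Ioo (0 : ℝ) 1) (hy : y ∉ Ioo (0 : ℝ) 1) :
    triDensity y θ = 0 := by
  rw [triDensity_eq hθ, max_eq_left (tent_nonpos hθ hy), mul_zero]

lemma triGradient_nonneg {y θ : ℝ} (hθ : θ ∈ Ioo (0 : ℝ) 1) : 0 ≤ triGradient y θ := by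
  rw [triGradient_eq_density]; linarith [triDensity_nonneg (y := y) hθ]

lemma triGradient_le {y θ : ℝ} (hθ : θ ∈ Ioo (0 : ℝ) 1) : triGradient y θ ≤ 1 / 2 := by
  rw [triGradient_eq_density]; linarith [triDensity_le_two (y := y) hθ]

lemma measurable_triDensity : Measurable (fun z : ℝ × ℝ => triDensity z.1 z.2) := by
  unfold triDensity
  have h1 : MeasurableSet {z : ℝ × ℝ | z.1 ∈ Ioc 0 z.2} :=
    (measurableSet_lt measurable_const measurable_fst).inter
      (measurableSet_le measurable_fst measurable_snd)
  have h2 : MeasurableSet {z : ℝ × ℝ | z.1 ∈ Ioo z.2 1} :=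
    (measurableSet_lt measurable_snd measurable_fst).inter
      (measurableSet_lt measurable_fst measurable_const)
  refine Measurable.add (Measurable.mul (by fun_prop) ?_) (Measurable.mul (by fun_prop) ?_)
  · exact (measurable_const (a := (1 : ℝ))).indicator h1
  · exact (measurable_const (a := (1 : ℝ))).indicator h2

lemma measurable_triDensity_left (θ : ℝ) : Measurable (fun y => triDensity y θ) :=
  measurable_triDensity.comp (measurable_id.prodMk measurable_const)

lemma measurable_triGradient : Measurable (fun z : ℝ × ℝ => triGradient z.1 z.2) := by
  simp_rw [triGradient_eq_density]
  exact measurable_triDensity.div_const 4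

lemma measurable_triGradient_left (θ : ℝ) : Measurable (fun y => triGradient y θ) :=
  measurable_triGradient.comp (measurable_id.prodMk measurable_const)

lemma triDGA_of_le {u θ : ℝ} (hu : 0 < u) (h : u ≤ θ) : triDGA u θ = √(u * θ) := by
  simp [triDGA, indicator, hu, h, h.not_gt]

lemma triDGA_of_gt {u θ : ℝ} (hu : u < 1) (h : θ < u) :
    triDGA u θ = 1 - √((1 - u) * (1 - θ)) := by
  simp [triDGA, indicator, hu, h, h.not_ge]

lemma triDGA_of_ge {u θ : ℝ} (hu : u ∈ Ioo (0 : ℝ) 1) (h : θ ≤ u) :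
    triDGA u θ = 1 - √((1 - u) * (1 - θ)) := by
  rcases h.eq_or_lt with rfl | h
  · rw [triDGA_of_le hu.1 le_rfl, Real.sqrt_mul_self hu.1.le,
      Real.sqrt_mul_self (by linarith [hu.2])]; ring
  · exact triDGA_of_gt hu.2 h

/-- The data-generating algorithm keeps the side of the mode. -/
lemma triDGA_le_mode_iff {u θ : ℝ} (hθ : θ ∈ Ioo (0 : ℝ) 1) (hu : u ∈ Ioo (0 : ℝ) 1) :
    triDGA u θ ≤ θ ↔ u ≤ θ := by
  have h1 := hθ.1
  have h2 : 0 < 1 - θ := by linarith [hθ.2]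
  rcases le_or_gt u θ with h | h
  · simp only [h, iff_true]
    rw [triDGA_of_le hu.1 h]
    exact Real.sqrt_le_iff.2 ⟨h1.le, by nlinarith⟩
  · simp only [h.not_ge, iff_false, not_le]
    rw [triDGA_of_gt hu.2 h]
    have : √((1 - u) * (1 - θ)) < 1 - θ := by
      rw [Real.sqrt_lt' h2]; nlinarith
    linarith

lemma triDGA_mem {u θ : ℝ} (hθ : θ ∈ Ioo (0 : ℝ) 1) (hu : u ∈ Ioo (0 : ℝ) 1) :
    triDGA u θ ∈ Ioo (0 : ℝ) 1 := by
  have h1 := hθ.1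
  have h2 : 0 < 1 - θ := by linarith [hθ.2]
  have h3 : 0 < 1 - u := by linarith [hu.2]
  have h4 := hu.1
  rcases le_or_gt u θ with h | h
  · exact ⟨by rw [triDGA_of_le hu.1 h]; positivity,
      ((triDGA_le_mode_iff hθ hu).2 h).trans_lt hθ.2⟩
  · refine ⟨h1.trans (not_le.1 (mt (triDGA_le_mode_iff hθ hu).1 (not_le.2 h))), ?_⟩
    rw [triDGA_of_gt hu.2 h]
    have : 0 < √((1 - u) * (1 - θ)) := by positivity
    linarith

lemma triCDF_le_mode_iff {y θ : ℝ} (hθ : θ ∈ Ioo (0 : ℝ) 1) (hy : y ∈ Icc (0 : ℝ) 1) :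
    triCDF y θ ≤ θ ↔ y ≤ θ := by
  have h1 := hθ.1
  have h2 : 0 < 1 - θ := by linarith [hθ.2]
  unfold triCDF
  split_ifs with h
  · simp only [h, iff_true]
    rw [div_le_iff₀ h1]; nlinarith [hy.1]
  · simp only [h, iff_false, not_le]
    rw [not_le] at h
    have : (1 - y) ^ 2 / (1 - θ) < 1 - θ := by rw [div_lt_iff₀ h2]; nlinarith [hy.2]
    linarith

lemma triCDF_of_le {y θ : ℝ} (h : y ≤ θ) : triCDF y θ = y ^ 2 / θ := if_pos h

lemma triCDF_of_gt {y θ : ℝ} (h : θ < y) : triCDF y θ = 1 - (1 - y) ^ 2 / (1 - θ) :=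
  if_neg h.not_ge

lemma triCDF_mem {y θ : ℝ} (hθ : θ ∈ Ioo (0 : ℝ) 1) (hy : y ∈ Ioo (0 : ℝ) 1) :
    triCDF y θ ∈ Ioo (0 : ℝ) 1 := by
  have h1 := hθ.1
  have h2 : 0 < 1 - θ := by linarith [hθ.2]
  have h3 := hy.1
  have h4 : 0 < 1 - y := by linarith [hy.2]
  have h5 : y ∈ Icc (0 : ℝ) 1 := ⟨hy.1.le, hy.2.le⟩
  rcases le_or_gt y θ with h | h
  · exact ⟨by rw [triCDF_of_le h]; positivity, ((triCDF_le_mode_iff hθ h5).2 h).trans_lt hθ.2⟩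
  · refine ⟨h1.trans (not_le.1 (mt (triCDF_le_mode_iff hθ h5).1 (not_le.2 h))), ?_⟩
    rw [triCDF_of_gt h]
    have : 0 < (1 - y) ^ 2 / (1 - θ) := by positivity
    linarith

/-- The data-generating algorithm is the quantile function: with a uniform `u`, it therefore
generates the law with distribution function `triCDF`. -/
lemma triDGA_le_iff {u x θ : ℝ} (hθ : θ ∈ Ioo (0 : ℝ) 1) (hu : u ∈ Ioo (0 : ℝ) 1)
    (hx : x ∈ Icc (0 : ℝ) 1) : triDGA u θ ≤ x ↔ u ≤ triCDF x θ := by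
  have h1 := hθ.1
  have h2 : 0 < 1 - θ := by linarith [hθ.2]
  rcases le_or_gt u θ with h | h <;> rcases le_or_gt x θ with h' | h'
  · rw [triDGA_of_le hu.1 h, triCDF_of_le h', Real.sqrt_le_left hx.1, le_div_iff₀ h1]
  · exact iff_of_true (((triDGA_le_mode_iff hθ hu).2 h).trans h'.le)
      (h.trans (not_le.1 (mt (triCDF_le_mode_iff hθ hx).1 (not_le.2 h'))).le)
  · exact iff_of_false (not_le.2 (h'.trans_lt
      (not_le.1 (mt (triDGA_le_mode_iff hθ hu).1 (not_le.2 h)))))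
      (not_le.2 (((triCDF_le_mode_iff hθ hx).2 h').trans_lt h))
  · have h3 : 0 ≤ (1 - u) * (1 - θ) := mul_nonneg (by linarith [hu.2]) h2.le
    rw [triDGA_of_gt hu.2 h, triCDF_of_gt h', sub_le_comm, le_sub_comm,
      Real.le_sqrt (by linarith [hx.2]), div_le_iff₀ h2]
    exact h3

lemma triDGA_triCDF {y θ : ℝ} (hθ : θ ∈ Ioo (0 : ℝ) 1) (hy : y ∈ Ioo (0 : ℝ) 1) :
    triDGA (triCDF y θ) θ = y := by
  have h1 := hθ.1
  have h2 : 0 < 1 - θ := by linarith [hθ.2]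
  have hu := triCDF_mem hθ hy
  have h5 : y ∈ Icc (0 : ℝ) 1 := ⟨hy.1.le, hy.2.le⟩
  rcases le_or_gt y θ with h | h
  · rw [triDGA_of_le hu.1 ((triCDF_le_mode_iff hθ h5).2 h), triCDF_of_le h,
      div_mul_cancel₀ _ h1.ne', Real.sqrt_sq hy.1.le]
  · rw [triDGA_of_gt hu.2 (not_le.1 (mt (triCDF_le_mode_iff hθ h5).1 (not_le.2 h))),
      triCDF_of_gt h, sub_sub_cancel, div_mul_cancel₀ _ h2.ne',
      Real.sqrt_sq (by linarith [hy.2])]; ring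

lemma triCDF_triDGA {u θ : ℝ} (hθ : θ ∈ Ioo (0 : ℝ) 1) (hu : u ∈ Ioo (0 : ℝ) 1) :
    triCDF (triDGA u θ) θ = u := by
  have h1 := hθ.1
  have h2 : 0 < 1 - θ := by linarith [hθ.2]
  rcases le_or_gt u θ with h | h
  · rw [triCDF_of_le ((triDGA_le_mode_iff hθ hu).2 h), triDGA_of_le hu.1 h,
      Real.sq_sqrt (mul_nonneg hu.1.le h1.le), mul_div_cancel_right₀ _ h1.ne']
  · rw [triCDF_of_gt (not_le.1 (mt (triDGA_le_mode_iff hθ hu).1 (not_le.2 h))),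
      triDGA_of_gt hu.2 h, sub_sub_cancel, Real.sq_sqrt
      (mul_nonneg (by linarith [hu.2]) h2.le), mul_div_cancel_right₀ _ h2.ne']; ring

lemma triDGA_existsUnique {y θ : ℝ} (hθ : θ ∈ Ioo (0 : ℝ) 1) (hy : y ∈ Ioo (0 : ℝ) 1) :
    ∃! u : ℝ, u ∈ Ioo (0 : ℝ) 1 ∧ triDGA u θ = y :=
  ⟨triCDF y θ, ⟨triCDF_mem hθ hy, triDGA_triCDF hθ hy⟩, by
    rintro u ⟨hu, rfl⟩
    exact (triCDF_triDGA hθ hu).symm⟩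

lemma dgaInverse_triDGA {y θ : ℝ} (hθ : θ ∈ Ioo (0 : ℝ) 1) (hy : y ∈ Ioo (0 : ℝ) 1) :
    dgaInverse triDGA y θ = triCDF y θ := by
  have h : ∃ u ∈ Ioo (0 : ℝ) 1, (fun u => triDGA u θ) u = y :=
    ⟨triCDF y θ, triCDF_mem hθ hy, triDGA_triCDF hθ hy⟩
  exact (triDGA_existsUnique hθ hy).unique
    ⟨Function.invFunOn_mem h, Function.invFunOn_eq h⟩ ⟨triCDF_mem hθ hy, triDGA_triCDF hθ hy⟩

/-- The two branches of `θ ↦ G(u,θ)` have the same derivative `1/2` at `θ = u`, so the algorithm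
is differentiable in `θ` across the mode. -/
lemma hasDerivAt_triDGA {u θ : ℝ} (hθ : θ ∈ Ioo (0 : ℝ) 1) (hu : u ∈ Ioo (0 : ℝ) 1) :
    HasDerivAt (fun t => triDGA u t) (tent (triDGA u θ) θ / 2) θ := by
  have h1 := hθ.1
  have h2 : 0 < 1 - θ := by linarith [hθ.2]
  have h3 := hu.1
  have h4 : 0 < 1 - u := by linarith [hu.2]
  have dl : HasDerivAt (fun t => √(u * t)) (√(u * θ) / θ / 2) θ := by
    have := ((hasDerivAt_id' θ).const_mul u).sqrt (by simp; exact ⟨h3.ne', h1.ne'⟩)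
    convert this using 1
    have h5 : 0 < √(u * θ) := by positivity
    rw [mul_one, div_div, div_eq_div_iff (by positivity) (by positivity)]
    nlinarith [Real.mul_self_sqrt (mul_pos h3 h1).le]
  have dr : HasDerivAt (fun t => 1 - √((1 - u) * (1 - t)))
      (√((1 - u) * (1 - θ)) / (1 - θ) / 2) θ := by
    have := ((((hasDerivAt_id' θ).const_sub 1).const_mul (1 - u)).sqrt
      (by simp; exact ⟨h4.ne', h2.ne'⟩)).const_sub 1
    have h5 : 0 < √((1 - u) * (1 - θ)) := by positivity
    refine this.congr_deriv ?_
    rw [div_div, ← neg_div, div_eq_div_iff (by positivity) (by positivity)]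
    nlinarith [Real.mul_self_sqrt (mul_pos h4 h2).le]
  have el : u ≤ θ → tent (triDGA u θ) θ = √(u * θ) / θ := fun h => by
    rw [tent_of_le hθ ((triDGA_le_mode_iff hθ hu).2 h), triDGA_of_le h3 h]
  have er : θ ≤ u → tent (triDGA u θ) θ = √((1 - u) * (1 - θ)) / (1 - θ) := fun h => by
    have : θ ≤ triDGA u θ := by
      rcases h.eq_or_lt with rfl | h
      · rw [triDGA_of_le h3 le_rfl, Real.sqrt_mul_self h3.le]
      · exact (not_le.1 (mt (triDGA_le_mode_iff hθ hu).1 (not_le.2 h))).le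
    rw [tent_of_ge hθ this, triDGA_of_ge hu h, sub_sub_cancel]
  rcases lt_trichotomy u θ with h | h | h
  · rw [el h.le]
    refine dl.congr_of_eventuallyEq ?_
    filter_upwards [lt_mem_nhds h] with t ht using triDGA_of_le h3 ht.le
  · have hl : HasDerivWithinAt (fun t => triDGA u t) (tent (triDGA u θ) θ / 2) (Iic θ) θ := by
      rw [er h.ge]
      exact dr.hasDerivWithinAt.congr (fun t ht => triDGA_of_ge hu (h ▸ ht))
        (triDGA_of_ge hu h.ge)
    have hr : HasDerivWithinAt (fun t => triDGA u t) (tent (triDGA u θ) θ / 2) (Ici θ) θ := by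
      rw [el h.le]
      exact dl.hasDerivWithinAt.congr (fun t ht => triDGA_of_le h3 (h ▸ ht))
        (triDGA_of_le h3 h.le)
    have := hl.union hr
    rwa [Iic_union_Ici, hasDerivWithinAt_univ] at this
  · rw [er h.le]
    refine dr.congr_of_eventuallyEq ?_
    filter_upwards [gt_mem_nhds h] with t ht using triDGA_of_gt hu.2 ht

lemma hasDerivAt_triDGA_inverse {y θ : ℝ} (hθ : θ ∈ Ioo (0 : ℝ) 1) (hy : y ∈ Ioo (0 : ℝ) 1) :
    HasDerivAt (fun t => triDGA (dgaInverse triDGA y θ) t) (triGradient y θ) θ := by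
  have := hasDerivAt_triDGA hθ (triCDF_mem hθ hy)
  rwa [triDGA_triCDF hθ hy, ← triGradient_of_mem hθ hy, ← dgaInverse_triDGA hθ hy] at this

/-! ### The explicit Jacobian -/

/-- The Jacobian of the triangular family as a root mean square of gradient entries. -/
def triJac (n : ℕ) (y : Fin n → ℝ) (θ : ℝ) : ℝ :=
  √(1 / (n : ℝ) * ∑ i, triGradient (y i) θ ^ 2)

lemma jacobian_triDGA {n : ℕ} {y : Fin n → ℝ} (hy : ∀ i, y i ∈ Ioo (0 : ℝ) 1) {θ : ℝ}
    (hθ : θ ∈ Ioo (0 : ℝ) 1) : jacobian triDGA n y θ = triJac n y θ := by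
  unfold jacobian triJac
  rw [Matrix.det_fin_one]
  simp only [Matrix.smul_apply, Matrix.mul_apply, Matrix.transpose_apply, dgaGradient,
    Matrix.of_apply, smul_eq_mul, one_div]
  congr 2
  exact Finset.sum_congr rfl fun i _ => by
    rw [(hasDerivAt_triDGA_inverse hθ (hy i)).deriv, sq]

lemma triJac_explicit {n : ℕ} {y : Fin n → ℝ} {θ : ℝ} :
    triJac n y θ = √(1 / (n : ℝ) * ∑ i, (y i / (2 * θ)) ^ 2 * (Ioc 0 θ).indicator 1 (y i)
      + 1 / (n : ℝ) * ∑ i, ((1 - y i) / (2 * (1 - θ))) ^ 2 * (Ioo θ 1).indicator 1 (y i)) := by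
  unfold triJac
  rw [← mul_add, ← Finset.sum_add_distrib]
  congr 2
  refine Finset.sum_congr rfl fun i _ => ?_
  unfold triGradient
  by_cases h : y i ∈ Ioc 0 θ
  · have h' : y i ∉ Ioo θ 1 := fun h' => absurd h'.1 (not_lt.2 h.2)
    simp [h, h']
  · simp only [indicator_of_notMem h, mul_zero, zero_add]
    by_cases h' : y i ∈ Ioo θ 1 <;> simp [h']

lemma measurable_triJac (n : ℕ) : Measurable (fun z : (Fin n → ℝ) × ℝ => triJac n z.1 z.2) := by
  unfold triJac
  refine (Measurable.const_mul (Finset.measurable_sum _ fun i _ => ?_) _).sqrt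
  have h : Measurable (fun z : (Fin n → ℝ) × ℝ => (z.1 i, z.2)) := by fun_prop
  exact (measurable_triGradient.comp h).pow_const 2

lemma triJac_nonneg {n : ℕ} {y : Fin n → ℝ} {θ : ℝ} : 0 ≤ triJac n y θ := Real.sqrt_nonneg _

lemma triJac_sq {n : ℕ} {y : Fin n → ℝ} {θ : ℝ} :
    triJac n y θ ^ 2 = 1 / (n : ℝ) * ∑ i, triGradient (y i) θ ^ 2 :=
  Real.sq_sqrt (by positivity)

lemma triJac_le {n : ℕ} {y : Fin n → ℝ} {θ : ℝ} (hθ : θ ∈ Ioo (0 : ℝ) 1) :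
    triJac n y θ ≤ 1 / 2 := by
  refine Real.sqrt_le_iff.2 ⟨by norm_num, ?_⟩
  have : ∑ i, triGradient (y i) θ ^ 2 ≤ ∑ i : Fin n, (1 / 2 : ℝ) ^ 2 :=
    Finset.sum_le_sum fun i _ => pow_le_pow_left₀ (triGradient_nonneg hθ) (triGradient_le hθ) 2
  simp only [Finset.sum_const, Finset.card_univ, Fintype.card_fin, nsmul_eq_mul] at this
  rcases Nat.eq_zero_or_pos n with rfl | hn
  · simp
  · have hn' : (0 : ℝ) < n := by exact_mod_cast hn
    rw [one_div, inv_mul_le_iff₀ hn']; linarith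

lemma triJac_pos {n : ℕ} (hn : 0 < n) {y : Fin n → ℝ} (hy : ∀ i, y i ∈ Ioo (0 : ℝ) 1) {θ : ℝ}
    (hθ : θ ∈ Ioo (0 : ℝ) 1) : 0 < triJac n y θ := by
  have hn' : (0 : ℝ) < n := by exact_mod_cast hn
  refine Real.sqrt_pos.2 (mul_pos (by positivity) ?_)
  have : Nonempty (Fin n) := ⟨⟨0, hn⟩⟩
  refine Finset.sum_pos (fun i _ => ?_) Finset.univ_nonempty
  rw [triGradient_of_mem hθ (hy i)]
  have := tent_pos hθ (hy i)
  positivity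

/-! ### The law of one observation -/

lemma law_apply (f : ℝ → ℝ → ℝ) (θ : ℝ) {s : Set ℝ} (hs : MeasurableSet s) :
    law f θ s = ∫⁻ y in s, ENNReal.ofReal (f y θ) := withDensity_apply _ hs

lemma law_triDensity_compl {θ : ℝ} (hθ : θ ∈ Ioo (0 : ℝ) 1) :
    law triDensity θ (Ioo 0 1)ᶜ = 0 := by
  rw [law_apply _ _ measurableSet_Ioo.compl]
  rw [setLIntegral_congr_fun (g := fun _ => 0) measurableSet_Ioo.compl fun y hy => by
    simp [triDensity_of_notMem hθ hy]]
  simp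

lemma law_triDensity_ae {θ : ℝ} (hθ : θ ∈ Ioo (0 : ℝ) 1) :
    ∀ᵐ y ∂(law triDensity θ), y ∈ Ioo (0 : ℝ) 1 := law_triDensity_compl hθ

lemma integrable_triDensity {θ : ℝ} (hθ : θ ∈ Ioo (0 : ℝ) 1) :
    Integrable (fun y => triDensity y θ) := by
  have h : IntegrableOn (fun y => triDensity y θ) (Ioo 0 1) := by
    refine Measure.integrableOn_of_bounded (M := 2) (by simp)
      (measurable_triDensity_left θ).aestronglyMeasurable (ae_of_all _ fun y => ?_)
    rw [Real.norm_of_nonneg (triDensity_nonneg hθ)]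
    exact triDensity_le_two hθ
  exact (integrableOn_iff_integrable_of_support_subset fun y hy => by
    by_contra h'
    exact hy (triDensity_of_notMem hθ h')).1 h

lemma continuous_triCDF {θ : ℝ} (hθ : θ ∈ Ioo (0 : ℝ) 1) :
    Continuous (fun y => triCDF y θ) := by
  have h1 := hθ.1
  have h2 : 0 < 1 - θ := by linarith [hθ.2]
  refine Continuous.if_le (by fun_prop) (by fun_prop) continuous_id continuous_const ?_
  rintro x rfl
  field_simp; ring

lemma triCDF_zero {θ : ℝ} (hθ : θ ∈ Ioo (0 : ℝ) 1) : triCDF 0 θ = 0 := by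
  rw [triCDF_of_le hθ.1.le]; simp

lemma triCDF_one {θ : ℝ} (hθ : θ ∈ Ioo (0 : ℝ) 1) : triCDF 1 θ = 1 := by
  rw [triCDF_of_gt hθ.2]; simp

lemma triCDF_mode {θ : ℝ} (hθ : θ ∈ Ioo (0 : ℝ) 1) : triCDF θ θ = θ := by
  rw [triCDF_of_le le_rfl, sq, mul_div_cancel_right₀ _ hθ.1.ne']

lemma triCDF_mem_Icc {y θ : ℝ} (hθ : θ ∈ Ioo (0 : ℝ) 1) (hy : y ∈ Icc (0 : ℝ) 1) :
    triCDF y θ ∈ Icc (0 : ℝ) 1 := by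
  rcases hy.1.eq_or_lt with rfl | h0
  · rw [triCDF_zero hθ]; simp
  rcases hy.2.eq_or_lt with rfl | h1
  · rw [triCDF_one hθ]; simp
  exact Ioo_subset_Icc_self (triCDF_mem hθ ⟨h0, h1⟩)

lemma law_triDensity_Iic {x θ : ℝ} (hθ : θ ∈ Ioo (0 : ℝ) 1) (hx : x ∈ Icc (0 : ℝ) 1) :
    law triDensity θ (Iic x) = ENNReal.ofReal (triCDF x θ) := by
  have h1 := hθ.1
  have h2 : 0 < 1 - θ := by linarith [hθ.2]
  have e : law triDensity θ (Iic x) = law triDensity θ (Ioc 0 x) := by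
    refine measure_congr ?_
    filter_upwards [law_triDensity_ae hθ] with y hy
    exact propext ⟨fun h => ⟨hy.1, h⟩, fun h => h.2⟩
  rw [e, law_apply _ _ measurableSet_Ioc, ← ofReal_integral_eq_lintegral_ofReal
    (integrable_triDensity hθ).integrableOn (ae_of_all _ fun y => triDensity_nonneg hθ),
    ← intervalIntegral.integral_of_le hx.1]
  congr 1
  rw [intervalIntegral.integral_eq_sub_of_hasDeriv_right_of_le (f := fun y => triCDF y θ) hx.1
    (continuous_triCDF hθ).continuousOn ?_ (integrable_triDensity hθ).intervalIntegrable,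
    triCDF_zero hθ, sub_zero]
  intro y hy
  have hy' : y ∈ Ioo (0 : ℝ) 1 := ⟨hy.1, hy.2.trans_le hx.2⟩
  rw [triDensity_of_mem hθ hy']
  rcases lt_or_ge y θ with h | h
  · have := ((hasDerivAt_id' y).pow 2).div_const θ
    rw [tent_of_le hθ h.le]
    refine HasDerivAt.hasDerivWithinAt ?_
    refine HasDerivAt.congr_of_eventuallyEq (this.congr_deriv ?_) ?_
    · push_cast; ring
    · filter_upwards [gt_mem_nhds h] with t ht using triCDF_of_le (le_of_lt ht)
  · have := (((hasDerivAt_id' y).const_sub 1).pow 2).div_const (1 - θ) |>.const_sub 1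
    rw [tent_of_ge hθ h]
    refine HasDerivWithinAt.congr (this.congr_deriv ?_).hasDerivWithinAt
      (fun t ht => triCDF_of_gt (h.trans_lt ht)) ?_
    · push_cast; ring
    · rcases h.eq_or_lt with rfl | h
      · rw [triCDF_mode hθ]; simp only [Pi.pow_apply]; field_simp; ring
      · exact triCDF_of_gt h

lemma isProbabilityMeasure_law {θ : ℝ} (hθ : θ ∈ Ioo (0 : ℝ) 1) :
    IsProbabilityMeasure (law triDensity θ) := by
  refine ⟨?_⟩
  rw [← ENNReal.ofReal_one, ← triCDF_one hθ, ← law_triDensity_Iic hθ (by simp)]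
  refine measure_congr ?_
  filter_upwards [law_triDensity_ae hθ] with y hy
  exact propext ⟨fun _ => hy.2.le, fun _ => trivial⟩

lemma measurable_triDGA : Measurable (fun z : ℝ × ℝ => triDGA z.1 z.2) := by
  unfold triDGA
  have h1 : MeasurableSet {z : ℝ × ℝ | z.1 ∈ Ioc 0 z.2} :=
    (measurableSet_lt measurable_const measurable_fst).inter
      (measurableSet_le measurable_fst measurable_snd)
  have h2 : MeasurableSet {z : ℝ × ℝ | z.1 ∈ Ioo z.2 1} :=
    (measurableSet_lt measurable_snd measurable_fst).inter
      (measurableSet_lt measurable_fst measurable_const)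
  refine Measurable.add (Measurable.mul (by fun_prop) ?_) (Measurable.mul (by fun_prop) ?_)
  · exact (measurable_const (a := (1 : ℝ))).indicator h1
  · exact (measurable_const (a := (1 : ℝ))).indicator h2

lemma measurable_triDGA_left (θ : ℝ) : Measurable (fun u => triDGA u θ) :=
  measurable_triDGA.comp (measurable_id.prodMk measurable_const)

instance : IsProbabilityMeasure ((volume : Measure ℝ).restrict (Ioo 0 1)) := ⟨by simp⟩

lemma map_triDGA {θ : ℝ} (hθ : θ ∈ Ioo (0 : ℝ) 1) :
    (volume.restrict (Ioo (0 : ℝ) 1)).map (fun u => triDGA u θ) = law triDensity θ := by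
  have := isProbabilityMeasure_law hθ
  have hm := measurable_triDGA_left θ
  have := Measure.isProbabilityMeasure_map (μ := volume.restrict (Ioo (0 : ℝ) 1)) hm.aemeasurable
  have hae : ∀ᵐ u ∂(volume.restrict (Ioo (0 : ℝ) 1)), u ∈ Ioo (0 : ℝ) 1 :=
    ae_restrict_mem measurableSet_Ioo
  refine Measure.ext_of_Iic _ _ fun x => ?_
  rw [Measure.map_apply hm measurableSet_Iic]
  rcases lt_or_ge x 0 with h0 | h0
  · trans 0
    · refine measure_eq_zero_iff_ae_notMem.2 ?_
      filter_upwards [hae] with u hu h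
      exact absurd ((triDGA_mem hθ hu).1.trans_le h) h0.not_gt
    · refine (measure_eq_zero_iff_ae_notMem.2 ?_).symm
      filter_upwards [law_triDensity_ae hθ] with y hy h
      exact absurd (hy.1.trans_le h) h0.not_gt
  rcases lt_or_ge 1 x with h1 | h1
  · trans 1
    · refine (mem_ae_iff_prob_eq_one (hm measurableSet_Iic)).1 ?_
      filter_upwards [hae] with u hu
      exact (triDGA_mem hθ hu).2.le.trans h1.le
    · refine ((mem_ae_iff_prob_eq_one measurableSet_Iic).1 ?_).symm
      filter_upwards [law_triDensity_ae hθ] with y hy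
      exact hy.2.le.trans h1.le
  have hx : x ∈ Icc (0 : ℝ) 1 := ⟨h0, h1⟩
  rw [law_triDensity_Iic hθ hx]
  have hF := triCDF_mem_Icc hθ hx
  have : volume.restrict (Ioo (0 : ℝ) 1) ((fun u => triDGA u θ) ⁻¹' Iic x)
      = volume.restrict (Ioo (0 : ℝ) 1) (Iic (triCDF x θ)) := by
    refine measure_congr ?_
    filter_upwards [hae] with u hu
    exact propext (triDGA_le_iff hθ hu hx)
  rw [this, ← restrict_Ioo_eq_restrict_Ioc.symm, Measure.restrict_apply measurableSet_Iic,
    Iic_inter_Ioc_of_le hF.2, Real.volume_Ioc, sub_zero]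

/-! ### Sample laws -/

lemma likelihood_of_notMem {n : ℕ} {θ : ℝ} (hθ : θ ∈ Ioo (0 : ℝ) 1) {y : Fin n → ℝ}
    (hy : ¬ ∀ i, y i ∈ Ioo (0 : ℝ) 1) : likelihood triDensity n y θ = 0 := by
  push Not at hy
  obtain ⟨i, hi⟩ := hy
  exact Finset.prod_eq_zero (Finset.mem_univ i) (triDensity_of_notMem hθ hi)

lemma likelihood_pos {n : ℕ} {θ : ℝ} (hθ : θ ∈ Ioo (0 : ℝ) 1) {y : Fin n → ℝ}
    (hy : ∀ i, y i ∈ Ioo (0 : ℝ) 1) : 0 < likelihood triDensity n y θ :=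
  Finset.prod_pos fun i _ => triDensity_pos hθ (hy i)

lemma likelihood_nonneg {n : ℕ} {θ : ℝ} (hθ : θ ∈ Ioo (0 : ℝ) 1) {y : Fin n → ℝ} :
    0 ≤ likelihood triDensity n y θ :=
  Finset.prod_nonneg fun _ _ => triDensity_nonneg hθ

lemma likelihood_le {n : ℕ} {θ : ℝ} (hθ : θ ∈ Ioo (0 : ℝ) 1) {y : Fin n → ℝ} :
    likelihood triDensity n y θ ≤ 2 ^ n := by
  refine (Finset.prod_le_prod (fun _ _ => triDensity_nonneg hθ)
    fun _ _ => triDensity_le_two hθ).trans_eq ?_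
  simp

lemma measurable_likelihood (n : ℕ) :
    Measurable (fun z : (Fin n → ℝ) × ℝ => likelihood triDensity n z.1 z.2) := by
  unfold likelihood
  refine Finset.measurable_prod _ fun i _ => ?_
  have h : Measurable (fun z : (Fin n → ℝ) × ℝ => (z.1 i, z.2)) := by fun_prop
  exact measurable_triDensity.comp h

lemma measurable_likelihood_left (n : ℕ) (θ : ℝ) :
    Measurable (fun y : Fin n → ℝ => likelihood triDensity n y θ) :=
  (measurable_likelihood n).comp (measurable_id.prodMk measurable_const)

lemma integrable_likelihood {n : ℕ} {θ : ℝ} (hθ : θ ∈ Ioo (0 : ℝ) 1) :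
    Integrable (fun y : Fin n → ℝ => likelihood triDensity n y θ) :=
  Integrable.fintype_prod (f := fun _ y => triDensity y θ) fun _ => integrable_triDensity hθ

/-- The law of the sample has the likelihood as its density. -/
lemma sampleLaw_eq_withDensity {n : ℕ} {θ : ℝ} (hθ : θ ∈ Ioo (0 : ℝ) 1) :
    sampleLaw triDensity n θ
      = volume.withDensity fun y => ENNReal.ofReal (likelihood triDensity n y θ) := by
  have := isProbabilityMeasure_law hθ
  refine Measure.pi_eq fun s hs => ?_
  rw [withDensity_apply _ (MeasurableSet.univ_pi hs), ← lintegral_indicator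
    (MeasurableSet.univ_pi hs)]
  have e : ∀ y : Fin n → ℝ, (univ.pi s).indicator
      (fun y => ENNReal.ofReal (likelihood triDensity n y θ)) y
      = ENNReal.ofReal (∏ i, (s i).indicator (fun x => triDensity x θ) (y i)) := by
    intro y
    by_cases h : y ∈ univ.pi s
    · rw [indicator_of_mem h]
      congr 1
      exact Finset.prod_congr rfl fun i _ =>
        (indicator_of_mem (h i trivial) (fun x => triDensity x θ)).symm
    · rw [indicator_of_notMem h]
      simp only [mem_univ_pi, not_forall] at h
      obtain ⟨i, hi⟩ := h
      rw [Finset.prod_eq_zero (Finset.mem_univ i) (indicator_of_notMem hi _), ENNReal.ofReal_zero]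
  have hint : ∀ i, Integrable ((s i).indicator (fun x => triDensity x θ)) := fun i =>
    (integrable_triDensity hθ).indicator (hs i)
  have hnn : ∀ i x, 0 ≤ (s i).indicator (fun x => triDensity x θ) x := fun i x =>
    indicator_nonneg (fun _ _ => triDensity_nonneg hθ) _
  simp_rw [e]
  rw [volume_pi, ← ofReal_integral_eq_lintegral_ofReal (Integrable.fintype_prod hint)
    (ae_of_all _ fun y => Finset.prod_nonneg fun i _ => hnn i _),
    integral_fintype_prod_eq_prod (f := fun i => (s i).indicator fun x => triDensity x θ),
    ENNReal.ofReal_prod_of_nonneg fun i _ => integral_nonneg (hnn i)]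
  refine Finset.prod_congr rfl fun i _ => ?_
  rw [law_apply _ _ (hs i), ofReal_integral_eq_lintegral_ofReal (hint i) (ae_of_all _ (hnn i)),
    ← lintegral_indicator (hs i)]
  refine lintegral_congr fun x => ?_
  by_cases h : x ∈ s i <;> simp [h]

lemma isProbabilityMeasure_sampleLaw {n : ℕ} {θ : ℝ} (hθ : θ ∈ Ioo (0 : ℝ) 1) :
    IsProbabilityMeasure (sampleLaw triDensity n θ) := by
  have := isProbabilityMeasure_law hθ
  unfold sampleLaw
  infer_instance

lemma sampleLaw_ae {n : ℕ} {θ : ℝ} (hθ : θ ∈ Ioo (0 : ℝ) 1) :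
    ∀ᵐ y ∂(sampleLaw triDensity n θ), ∀ i, y i ∈ Ioo (0 : ℝ) 1 := by
  have := isProbabilityMeasure_law hθ
  refine ae_all_iff.2 fun i => ?_
  exact (Measure.tendsto_eval_ae_ae (i := i)).eventually (law_triDensity_ae hθ)

lemma integral_law (g : ℝ → ℝ) {θ : ℝ} (hθ : θ ∈ Ioo (0 : ℝ) 1) :
    ∫ y, g y ∂(law triDensity θ) = ∫ y, g y * triDensity y θ := by
  unfold law
  rw [integral_withDensity_eq_integral_toReal_smul
    (measurable_triDensity_left θ).ennreal_ofReal (ae_of_all _ fun _ => ENNReal.ofReal_lt_top)]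
  refine integral_congr_ae (ae_of_all _ fun y => ?_)
  simp only [smul_eq_mul]
  rw [ENNReal.toReal_ofReal (triDensity_nonneg hθ), mul_comm]

lemma integrable_law_iff (g : ℝ → ℝ) {θ : ℝ} (hθ : θ ∈ Ioo (0 : ℝ) 1) :
    Integrable g (law triDensity θ) ↔ Integrable (fun y => g y * triDensity y θ) := by
  unfold law
  rw [integrable_withDensity_iff
    (measurable_triDensity_left θ).ennreal_ofReal (ae_of_all _ fun _ => ENNReal.ofReal_lt_top)]
  refine integrable_congr (ae_of_all _ fun y => ?_)
  simp only
  rw [ENNReal.toReal_ofReal (triDensity_nonneg hθ)]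

lemma law_real_Iic {x θ : ℝ} (hθ : θ ∈ Ioo (0 : ℝ) 1) (hx : x ∈ Icc (0 : ℝ) 1) :
    (law triDensity θ).real (Iic x) = triCDF x θ := by
  rw [Measure.real, law_triDensity_Iic hθ hx, ENNReal.toReal_ofReal (triCDF_mem_Icc hθ hx).1]

/-! ### The score -/

lemma triScore_of_le {θ y : ℝ} (hy : 0 < y) (h : y ≤ θ) : triScore θ y = -(1 / θ) := by
  simp [triScore, indicator, hy, h, h.not_gt]

lemma triScore_of_gt {θ y : ℝ} (hy : y < 1) (h : θ < y) : triScore θ y = 1 / (1 - θ) := by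
  simp [triScore, indicator, hy, h, h.not_ge]

/-- On `(0,1)` the score is an affine function of the indicator of `{y ≤ θ}`. -/
lemma triScore_eq {θ y : ℝ} (hθ : θ ∈ Ioo (0 : ℝ) 1) (hy : y ∈ Ioo (0 : ℝ) 1) :
    triScore θ y = (θ * (1 - θ))⁻¹ * (θ - (Iic θ).indicator 1 y) := by
  have h1 := hθ.1
  have h2 : 0 < 1 - θ := by linarith [hθ.2]
  rcases le_or_gt y θ with h | h
  · rw [triScore_of_le hy.1 h, indicator_of_mem (show y ∈ Iic θ from h), Pi.one_apply]
    field_simp; ring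
  · rw [triScore_of_gt hy.2 h, indicator_of_notMem (show y ∉ Iic θ from not_le.2 h)]
    field_simp; ring

lemma measurable_triScore (θ : ℝ) : Measurable (triScore θ) := by
  unfold triScore
  exact ((measurable_one.indicator measurableSet_Ioc).const_mul _).add
    ((measurable_one.indicator measurableSet_Ioo).const_mul _)

lemma abs_triScore_le {θ y : ℝ} (hθ : θ ∈ Ioo (0 : ℝ) 1) :
    |triScore θ y| ≤ (min θ (1 - θ))⁻¹ := by
  have h1 := hθ.1
  have h2 : 0 < 1 - θ := by linarith [hθ.2]
  have h3 : 0 < min θ (1 - θ) := lt_min h1 h2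
  have i1 : 1 / θ ≤ (min θ (1 - θ))⁻¹ := by rw [one_div]; gcongr; exact min_le_left _ _
  have i2 : 1 / (1 - θ) ≤ (min θ (1 - θ))⁻¹ := by rw [one_div]; gcongr; exact min_le_right _ _
  by_cases hy : y ∈ Ioo (0 : ℝ) 1
  · rcases le_or_gt y θ with h | h
    · rwa [triScore_of_le hy.1 h, abs_neg, abs_of_pos (by positivity)]
    · rwa [triScore_of_gt hy.2 h, abs_of_pos (by positivity)]
  · have e1 : y ∉ Ioc 0 θ := fun h => hy ⟨h.1, h.2.trans_lt hθ.2⟩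
    have e2 : y ∉ Ioo θ 1 := fun h => hy ⟨h1.trans h.1, h.2⟩
    simp only [triScore, indicator_of_notMem e1, indicator_of_notMem e2]
    simpa using ⟨h1.le, hθ.2.le⟩

lemma integrable_indicator_Iic {θ θ₀ : ℝ} (hθ : θ ∈ Ioo (0 : ℝ) 1) :
    Integrable ((Iic θ₀).indicator (1 : ℝ → ℝ)) (law triDensity θ) := by
  have := isProbabilityMeasure_law hθ
  exact (integrable_const (1 : ℝ)).indicator measurableSet_Iic

lemma integral_indicator_Iic {θ θ₀ : ℝ} (hθ : θ ∈ Ioo (0 : ℝ) 1) (hθ₀ : θ₀ ∈ Ioo (0 : ℝ) 1) :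
    ∫ y, (Iic θ₀).indicator 1 y ∂(law triDensity θ) = triCDF θ₀ θ := by
  rw [integral_indicator_one measurableSet_Iic, law_real_Iic hθ ⟨hθ₀.1.le, hθ₀.2.le⟩]

lemma integral_triScore {θ : ℝ} (hθ : θ ∈ Ioo (0 : ℝ) 1) :
    ∫ y, triScore θ y ∂(law triDensity θ) = 0 := by
  have := isProbabilityMeasure_law hθ
  rw [integral_congr_ae (g := fun y => (θ * (1 - θ))⁻¹ * (θ - (Iic θ).indicator 1 y)) (by
    filter_upwards [law_triDensity_ae hθ] with y hy using triScore_eq hθ hy),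
    integral_const_mul, integral_sub (integrable_const _) (integrable_indicator_Iic hθ),
    integral_indicator_Iic hθ hθ, triCDF_mode hθ]
  simp

lemma integral_triScore_sq {θ : ℝ} (hθ : θ ∈ Ioo (0 : ℝ) 1) :
    ∫ y, triScore θ y ^ 2 ∂(law triDensity θ) = (θ * (1 - θ))⁻¹ := by
  have := isProbabilityMeasure_law hθ
  have h1 := hθ.1
  have h2 : 0 < 1 - θ := by linarith [hθ.2]
  rw [integral_congr_ae (g := fun y => (θ * (1 - θ))⁻¹ ^ 2 *
      (θ ^ 2 + (1 - 2 * θ) * (Iic θ).indicator 1 y)) (by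
    filter_upwards [law_triDensity_ae hθ] with y hy
    rw [triScore_eq hθ hy]
    by_cases h : y ∈ Iic θ
    · simp only [indicator_of_mem h, Pi.one_apply]; ring
    · simp only [indicator_of_notMem h]; ring),
    integral_const_mul, integral_add (integrable_const _)
      ((integrable_indicator_Iic hθ).const_mul _), integral_const_mul,
    integral_indicator_Iic hθ hθ, triCDF_mode hθ]
  simp
  field_simp; ring

lemma fisherInfo_tri {θ : ℝ} (hθ : θ ∈ Ioo (0 : ℝ) 1) :
    fisherInfo triDensity θ (triScore θ) = (θ * (1 - θ))⁻¹ := by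
  rw [fisherInfo, ← integral_law (fun y => triScore θ y ^ 2) hθ, integral_triScore_sq hθ]

lemma integrable_of_bound_law {θ : ℝ} (hθ : θ ∈ Ioo (0 : ℝ) 1) {g : ℝ → ℝ} (hg : Measurable g)
    {C : ℝ} (h : ∀ y ∈ Ioo (0 : ℝ) 1, |g y| ≤ C) : Integrable g (law triDensity θ) := by
  have := isProbabilityMeasure_law hθ
  refine Integrable.of_bound hg.aestronglyMeasurable C ?_
  filter_upwards [law_triDensity_ae hθ] with y hy using h y hy

/-! ### Regularity of the log-density in the mode -/

lemma measurable_tent (θ : ℝ) : Measurable (fun y => tent y θ) := by unfold tent; fun_prop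

lemma abs_log_sub_log_le {a x y : ℝ} (ha : 0 < a) (hx : a ≤ x) (hy : a ≤ y) :
    |Real.log x - Real.log y| ≤ |x - y| / a := by
  have hx' := ha.trans_le hx
  have hy' := ha.trans_le hy
  wlog h : y ≤ x generalizing x y
  · rw [abs_sub_comm, abs_sub_comm x]
    exact this hy hx hy' hx' (le_of_not_ge h)
  rw [abs_of_nonneg (sub_nonneg.2 (Real.log_le_log hy' h)), abs_of_nonneg (sub_nonneg.2 h),
    ← Real.log_div hx'.ne' hy'.ne']
  refine (Real.log_le_sub_one_of_pos (div_pos hx' hy')).trans ?_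
  rw [show x / y - 1 = (x - y) / y by field_simp]
  exact div_le_div_of_nonneg_left (sub_nonneg.2 h) ha hy

lemma log_tent {y θ : ℝ} (hθ : θ ∈ Ioo (0 : ℝ) 1) (hy : y ∈ Ioo (0 : ℝ) 1) :
    Real.log (tent y θ)
      = min (Real.log y - Real.log θ) (Real.log (1 - y) - Real.log (1 - θ)) := by
  have h1 := hθ.1
  have h2 : 0 < 1 - θ := by linarith [hθ.2]
  have h3 := hy.1
  have h4 : 0 < 1 - y := by linarith [hy.2]
  rw [← Real.log_div h3.ne' h1.ne', ← Real.log_div h4.ne' h2.ne', tent]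
  rcases le_total (y / θ) ((1 - y) / (1 - θ)) with h | h
  · rw [min_eq_left h, min_eq_left (Real.log_le_log (by positivity) h)]
  · rw [min_eq_right h, min_eq_right (Real.log_le_log (by positivity) h)]

/-- The log-density is Lipschitz in the mode, uniformly in the observation. -/
lemma abs_log_tent_sub_le {a y θ θ' : ℝ} (ha : 0 < a) (hθ : θ ∈ Icc a (1 - a))
    (hθ' : θ' ∈ Icc a (1 - a)) (hy : y ∈ Ioo (0 : ℝ) 1) :
    |Real.log (tent y θ) - Real.log (tent y θ')| ≤ |θ - θ'| / a := by
  have m : θ ∈ Ioo (0 : ℝ) 1 := ⟨ha.trans_le hθ.1, by linarith [hθ.2]⟩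
  have m' : θ' ∈ Ioo (0 : ℝ) 1 := ⟨ha.trans_le hθ'.1, by linarith [hθ'.2]⟩
  rw [log_tent m hy, log_tent m' hy]
  refine (abs_min_sub_min_le_max _ _ _ _).trans (max_le ?_ ?_)
  · rw [sub_sub_sub_cancel_left, abs_sub_comm]
    exact abs_log_sub_log_le ha hθ.1 hθ'.1
  · rw [sub_sub_sub_cancel_left]
    refine (abs_log_sub_log_le ha (by linarith [hθ'.2]) (by linarith [hθ.2])).trans_eq ?_
    rw [sub_sub_sub_cancel_left]

/-- The tent function is Lipschitz in the mode, uniformly in the observation. -/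
lemma abs_tent_sub_le {a y θ θ' : ℝ} (ha : 0 < a) (hθ : θ ∈ Icc a (1 - a))
    (hθ' : θ' ∈ Icc a (1 - a)) (hy : y ∈ Ioo (0 : ℝ) 1) :
    |tent y θ - tent y θ'| ≤ |θ - θ'| / a := by
  have m : θ ∈ Ioo (0 : ℝ) 1 := ⟨ha.trans_le hθ.1, by linarith [hθ.2]⟩
  have m' : θ' ∈ Ioo (0 : ℝ) 1 := ⟨ha.trans_le hθ'.1, by linarith [hθ'.2]⟩
  refine le_trans ?_ (abs_log_tent_sub_le ha hθ hθ' hy)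
  have p := tent_pos m hy
  have p' := tent_pos m' hy
  have q := tent_le_one (y := y) m
  have q' := tent_le_one (y := y) m'
  wlog h : tent y θ' ≤ tent y θ generalizing θ θ'
  · rw [abs_sub_comm, abs_sub_comm (Real.log _)]
    exact this hθ' hθ m' m p' p q' q (le_of_not_ge h)
  rw [abs_of_nonneg (sub_nonneg.2 h), abs_of_nonneg (sub_nonneg.2 (Real.log_le_log p' h)),
    ← Real.log_div p.ne' p'.ne', ← inv_div, Real.log_inv]
  have := Real.log_le_sub_one_of_pos (div_pos p' p)
  have e : tent y θ' / tent y θ - 1 = -((tent y θ - tent y θ') / tent y θ) := by field_simp; ring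
  have : tent y θ - tent y θ' ≤ (tent y θ - tent y θ') / tent y θ := by
    rw [le_div_iff₀ p]; nlinarith
  linarith

lemma hasDerivAt_log_tent {y θ : ℝ} (hθ : θ ∈ Ioo (0 : ℝ) 1) (hy : y ∈ Ioo (0 : ℝ) 1)
    (hne : y ≠ θ) : HasDerivAt (fun t => Real.log (tent y t)) (triScore θ y) θ := by
  have h1 := hθ.1
  have h2 : 0 < 1 - θ := by linarith [hθ.2]
  have h3 := hy.1
  have h4 : 0 < 1 - y := by linarith [hy.2]
  rcases hne.lt_or_gt with h | h
  · rw [triScore_of_le hy.1 h.le]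
    have := (Real.hasDerivAt_log h1.ne').const_sub (Real.log y)
    refine (this.congr_of_eventuallyEq ?_).congr_deriv (by rw [one_div])
    filter_upwards [lt_mem_nhds h, isOpen_Ioo.mem_nhds hθ] with t ht ht'
    rw [tent_of_le ht' (le_of_lt ht), Real.log_div h3.ne' ht'.1.ne']
  · rw [triScore_of_gt hy.2 h]
    have := (((hasDerivAt_id' θ).const_sub 1).log h2.ne').const_sub (Real.log (1 - y))
    refine (this.congr_of_eventuallyEq ?_).congr_deriv (by ring)
    filter_upwards [gt_mem_nhds h, isOpen_Ioo.mem_nhds hθ] with t ht ht'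
    rw [tent_of_ge ht' (le_of_lt ht), Real.log_div h4.ne' (by linarith [ht'.2])]

lemma law_singleton (θ x : ℝ) : law triDensity θ {x} = 0 :=
  withDensity_absolutelyContinuous _ _ (by simp)

/-- Half the distance from the mode to the boundary of `(0,1)`. -/
def margin (θ : ℝ) : ℝ := min θ (1 - θ) / 2

lemma margin_pos {θ : ℝ} (hθ : θ ∈ Ioo (0 : ℝ) 1) : 0 < margin θ :=
  half_pos (lt_min hθ.1 (by linarith [hθ.2]))

lemma mem_Icc_margin {θ t : ℝ} (h : |t - θ| ≤ margin θ) :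
    t ∈ Icc (margin θ) (1 - margin θ) := by
  have h1 := min_le_left θ (1 - θ)
  have h2 := min_le_right θ (1 - θ)
  rw [abs_le] at h
  unfold margin at *
  constructor <;> linarith [h.1, h.2]

lemma mem_Icc_margin_self {θ : ℝ} (hθ : θ ∈ Ioo (0 : ℝ) 1) :
    θ ∈ Icc (margin θ) (1 - margin θ) := mem_Icc_margin (by simpa using (margin_pos hθ).le)

lemma mem_Icc_margin_add {θ δ : ℝ} (h : |δ| ≤ margin θ) :
    θ + δ ∈ Icc (margin θ) (1 - margin θ) := mem_Icc_margin (by simpa using h)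

lemma Icc_subset_unit {a : ℝ} (ha : 0 < a) : Icc a (1 - a) ⊆ Ioo (0 : ℝ) 1 :=
  fun _ h => ⟨ha.trans_le h.1, by linarith [h.2]⟩

/-- The log-likelihood ratio of one observation between the modes `θ + δ` and `θ`. -/
def logRatio (θ δ y : ℝ) : ℝ := Real.log (tent y (θ + δ)) - Real.log (tent y θ)

lemma measurable_logRatio (θ δ : ℝ) : Measurable (logRatio θ δ) :=
  (measurable_tent _).log.sub (measurable_tent _).log

lemma abs_logRatio_le {θ δ y : ℝ} (hθ : θ ∈ Ioo (0 : ℝ) 1) (hδ : |δ| ≤ margin θ)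
    (hy : y ∈ Ioo (0 : ℝ) 1) : |logRatio θ δ y| ≤ |δ| / margin θ := by
  have := abs_log_tent_sub_le (margin_pos hθ) (mem_Icc_margin_add hδ) (mem_Icc_margin_self hθ) hy
  simpa [logRatio] using this

lemma exp_logRatio {θ δ y : ℝ} (hθ : θ ∈ Ioo (0 : ℝ) 1) (hδ : |δ| ≤ margin θ)
    (hy : y ∈ Ioo (0 : ℝ) 1) :
    Real.exp (logRatio θ δ y) = triDensity y (θ + δ) / triDensity y θ := by
  have m := Icc_subset_unit (margin_pos hθ) (mem_Icc_margin_add hδ)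
  rw [logRatio, Real.exp_sub, Real.exp_log (tent_pos m hy), Real.exp_log (tent_pos hθ hy),
    triDensity_of_mem m hy, triDensity_of_mem hθ hy, mul_div_mul_left _ _ two_ne_zero]

lemma integral_exp_logRatio {θ δ : ℝ} (hθ : θ ∈ Ioo (0 : ℝ) 1) (hδ : |δ| ≤ margin θ) :
    ∫ y, Real.exp (logRatio θ δ y) ∂(law triDensity θ) = 1 := by
  have m := Icc_subset_unit (margin_pos hθ) (mem_Icc_margin_add hδ)
  have := isProbabilityMeasure_law m
  have e : ∫ y, (1 : ℝ) ∂(law triDensity (θ + δ)) = 1 := by simp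
  rw [integral_law _ hθ, ← e, integral_law _ m]
  refine integral_congr_ae (ae_of_all _ fun y => ?_)
  by_cases hy : y ∈ Ioo (0 : ℝ) 1
  · simp only [one_mul]
    rw [exp_logRatio hθ hδ hy, div_mul_cancel₀ _ (triDensity_pos hθ hy).ne']
  · simp [triDensity_of_notMem hθ hy, triDensity_of_notMem m hy]

lemma abs_triScore_le_margin {θ y : ℝ} (hθ : θ ∈ Ioo (0 : ℝ) 1) :
    |triScore θ y| ≤ 1 / margin θ := by
  have h3 : 0 < min θ (1 - θ) := lt_min hθ.1 (by linarith [hθ.2])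
  refine (abs_triScore_le hθ).trans ?_
  rw [margin, one_div, inv_div, ← one_div]
  gcongr
  norm_num

/-- The linearization error of the log-likelihood ratio, relative to the increment, vanishes in
mean: pointwise convergence away from the mode, and a uniform Lipschitz bound. -/
lemma tendsto_integral_abs_logRatio {θ : ℝ} (hθ : θ ∈ Ioo (0 : ℝ) 1) :
    Tendsto (fun δ => ∫ y, |logRatio θ δ y - δ * triScore θ y| / |δ| ∂(law triDensity θ))
      (𝓝[≠] 0) (𝓝 0) := by
  have := isProbabilityMeasure_law hθ
  have key : Tendsto
      (fun δ => ∫ y, |logRatio θ δ y - δ * triScore θ y| / |δ| ∂(law triDensity θ))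
      (𝓝[≠] 0) (𝓝 (∫ _, (0 : ℝ) ∂(law triDensity θ))) := by
    refine tendsto_integral_filter_of_dominated_convergence (fun _ => 2 / margin θ) ?_ ?_
      (integrable_const _) ?_
    · refine Eventually.of_forall fun δ => ?_
      exact (((measurable_logRatio θ δ).sub ((measurable_triScore θ).const_mul δ)).abs.div_const
        _).aestronglyMeasurable
    · have h1 : ∀ᶠ δ : ℝ in 𝓝[≠] 0, |δ| ≤ margin θ := by
        refine nhdsWithin_le_nhds ?_
        filter_upwards [Metric.closedBall_mem_nhds (0 : ℝ) (margin_pos hθ)] with δ hδ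
        simpa using hδ
      filter_upwards [h1, self_mem_nhdsWithin] with δ hδ hδ0
      filter_upwards [law_triDensity_ae hθ] with y hy
      have hp : 0 < |δ| := abs_pos.2 hδ0
      rw [Real.norm_of_nonneg (by positivity), div_le_iff₀ hp]
      refine (abs_sub _ _).trans ?_
      rw [abs_mul]
      have e1 := abs_logRatio_le hθ hδ hy
      have e2 := mul_le_mul_of_nonneg_left (abs_triScore_le_margin (y := y) hθ) hp.le
      calc _ ≤ |δ| / margin θ + |δ| * (1 / margin θ) := add_le_add e1 e2
        _ = _ := by ring
    -- the log-density is differentiable in the mode except at `y = θ`, a null event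
    · have hne : ∀ᵐ y ∂(law triDensity θ), y ≠ θ := by
        rw [ae_iff]; simpa using law_singleton θ θ
      filter_upwards [law_triDensity_ae hθ, hne] with y hy hne
      have h := (hasDerivAt_iff_tendsto_slope_zero.1 (hasDerivAt_log_tent hθ hy hne))
      have h2 := (h.sub_const (triScore θ y)).abs
      rw [sub_self, abs_zero] at h2
      refine h2.congr' ?_
      filter_upwards [self_mem_nhdsWithin] with δ hδ0
      have hδ0 : δ ≠ 0 := hδ0
      rw [← abs_div, smul_eq_mul, logRatio]
      congr 1
      field_simp
  simpa using key

lemma exists_integral_abs_logRatio_le {θ : ℝ} (hθ : θ ∈ Ioo (0 : ℝ) 1) {η : ℝ} (hη : 0 < η) :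
    ∃ d : ℝ, 0 < d ∧ ∀ δ : ℝ, |δ| ≤ d →
      ∫ y, |logRatio θ δ y - δ * triScore θ y| ∂(law triDensity θ) ≤ η * |δ| := by
  have h := (tendsto_integral_abs_logRatio hθ).eventually (gt_mem_nhds hη)
  rw [eventually_nhdsWithin_iff, Metric.eventually_nhds_iff] at h
  obtain ⟨d, hd, h⟩ := h
  refine ⟨d / 2, by positivity, fun δ hδ => ?_⟩
  rcases eq_or_ne δ 0 with rfl | h0
  · simp [logRatio]
  have := h (y := δ) (by rw [Real.dist_eq, sub_zero]; linarith) h0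
  rw [integral_div, div_lt_iff₀ (abs_pos.2 h0)] at this
  exact this.le

/-- The remainder of the local quadratic expansion of the log-likelihood ratio of one
observation. -/
def logRem (θ δ y : ℝ) : ℝ :=
  logRatio θ δ y - δ * triScore θ y + δ ^ 2 * (θ * (1 - θ))⁻¹ / 2

lemma measurable_logRem (θ δ : ℝ) : Measurable (logRem θ δ) :=
  ((measurable_logRatio θ δ).sub ((measurable_triScore θ).const_mul δ)).add_const _

lemma abs_exp_sub_quadratic_le {x : ℝ} (hx : |x| ≤ 1) :
    |Real.exp x - 1 - x - x ^ 2 / 2| ≤ |x| ^ 3 := by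
  have h := Real.exp_bound hx (n := 3) (by norm_num)
  have e : ∑ m ∈ Finset.range 3, x ^ m / (m.factorial : ℝ) = 1 + x + x ^ 2 / 2 := by
    simp [Finset.sum_range_succ, Nat.factorial]
  rw [e] at h
  rw [show Real.exp x - 1 - x - x ^ 2 / 2 = Real.exp x - (1 + x + x ^ 2 / 2) by ring]
  refine h.trans ?_
  have : (0 : ℝ) ≤ |x| ^ 3 := by positivity
  norm_num [Nat.factorial]
  linarith

lemma abs_integral_law_le {θ : ℝ} (hθ : θ ∈ Ioo (0 : ℝ) 1) {g : ℝ → ℝ} {C : ℝ}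
    (h : ∀ y ∈ Ioo (0 : ℝ) 1, |g y| ≤ C) :
    |∫ y, g y ∂(law triDensity θ)| ≤ C := by
  have := isProbabilityMeasure_law hθ
  have h2 : ∀ᵐ y ∂(law triDensity θ), ‖g y‖ ≤ C := by
    filter_upwards [law_triDensity_ae hθ] with y hy using h y hy
  simpa using norm_integral_le_of_norm_le_const h2

/-- Mean and second moment of the remainder are of smaller order than `δ²`. The mean is the
subtle one, since the log-density is not twice differentiable: the normalization
`E exp L = 1` of the log-likelihood ratio `L` gives `E L = -E L² / 2 + O(|δ|³)`. -/
lemma exists_logRem_moments_le {θ : ℝ} (hθ : θ ∈ Ioo (0 : ℝ) 1) {η : ℝ} (hη : 0 < η) :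
    ∃ d : ℝ, 0 < d ∧ ∀ δ : ℝ, |δ| ≤ d →
      |∫ y, logRem θ δ y ∂(law triDensity θ)| ≤ η * δ ^ 2 ∧
      ∫ y, logRem θ δ y ^ 2 ∂(law triDensity θ) ≤ η * δ ^ 2 := by
  have := isProbabilityMeasure_law hθ
  set a := margin θ with ha
  have ha0 : 0 < a := margin_pos hθ
  set I := (θ * (1 - θ))⁻¹ with hI
  have hI0 : 0 < I := inv_pos.2 (mul_pos hθ.1 (by linarith [hθ.2]))
  obtain ⟨d₁, hd₁, hd⟩ := exists_integral_abs_logRatio_le hθ (η := η * a / 8) (by positivity)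
  -- besides the linear expansion and `θ + δ ∈ (0,1)`, the bounds on `|δ|` absorb the cubic error of the
  -- exponential and the square of `δ² I / 2` into `η δ²`
  refine ⟨min d₁ (min a (min (η * a ^ 3 / 2) (min 1 (η / (1 + I ^ 2))))),
    by positivity, fun δ hδ => ?_⟩
  simp only [le_min_iff] at hδ
  obtain ⟨b1, b2, b3, b4, b5⟩ := hδ
  have hd := hd δ b1
  set P := law triDensity θ with hP
  have mL := measurable_logRatio θ δ
  have mS := measurable_triScore θ
  have bL : ∀ y ∈ Ioo (0 : ℝ) 1, |logRatio θ δ y| ≤ |δ| / a := fun y hy =>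
    abs_logRatio_le hθ b2 hy
  have bS : ∀ y, |δ * triScore θ y| ≤ |δ| / a := fun y => by
    rw [abs_mul, div_eq_mul_one_div]
    exact mul_le_mul_of_nonneg_left (abs_triScore_le_margin hθ) (abs_nonneg _)
  have hδa : |δ| / a ≤ 1 := (div_le_one ha0).2 b2
  have iL : Integrable (logRatio θ δ) P := integrable_of_bound_law hθ mL bL
  have iS : Integrable (fun y => δ * triScore θ y) P :=
    integrable_of_bound_law hθ (mS.const_mul δ) fun y _ => bS y
  have iL2 : Integrable (fun y => logRatio θ δ y ^ 2) P :=
    integrable_of_bound_law hθ (mL.pow_const 2) (C := 1) fun y hy => by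
      rw [abs_pow]; exact pow_le_one₀ (abs_nonneg _) ((bL y hy).trans hδa)
  have iS2 : Integrable (fun y => (δ * triScore θ y) ^ 2) P :=
    integrable_of_bound_law hθ ((mS.const_mul δ).pow_const 2) (C := 1) fun y _ => by
      rw [abs_pow]; exact pow_le_one₀ (abs_nonneg _) ((bS y).trans hδa)
  have iD : Integrable (fun y => |logRatio θ δ y - δ * triScore θ y|) P := (iL.sub iS).abs
  have eS : ∫ y, δ * triScore θ y ∂P = 0 := by
    rw [integral_const_mul, integral_triScore hθ, mul_zero]
  have eS2 : ∫ y, (δ * triScore θ y) ^ 2 ∂P = δ ^ 2 * I := by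
    simp_rw [mul_pow]
    rw [integral_const_mul, integral_triScore_sq hθ]
  -- the second moment of the log-likelihood ratio is `δ² I` up to `o(δ²)`
  have q1 : |∫ y, logRatio θ δ y ^ 2 ∂P - δ ^ 2 * I| ≤ η / 4 * δ ^ 2 := by
    rw [← eS2, ← integral_sub iL2 iS2]
    calc |∫ y, (logRatio θ δ y ^ 2 - (δ * triScore θ y) ^ 2) ∂P|
        ≤ ∫ y, |logRatio θ δ y ^ 2 - (δ * triScore θ y) ^ 2| ∂P := abs_integral_le_integral_abs
      _ ≤ ∫ y, 2 * |δ| / a * |logRatio θ δ y - δ * triScore θ y| ∂P := by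
          refine integral_mono_ae (iL2.sub iS2).abs (iD.const_mul _) ?_
          filter_upwards [law_triDensity_ae hθ] with y hy
          rw [sq_sub_sq, abs_mul]
          refine mul_le_mul_of_nonneg_right ((abs_add_le _ _).trans ?_) (abs_nonneg _)
          calc _ ≤ |δ| / a + |δ| / a := add_le_add (bL y hy) (bS y)
            _ = _ := by ring
      _ ≤ 2 * |δ| / a * (η * a / 8 * |δ|) := by
          rw [integral_const_mul]
          exact mul_le_mul_of_nonneg_left hd (by positivity)
      _ = η / 4 * δ ^ 2 := by
          rw [← sq_abs δ]; field_simp; ring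
  -- the normalization `E exp L = 1` expresses the mean of `L` by its second moment
  have q2 : |∫ y, logRatio θ δ y ∂P + (∫ y, logRatio θ δ y ^ 2 ∂P) / 2| ≤ η / 2 * δ ^ 2 := by
    have iE : Integrable (fun y => Real.exp (logRatio θ δ y)) P :=
      integrable_of_bound_law hθ mL.exp (C := Real.exp 1) fun y hy => by
        rw [abs_of_pos (Real.exp_pos _)]
        exact Real.exp_le_exp.2 ((le_abs_self _).trans ((bL y hy).trans hδa))
    have e : ∫ y, logRatio θ δ y ∂P + (∫ y, logRatio θ δ y ^ 2 ∂P) / 2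
        = -∫ y, (Real.exp (logRatio θ δ y) - 1 - logRatio θ δ y - logRatio θ δ y ^ 2 / 2) ∂P := by
      have i1 : Integrable (fun y => Real.exp (logRatio θ δ y) - 1) P :=
        iE.sub (integrable_const _)
      have i2 : Integrable (fun y => Real.exp (logRatio θ δ y) - 1 - logRatio θ δ y) P := i1.sub iL
      rw [integral_sub i2 (iL2.div_const 2),
        integral_sub i1 iL, integral_sub iE (integrable_const _),
        integral_exp_logRatio hθ b2, integral_div]
      simp; ring
    rw [e, abs_neg]
    refine (abs_integral_law_le hθ (C := (|δ| / a) ^ 3) fun y hy =>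
      (abs_exp_sub_quadratic_le ((bL y hy).trans hδa)).trans
        (pow_le_pow_left₀ (abs_nonneg _) (bL y hy) 3)).trans ?_
    rw [div_pow, div_le_iff₀ (by positivity), ← sq_abs δ]
    have := mul_le_mul_of_nonneg_right b3 (sq_nonneg |δ|)
    nlinarith
  constructor
  · have e : ∫ y, logRem θ δ y ∂P = (∫ y, logRatio θ δ y ∂P + (∫ y, logRatio θ δ y ^ 2 ∂P) / 2)
        - (∫ y, logRatio θ δ y ^ 2 ∂P - δ ^ 2 * I) / 2 := by
      have i1 : Integrable (fun y => logRatio θ δ y - δ * triScore θ y) P := iL.sub iS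
      simp only [logRem, ← hI]
      rw [integral_add i1 (integrable_const _), integral_sub iL iS, eS]
      simp; ring
    rw [e]
    refine (abs_sub _ _).trans ?_
    rw [abs_div, abs_two]
    have : 0 ≤ η * δ ^ 2 := by positivity
    linarith
  · have hsq : ∀ y ∈ Ioo (0 : ℝ) 1, logRem θ δ y ^ 2
        ≤ 4 * |δ| / a * |logRatio θ δ y - δ * triScore θ y| + δ ^ 2 * (I ^ 2 / 2 * δ ^ 2) := by
      intro y hy
      have h1 : |logRatio θ δ y - δ * triScore θ y| ≤ 2 * |δ| / a :=
        (abs_sub _ _).trans (by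
          calc _ ≤ |δ| / a + |δ| / a := add_le_add (bL y hy) (bS y)
            _ = _ := by ring)
      have h2 := mul_le_mul_of_nonneg_right h1 (abs_nonneg (logRatio θ δ y - δ * triScore θ y))
      rw [abs_mul_abs_self] at h2
      unfold logRem
      have h3 := sq_nonneg (logRatio θ δ y - δ * triScore θ y - δ ^ 2 * I / 2)
      rw [← hI]
      calc (logRatio θ δ y - δ * triScore θ y + δ ^ 2 * I / 2) ^ 2
          ≤ 2 * ((logRatio θ δ y - δ * triScore θ y) * (logRatio θ δ y - δ * triScore θ y))
            + δ ^ 2 * (I ^ 2 / 2 * δ ^ 2) := by nlinarith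
        _ ≤ 2 * (2 * |δ| / a * |logRatio θ δ y - δ * triScore θ y|)
            + δ ^ 2 * (I ^ 2 / 2 * δ ^ 2) := by linarith
        _ = _ := by ring
    have iB : Integrable (fun y => 4 * |δ| / a * |logRatio θ δ y - δ * triScore θ y|
        + δ ^ 2 * (I ^ 2 / 2 * δ ^ 2)) P := (iD.const_mul _).add (integrable_const _)
    have i0 : Integrable (fun y => logRem θ δ y ^ 2) P := by
      refine iB.mono' ((measurable_logRem θ δ).pow_const 2).aestronglyMeasurable ?_
      filter_upwards [law_triDensity_ae hθ] with y hy
      rw [Real.norm_of_nonneg (sq_nonneg _)]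
      exact hsq y hy
    calc ∫ y, logRem θ δ y ^ 2 ∂P ≤ ∫ y, (4 * |δ| / a * |logRatio θ δ y - δ * triScore θ y|
          + δ ^ 2 * (I ^ 2 / 2 * δ ^ 2)) ∂P := by
          refine integral_mono_ae i0 iB ?_
          filter_upwards [law_triDensity_ae hθ] with y hy using hsq y hy
      _ = 4 * |δ| / a * ∫ y, |logRatio θ δ y - δ * triScore θ y| ∂P
          + δ ^ 2 * (I ^ 2 / 2 * δ ^ 2) := by
          rw [integral_add (iD.const_mul _) (integrable_const _), integral_const_mul]; simp
      _ ≤ 4 * |δ| / a * (η * a / 8 * |δ|) + δ ^ 2 * (η / 2) := by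
          refine add_le_add (mul_le_mul_of_nonneg_left hd (by positivity))
            (mul_le_mul_of_nonneg_left ?_ (sq_nonneg _))
          have h4 : δ ^ 2 ≤ |δ| := by
            rw [← sq_abs]; nlinarith [abs_nonneg δ]
          rw [le_div_iff₀ (by positivity)] at b5
          nlinarith [abs_nonneg δ, sq_nonneg I]
      _ = η * δ ^ 2 := by
          rw [← sq_abs δ]; field_simp; ring

/-- The `χ²`-type bound on the second moment of the likelihood ratio of one observation. -/
lemma integral_exp_two_logRatio_le {θ δ : ℝ} (hθ : θ ∈ Ioo (0 : ℝ) 1) (hδ : |δ| ≤ margin θ) :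
    ∫ y, Real.exp (logRatio θ δ y) ^ 2 ∂(law triDensity θ)
      ≤ Real.exp (4 / margin θ ^ 2 * δ ^ 2) := by
  have := isProbabilityMeasure_law hθ
  have ha0 := margin_pos hθ
  set P := law triDensity θ with hP
  have mL := measurable_logRatio θ δ
  have hδa : |δ| / margin θ ≤ 1 := (div_le_one ha0).2 hδ
  have bL : ∀ y ∈ Ioo (0 : ℝ) 1, |logRatio θ δ y| ≤ 1 := fun y hy =>
    (abs_logRatio_le hθ hδ hy).trans hδa
  have iE : Integrable (fun y => Real.exp (logRatio θ δ y)) P :=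
    integrable_of_bound_law hθ mL.exp (C := Real.exp 1) fun y hy => by
      rw [abs_of_pos (Real.exp_pos _)]
      exact Real.exp_le_exp.2 ((le_abs_self _).trans (bL y hy))
  have bD : ∀ y ∈ Ioo (0 : ℝ) 1, |(Real.exp (logRatio θ δ y) - 1) ^ 2|
      ≤ 4 / margin θ ^ 2 * δ ^ 2 := fun y hy => by
    have h1 := Real.abs_exp_sub_one_le (bL y hy)
    have h2 := h1.trans (mul_le_mul_of_nonneg_left (abs_logRatio_le hθ hδ hy) zero_le_two)
    rw [abs_pow]
    refine (pow_le_pow_left₀ (abs_nonneg _) h2 2).trans_eq ?_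
    rw [mul_pow, div_pow, sq_abs]; ring
  have mD : Measurable (fun y => (Real.exp (logRatio θ δ y) - 1) ^ 2) := by fun_prop
  have iD : Integrable (fun y => (Real.exp (logRatio θ δ y) - 1) ^ 2) P :=
    integrable_of_bound_law hθ mD bD
  have e : ∀ y, Real.exp (logRatio θ δ y) ^ 2
      = 2 * Real.exp (logRatio θ δ y) - 1 + (Real.exp (logRatio θ δ y) - 1) ^ 2 := fun y => by ring
  have i1 : Integrable (fun y => 2 * Real.exp (logRatio θ δ y) - 1) P :=
    (iE.const_mul 2).sub (integrable_const _)
  simp_rw [e]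
  rw [integral_add i1 iD,
    integral_sub (iE.const_mul 2) (integrable_const _), integral_const_mul,
    integral_exp_logRatio hθ hδ]
  have h3 := (le_abs_self _).trans (abs_integral_law_le hθ bD)
  have h4 := Real.add_one_le_exp (4 / margin θ ^ 2 * δ ^ 2)
  simp
  linarith

/-- The exponential moments of the score are subgaussian near zero. -/
lemma integral_exp_triScore_le {θ s : ℝ} (hθ : θ ∈ Ioo (0 : ℝ) 1) (hs : |s| ≤ margin θ) :
    ∫ y, Real.exp (s * triScore θ y) ∂(law triDensity θ)
      ≤ Real.exp (1 / margin θ ^ 2 * s ^ 2) := by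
  have := isProbabilityMeasure_law hθ
  have ha0 := margin_pos hθ
  have mS := (measurable_triScore θ).const_mul s
  have bS : ∀ y, |s * triScore θ y| ≤ |s| / margin θ := fun y => by
    rw [abs_mul, div_eq_mul_one_div]
    exact mul_le_mul_of_nonneg_left (abs_triScore_le_margin hθ) (abs_nonneg _)
  have hsa : |s| / margin θ ≤ 1 := (div_le_one ha0).2 hs
  have iS : Integrable (fun y => s * triScore θ y) (law triDensity θ) :=
    integrable_of_bound_law hθ mS fun y _ => bS y
  have b : ∀ y, Real.exp (s * triScore θ y)
      ≤ 1 + s * triScore θ y + 1 / margin θ ^ 2 * s ^ 2 := fun y => by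
    have h1 := Real.abs_exp_sub_one_sub_id_le ((bS y).trans hsa)
    have h2 := (le_abs_self _).trans h1
    have h3 := pow_le_pow_left₀ (abs_nonneg _) (bS y) 2
    rw [sq_abs, div_pow, sq_abs, div_eq_mul_one_div] at h3
    linarith
  have i1 : Integrable (fun y => 1 + s * triScore θ y) (law triDensity θ) :=
    (integrable_const _).add iS
  have iB : Integrable (fun y => 1 + s * triScore θ y + 1 / margin θ ^ 2 * s ^ 2)
      (law triDensity θ) := i1.add (integrable_const _)
  calc _ ≤ ∫ y, (1 + s * triScore θ y + 1 / margin θ ^ 2 * s ^ 2) ∂(law triDensity θ) :=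
        integral_mono_of_nonneg (ae_of_all _ fun y => (Real.exp_pos _).le) iB (ae_of_all _ b)
    _ = 1 + 1 / margin θ ^ 2 * s ^ 2 := by
        rw [integral_add i1 (integrable_const _),
          integral_add (integrable_const _) iS, integral_const_mul, integral_triScore hθ]
        simp
    _ ≤ _ := by rw [add_comm]; exact Real.add_one_le_exp _

/-- Differentiability in quadratic mean, by dominated convergence. -/
lemma isDQM_tri {θ : ℝ} (hθ : θ ∈ Ioo (0 : ℝ) 1) : IsDQM triDensity θ (triScore θ) := by
  have := isProbabilityMeasure_law hθ
  have ha0 := margin_pos hθ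
  refine ⟨measurable_triScore θ, (integrable_law_iff (fun y => triScore θ y ^ 2) hθ).1
    (integrable_of_bound_law hθ ((measurable_triScore θ).pow_const 2) (C := (1 / margin θ) ^ 2)
      fun y _ => by
        rw [abs_pow]; exact pow_le_pow_left₀ (abs_nonneg _) (abs_triScore_le_margin hθ) 2), ?_⟩
  -- on the support the integrand is `(exp (L/2) - 1 - hℓ/2)² f`
  have e : ∀ᶠ h : ℝ in 𝓝 0, ∫ y, (√(triDensity y (θ + h)) - √(triDensity y θ)
      - 1 / 2 * h * triScore θ y * √(triDensity y θ)) ^ 2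
      = ∫ y, (Real.exp (logRatio θ h y / 2) - 1 - h * triScore θ y / 2) ^ 2
        ∂(law triDensity θ) := by
    filter_upwards [Metric.closedBall_mem_nhds (0 : ℝ) ha0] with h hh
    have hh : |h| ≤ margin θ := by simpa using hh
    have m := Icc_subset_unit ha0 (mem_Icc_margin_add hh)
    rw [integral_law _ hθ]
    refine integral_congr_ae (ae_of_all _ fun y => ?_)
    by_cases hy : y ∈ Ioo (0 : ℝ) 1
    · have p := triDensity_pos hθ hy
      have : √(triDensity y (θ + h)) = Real.exp (logRatio θ h y / 2) * √(triDensity y θ) := by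
        rw [Real.exp_half, exp_logRatio hθ hh hy, ← Real.sqrt_mul (by
          have := triDensity_pos m hy; positivity), div_mul_cancel₀ _ p.ne']
      simp only
      rw [this, show Real.exp (logRatio θ h y / 2) * √(triDensity y θ) - √(triDensity y θ)
        - 1 / 2 * h * triScore θ y * √(triDensity y θ)
        = (Real.exp (logRatio θ h y / 2) - 1 - h * triScore θ y / 2) * √(triDensity y θ) by ring,
        mul_pow, Real.sq_sqrt p.le]
    · simp [triDensity_of_notMem hθ hy, triDensity_of_notMem m hy]
  refine Asymptotics.IsLittleO.congr' (f₁ := fun h => ∫ y, (Real.exp (logRatio θ h y / 2) - 1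
    - h * triScore θ y / 2) ^ 2 ∂(law triDensity θ)) ?_ (e.mono fun _ h => h.symm)
    EventuallyEq.rfl
  rw [Asymptotics.isLittleO_iff]
  intro η hη
  obtain ⟨d, hd, hd'⟩ := exists_integral_abs_logRatio_le hθ (η := η * margin θ / 2) (by positivity)
  filter_upwards [Metric.closedBall_mem_nhds (0 : ℝ) hd, Metric.closedBall_mem_nhds (0 : ℝ) ha0,
    Metric.closedBall_mem_nhds (0 : ℝ) (show 0 < η * margin θ ^ 4 by positivity)]
    with h h1 h2 h3
  have h1 : |h| ≤ d := by simpa using h1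
  have h2 : |h| ≤ margin θ := by simpa using h2
  have h3 : |h| ≤ η * margin θ ^ 4 := by simpa using h3
  have hha : |h| / margin θ ≤ 1 := (div_le_one ha0).2 h2
  have bS : ∀ y, |h * triScore θ y| ≤ |h| / margin θ := fun y => by
    rw [abs_mul, div_eq_mul_one_div]
    exact mul_le_mul_of_nonneg_left (abs_triScore_le_margin hθ) (abs_nonneg _)
  -- the square splits into the quadratic error of the exponential and the squared linearization error;
  -- one factor of the latter is bounded pointwise, the other one in mean
  have hb : ∀ y ∈ Ioo (0 : ℝ) 1, (Real.exp (logRatio θ h y / 2) - 1 - h * triScore θ y / 2) ^ 2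
      ≤ |h| / margin θ * |logRatio θ h y - h * triScore θ y| + (|h| / margin θ) ^ 4 / 8 := by
    intro y hy
    have hL := abs_logRatio_le hθ h2 hy
    have hL2 : |logRatio θ h y / 2| ≤ 1 := by rw [abs_div, abs_two]; linarith
    have t1 := Real.abs_exp_sub_one_sub_id_le hL2
    have t1' : |Real.exp (logRatio θ h y / 2) - 1 - logRatio θ h y / 2|
        ≤ (|h| / margin θ) ^ 2 / 4 := by
      refine t1.trans ?_
      have := pow_le_pow_left₀ (abs_nonneg _) hL 2
      rw [sq_abs] at this
      linarith
    have t2 : |logRatio θ h y - h * triScore θ y| ≤ 2 * (|h| / margin θ) :=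
      (abs_sub _ _).trans (by linarith [bS y])
    set A := Real.exp (logRatio θ h y / 2) - 1 - logRatio θ h y / 2
    set B := logRatio θ h y - h * triScore θ y
    have t3 := pow_le_pow_left₀ (abs_nonneg _) t1' 2
    have t4 := mul_le_mul_of_nonneg_right t2 (abs_nonneg B)
    rw [sq_abs] at t3
    rw [abs_mul_abs_self] at t4
    rw [show Real.exp (logRatio θ h y / 2) - 1 - h * triScore θ y / 2 = A + B / 2 by
      simp only [A, B]; ring]
    nlinarith [sq_nonneg (A - B / 2)]
  have iL : Integrable (logRatio θ h) (law triDensity θ) :=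
    integrable_of_bound_law hθ (measurable_logRatio θ h) fun y hy => abs_logRatio_le hθ h2 hy
  have iS : Integrable (fun y => h * triScore θ y) (law triDensity θ) :=
    integrable_of_bound_law hθ ((measurable_triScore θ).const_mul h) fun y _ => bS y
  have iD : Integrable (fun y => |logRatio θ h y - h * triScore θ y|) (law triDensity θ) :=
    (iL.sub iS).abs
  rw [Real.norm_of_nonneg (integral_nonneg fun y => sq_nonneg _), Real.norm_of_nonneg (sq_nonneg _)]
  calc _ ≤ ∫ y, (|h| / margin θ * |logRatio θ h y - h * triScore θ y|
        + (|h| / margin θ) ^ 4 / 8) ∂(law triDensity θ) := by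
        refine integral_mono_of_nonneg (ae_of_all _ fun y => sq_nonneg _)
          ((iD.const_mul _).add (integrable_const _)) ?_
        filter_upwards [law_triDensity_ae hθ] with y hy using hb y hy
    _ = |h| / margin θ * ∫ y, |logRatio θ h y - h * triScore θ y| ∂(law triDensity θ)
        + (|h| / margin θ) ^ 4 / 8 := by
        rw [integral_add (iD.const_mul _) (integrable_const _), integral_const_mul]; simp
    _ ≤ |h| / margin θ * (η * margin θ / 2 * |h|) + η / 2 * h ^ 2 := by
        refine add_le_add (mul_le_mul_of_nonneg_left (hd' h h1) (by positivity)) ?_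
        have h4 : (|h| / margin θ) ^ 4 ≤ |h| ^ 3 / margin θ ^ 4 * (η * margin θ ^ 4) := by
          rw [div_pow, pow_succ |h| 3, mul_div_right_comm]
          exact mul_le_mul_of_nonneg_left h3 (by positivity)
        have h5 : |h| ^ 3 / margin θ ^ 4 * (η * margin θ ^ 4) = η * |h| ^ 3 := by
          field_simp
        have h6 : |h| ≤ 1 := h2.trans (by
          have := min_le_left θ (1 - θ); unfold margin; linarith [hθ.1, hθ.2])
        have h7 : |h| ^ 3 ≤ h ^ 2 := by
          rw [← sq_abs h, pow_succ]; nlinarith [sq_nonneg |h|]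
        nlinarith
    _ = η * h ^ 2 := by rw [← sq_abs h]; field_simp; ring

/-! ### Sample moments -/

lemma integral_eval_sum {n : ℕ} (μ : Measure ℝ) [IsProbabilityMeasure μ] {g : ℝ → ℝ}
    (hg : MemLp g 2 μ) :
    ∫ y, ∑ i : Fin n, g (y i) ∂(Measure.pi fun _ => μ) = n * ∫ x, g x ∂μ := by
  have h1 : Integrable g μ := hg.integrable (by norm_num)
  have e : ∀ i : Fin n, ∫ y, g (y i) ∂(Measure.pi fun _ : Fin n => μ) = ∫ x, g x ∂μ := fun i =>
    integral_comp_eval (μ := fun _ : Fin n => μ) h1.aestronglyMeasurable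
  rw [integral_finsetSum _ fun i _ => ?_]
  · simp [e]
  · exact integrable_comp_eval (μ := fun _ : Fin n => μ) h1

/-- Second moment of a sum over an independent sample. -/
lemma integral_sum_sq_le {n : ℕ} (μ : Measure ℝ) [IsProbabilityMeasure μ] {g : ℝ → ℝ}
    (hg : MemLp g 2 μ) :
    ∫ y, (∑ i : Fin n, g (y i)) ^ 2 ∂(Measure.pi fun _ => μ)
      ≤ n * ∫ x, g x ^ 2 ∂μ + n ^ 2 * (∫ x, g x ∂μ) ^ 2 := by
  have hm : ∀ i : Fin n, MemLp (fun y : Fin n → ℝ => g (y i)) 2 (Measure.pi fun _ => μ) :=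
    fun i => hg.comp_measurePreserving (measurePreserving_eval (fun _ => μ) i)
  have hs : MemLp (fun y : Fin n → ℝ => ∑ i, g (y i)) 2 (Measure.pi fun _ => μ) :=
    memLp_finsetSum _ fun i _ => hm i
  have h1 := variance_sum_pi (μ := fun _ : Fin n => μ) (X := fun _ => g) fun _ => hg
  have e : (∑ i : Fin n, fun ω : Fin n → ℝ => g (ω i)) = fun y => ∑ i, g (y i) := by
    ext y; simp
  rw [e, variance_eq_sub hs] at h1
  simp only [Finset.sum_const, Finset.card_univ, Fintype.card_fin, nsmul_eq_mul,
    variance_eq_sub hg, Pi.pow_apply] at h1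
  rw [integral_eval_sum μ hg] at h1
  have : 0 ≤ (n : ℝ) * (∫ x, g x ∂μ) ^ 2 := by positivity
  nlinarith

lemma memLp_of_bound_law {θ : ℝ} (hθ : θ ∈ Ioo (0 : ℝ) 1) {g : ℝ → ℝ} (hg : Measurable g)
    {C : ℝ} (h : ∀ y ∈ Ioo (0 : ℝ) 1, |g y| ≤ C) : MemLp g 2 (law triDensity θ) := by
  have := isProbabilityMeasure_law hθ
  refine MemLp.of_bound hg.aestronglyMeasurable C ?_
  filter_upwards [law_triDensity_ae hθ] with y hy using h y hy

/-- Chebyshev's inequality for the second moment. -/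
lemma measure_abs_ge_le {Ω : Type*} [MeasurableSpace Ω] {P : Measure Ω} [IsProbabilityMeasure P]
    {X : Ω → ℝ} (hX : Integrable (fun ω => X ω ^ 2) P) {τ : ℝ} (hτ : 0 < τ) :
    P {ω | τ ≤ |X ω|} ≤ ENNReal.ofReal ((∫ ω, X ω ^ 2 ∂P) / τ ^ 2) := by
  have h := mul_meas_ge_le_integral_of_nonneg (ae_of_all P fun ω => sq_nonneg (X ω)) hX (τ ^ 2)
  have e : {ω | τ ^ 2 ≤ X ω ^ 2} = {ω | τ ≤ |X ω|} := by
    ext ω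
    simp only [mem_ofPred_eq]
    rw [← sq_abs (X ω), sq_le_sq₀ hτ.le (abs_nonneg _)]
  rw [e] at h
  rw [← ofReal_measureReal]
  refine ENNReal.ofReal_le_ofReal ?_
  rw [le_div_iff₀ (by positivity)]
  linarith

lemma integrable_of_bound_sampleLaw {n : ℕ} {θ : ℝ} (hθ : θ ∈ Ioo (0 : ℝ) 1)
    {g : (Fin n → ℝ) → ℝ} (hg : Measurable g) {C : ℝ}
    (h : ∀ y, (∀ i, y i ∈ Ioo (0 : ℝ) 1) → |g y| ≤ C) :
    Integrable g (sampleLaw triDensity n θ) := by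
  have := isProbabilityMeasure_sampleLaw (n := n) hθ
  refine Integrable.of_bound hg.aestronglyMeasurable C ?_
  filter_upwards [sampleLaw_ae hθ] with y hy using h y hy

lemma integral_sampleLaw {n : ℕ} (g : (Fin n → ℝ) → ℝ) {θ : ℝ} (hθ : θ ∈ Ioo (0 : ℝ) 1) :
    ∫ y, g y ∂(sampleLaw triDensity n θ) = ∫ y, g y * likelihood triDensity n y θ := by
  rw [sampleLaw_eq_withDensity hθ, integral_withDensity_eq_integral_toReal_smul
    (measurable_likelihood_left n θ).ennreal_ofReal (ae_of_all _ fun _ => ENNReal.ofReal_lt_top)]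
  refine integral_congr_ae (ae_of_all _ fun y => ?_)
  simp only [smul_eq_mul]
  rw [ENNReal.toReal_ofReal (likelihood_nonneg hθ), mul_comm]

/-! ### Exponentially consistent tests -/

/-- The centred number of observations below `θ₀`. -/
def countStat (θ₀ : ℝ) {n : ℕ} (y : Fin n → ℝ) : ℝ :=
  ∑ i, ((Iic θ₀).indicator 1 (y i) - θ₀)

lemma measurable_countStat (θ₀ : ℝ) (n : ℕ) :
    Measurable (countStat θ₀ : (Fin n → ℝ) → ℝ) := by
  refine Finset.measurable_sum _ fun i _ => ?_
  exact ((measurable_one.indicator measurableSet_Iic).comp (measurable_pi_apply i)).sub_const _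

/-- Hoeffding's inequality for the number of observations below `θ₀`. -/
lemma sampleLaw_countStat_le {n : ℕ} {θ θ₀ s : ℝ} (hθ : θ ∈ Ioo (0 : ℝ) 1)
    (hθ₀ : θ₀ ∈ Ioo (0 : ℝ) 1) (hs : 0 ≤ s) :
    (sampleLaw triDensity n θ).real {y | s ≤ |countStat θ₀ y - n * (triCDF θ₀ θ - θ₀)|}
      ≤ 2 * Real.exp (-(2 * s ^ 2 / n)) := by
  have := isProbabilityMeasure_law hθ
  have := isProbabilityMeasure_sampleLaw (n := n) hθ
  set g : ℝ → ℝ := fun x => (Iic θ₀).indicator 1 x - triCDF θ₀ θ with hg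
  have mI : Measurable ((Iic θ₀).indicator (1 : ℝ → ℝ)) := measurable_one.indicator measurableSet_Iic
  have mg : Measurable g := mI.sub_const _
  have sub : HasSubgaussianMGF g ((‖(1 : ℝ) - 0‖₊ / 2) ^ 2) (law triDensity θ) := by
    have := hasSubgaussianMGF_of_mem_Icc (μ := law triDensity θ) (X := (Iic θ₀).indicator 1)
      (a := 0) (b := 1) mI.aemeasurable (ae_of_all _ fun x => by
        by_cases h : x ∈ Iic θ₀ <;> simp [h])
    rwa [integral_indicator_Iic hθ hθ₀] at this
  -- one tail; the other one is the same statement for `-g`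
  have main : ∀ k : ℝ → ℝ, Measurable k →
      HasSubgaussianMGF k ((‖(1 : ℝ) - 0‖₊ / 2) ^ 2) (law triDensity θ) →
      (sampleLaw triDensity n θ).real {y | s ≤ ∑ i, k (y i)} ≤ Real.exp (-(2 * s ^ 2 / n)) := by
    intro k mk hk
    have hsub : ∀ i ∈ (Finset.univ : Finset (Fin n)),
        HasSubgaussianMGF (fun y : Fin n → ℝ => k (y i)) ((‖(1 : ℝ) - 0‖₊ / 2) ^ 2)
          (sampleLaw triDensity n θ) := fun i _ => by
      refine HasSubgaussianMGF.of_map (Y := fun y : Fin n → ℝ => y i) (X := k)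
        (measurable_pi_apply i).aemeasurable ?_
      rw [sampleLaw, (measurePreserving_eval (fun _ : Fin n => law triDensity θ) i).map_eq]
      exact hk
    have h := HasSubgaussianMGF.measure_sum_ge_le_of_iIndepFun
      (iIndepFun_pi (μ := fun _ : Fin n => law triDensity θ) (X := fun _ => k)
        fun _ => mk.aemeasurable) hsub hs
    refine h.trans_eq ?_
    congr 1
    simp
    ring
  have e : ∀ y : Fin n → ℝ, countStat θ₀ y - n * (triCDF θ₀ θ - θ₀) = ∑ i, g (y i) := by
    intro y
    simp only [countStat, hg, Finset.sum_sub_distrib, Finset.sum_const, Finset.card_univ,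
      Fintype.card_fin, nsmul_eq_mul]
    ring
  have hsubset : {y : Fin n → ℝ | s ≤ |countStat θ₀ y - n * (triCDF θ₀ θ - θ₀)|}
      ⊆ {y | s ≤ ∑ i, g (y i)} ∪ {y | s ≤ ∑ i, (-g) (y i)} := by
    intro y hy
    simp only [mem_ofPred_eq, e] at hy
    rcases le_abs.1 hy with h | h
    · exact Or.inl h
    · right
      simpa using h
  refine (measureReal_mono hsubset).trans ((measureReal_union_le _ _).trans ?_)
  rw [two_mul]
  exact add_le_add (main g mg sub) (main (-g) mg.neg sub.neg)

/-- The mean number of observations below `θ₀` separates `θ₀` from the other modes linearly. -/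
lemma abs_triCDF_sub_ge {θ θ₀ : ℝ} (hθ : θ ∈ Ioo (0 : ℝ) 1) (hθ₀ : θ₀ ∈ Ioo (0 : ℝ) 1) :
    margin θ₀ * |θ - θ₀| ≤ |triCDF θ₀ θ - θ₀| := by
  have h1 := hθ.1
  have h2 : 0 < 1 - θ := by linarith [hθ.2]
  have h3 := hθ₀.1
  have h4 : 0 < 1 - θ₀ := by linarith [hθ₀.2]
  have m1 : margin θ₀ ≤ θ₀ := by
    have := min_le_left θ₀ (1 - θ₀); unfold margin; linarith
  have m2 : margin θ₀ ≤ 1 - θ₀ := by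
    have := min_le_right θ₀ (1 - θ₀); unfold margin; linarith
  rcases le_or_gt θ₀ θ with h | h
  · rw [triCDF_of_le h, abs_of_nonneg (sub_nonneg.2 h), abs_sub_comm]
    refine le_trans ?_ (le_abs_self _)
    have e : θ₀ - θ₀ ^ 2 / θ = θ₀ * ((θ - θ₀) / θ) := by field_simp
    rw [e]
    have : θ - θ₀ ≤ (θ - θ₀) / θ := by
      rw [le_div_iff₀ h1]; nlinarith [hθ.2]
    exact mul_le_mul m1 this (sub_nonneg.2 h) h3.le
  · rw [triCDF_of_gt h, abs_sub_comm θ, abs_of_pos (sub_pos.2 h)]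
    refine le_trans ?_ (le_abs_self _)
    have e : 1 - (1 - θ₀) ^ 2 / (1 - θ) - θ₀ = (1 - θ₀) * ((θ₀ - θ) / (1 - θ)) := by
      field_simp; ring
    rw [e]
    have : θ₀ - θ ≤ (θ₀ - θ) / (1 - θ) := by
      rw [le_div_iff₀ h2]; nlinarith
    exact mul_le_mul m2 this (sub_pos.2 h).le h4.le

/-- The error of second kind of the test that rejects when the counting statistic exceeds `t`. -/
lemma sampleLaw_countStat_lt {n : ℕ} {θ θ₀ t : ℝ} (hθ : θ ∈ Ioo (0 : ℝ) 1)
    (hθ₀ : θ₀ ∈ Ioo (0 : ℝ) 1) (ht : t ≤ n * (margin θ₀ * |θ - θ₀|) / 2) :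
    (sampleLaw triDensity n θ).real {y | |countStat θ₀ y| < t}
      ≤ 2 * Real.exp (-(n * (margin θ₀ * |θ - θ₀|) ^ 2 / 2)) := by
  have := isProbabilityMeasure_sampleLaw (n := n) hθ
  have hm := margin_pos hθ₀
  refine le_trans (measureReal_mono fun y hy => ?_) ((sampleLaw_countStat_le hθ hθ₀
    (s := n * (margin θ₀ * |θ - θ₀|) / 2) (by positivity)).trans_eq ?_)
  · simp only [mem_ofPred_eq] at hy ⊢
    have h1 := mul_le_mul_of_nonneg_left (abs_triCDF_sub_ge hθ hθ₀) (Nat.cast_nonneg (α := ℝ) n)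
    have h2 := abs_sub_abs_le_abs_sub (n * (triCDF θ₀ θ - θ₀)) (countStat θ₀ y)
    rw [abs_mul, Nat.abs_cast, abs_sub_comm _ (countStat θ₀ y)] at h2
    linarith
  · congr 2
    rcases Nat.eq_zero_or_pos n with rfl | hn
    · simp
    · have : (0 : ℝ) < n := by exact_mod_cast hn
      field_simp

lemma sampleLaw_countStat_ge {n : ℕ} {θ₀ t : ℝ} (hθ₀ : θ₀ ∈ Ioo (0 : ℝ) 1) (ht : 0 ≤ t) :
    (sampleLaw triDensity n θ₀).real {y | t ≤ |countStat θ₀ y|}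
      ≤ 2 * Real.exp (-(2 * t ^ 2 / n)) := by
  have := sampleLaw_countStat_le (n := n) hθ₀ hθ₀ ht
  simpa [triCDF_mode hθ₀] using this

lemma expConsistentTests_tri {θ₀ : ℝ} (hθ₀ : θ₀ ∈ Ioo (0 : ℝ) 1) :
    ExpConsistentTests triDensity (Ioo 0 1) θ₀ (likelihood triDensity) := by
  intro ε hε
  have hm := margin_pos hθ₀
  set a := margin θ₀ with ha
  -- from the sample size `N` on, the factor `2` of Hoeffding's inequality is absorbed in the rate
  obtain ⟨N, hN⟩ := exists_nat_ge (4 * Real.log 2 / (a * ε) ^ 2)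
  set R : (n : ℕ) → Set (Fin n → ℝ) := fun n => {y | n * (a * ε) / 2 ≤ |countStat θ₀ y|} with hR
  have mR : ∀ n, MeasurableSet (R n) := fun n =>
    measurableSet_le measurable_const (measurable_countStat θ₀ n).abs
  refine ⟨fun n y => if n < N then 1 else (R n).indicator 1 y, a ^ 2 / 4, by positivity,
    fun n => ⟨?_, fun y => ?_⟩, ?_, ?_⟩
  · simp only
    split_ifs
    · exact measurable_const
    · exact measurable_one.indicator (mR n)
  · simp only
    split_ifs
    · simp
    · by_cases h : y ∈ R n <;> simp [h]
  · have h0 : Tendsto (fun n : ℕ => 2 * Real.exp (-(n * ((a * ε) ^ 2 / 2)))) atTop (𝓝 0) := by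
      rw [← mul_zero (2 : ℝ)]
      refine Tendsto.const_mul _ (Real.tendsto_exp_neg_atTop_nhds_zero.comp ?_)
      exact tendsto_natCast_atTop_atTop.atTop_mul_const (by positivity)
    refine tendsto_of_tendsto_of_tendsto_of_le_of_le' tendsto_const_nhds h0
      (Eventually.of_forall fun n => integral_nonneg fun y => ?_) ?_
    · simp only
      split_ifs
      · simp
      · exact indicator_nonneg (by simp) _
    · filter_upwards [eventually_ge_atTop N, eventually_gt_atTop 0] with n hn hn0
      have hn0 : (0 : ℝ) < n := by exact_mod_cast hn0
      simp only [not_lt.2 hn, if_false]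
      rw [integral_indicator_one (mR n)]
      refine (sampleLaw_countStat_ge hθ₀ (by positivity)).trans_eq ?_
      congr 2
      field_simp
  · intro n θ hθ hd
    have := isProbabilityMeasure_sampleLaw (n := n) hθ
    -- the rate is half of the exponent in `sampleLaw_countStat_lt`; the other half absorbs the factor `2`
    have key : ∫ y, (1 - (if n < N then (1 : ℝ) else (R n).indicator 1 y))
        ∂(sampleLaw triDensity n θ) ≤ Real.exp (-(a ^ 2 / 4 * n * min (|θ - θ₀| ^ 2) 1)) := by
      split_ifs with h
      · simp; positivity
      · have e : ∀ y, (1 : ℝ) - (R n).indicator 1 y = ((R n)ᶜ).indicator 1 y := fun y => by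
          by_cases h : y ∈ R n <;> simp [h]
        simp_rw [e]
        rw [integral_indicator_one (mR n).compl]
        have e2 : (R n)ᶜ = {y : Fin n → ℝ | |countStat θ₀ y| < n * (a * ε) / 2} := by
          ext y; simp [hR]
        rw [e2]
        refine (sampleLaw_countStat_lt hθ hθ₀ (by gcongr)).trans ?_
        rw [← ha]
        have h2 : (2 : ℝ) = Real.exp (Real.log 2) := (Real.exp_log two_pos).symm
        calc 2 * Real.exp (-(n * (a * |θ - θ₀|) ^ 2 / 2))
            = Real.exp (Real.log 2 + -(n * (a * |θ - θ₀|) ^ 2 / 2)) := by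
              rw [Real.exp_add, ← h2]
          _ ≤ _ := by
              refine Real.exp_le_exp.2 ?_
              have hnN : (N : ℝ) ≤ n := by exact_mod_cast not_lt.1 h
              have h3 : Real.log 2 ≤ n * (a * ε) ^ 2 / 4 := by
                have := hN.trans hnN
                rw [div_le_iff₀ (by positivity)] at this
                linarith
              have h4 : (n : ℝ) * (a * ε) ^ 2 ≤ n * (a * |θ - θ₀|) ^ 2 := by gcongr
              have h5 : a ^ 2 / 4 * n * min (|θ - θ₀| ^ 2) 1 ≤ a ^ 2 / 4 * n * |θ - θ₀| ^ 2 := by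
                gcongr; exact min_le_left _ _
              nlinarith
    exact ⟨key, by rw [integral_sampleLaw _ hθ] at key; exact key⟩

/-- The factorization of the likelihood into itself and the indicator of the support: the Jacobian
is bounded, so no likelihood factor is needed to control it away from the true mode. -/
lemma likelihoodSplits_tri {θ₀ D : ℝ} (hθ₀ : θ₀ ∈ Ioo (0 : ℝ) 1) :
    LikelihoodSplits triDensity (jacobian triDGA) (Ioo 0 1) θ₀ D (likelihood triDensity)
      (fun n y _ => (univ.pi fun _ : Fin n => Ioo (0 : ℝ) 1).indicator 1 y) := by
  have mB : ∀ n, MeasurableSet (univ.pi fun _ : Fin n => Ioo (0 : ℝ) 1) := fun n =>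
    MeasurableSet.univ_pi fun _ => measurableSet_Ioo
  refine ⟨fun n => ⟨measurable_likelihood n, fun θ hθ =>
    ⟨fun y => likelihood_nonneg hθ, integrable_likelihood hθ⟩⟩,
    fun n => ⟨(measurable_one.indicator (mB n)).comp measurable_fst, fun θ hθ =>
      ⟨fun y => indicator_nonneg (by simp) _, ?_⟩⟩, fun n y θ hθ => ?_,
    fun _ => 1 / 2, measurable_const, fun _ => by norm_num, ?_, ?_⟩
  · refine (integrable_indicator_iff (mB n)).2 (integrableOn_const ?_)
    simp [volume_pi_pi]
  · simp only
    by_cases h : ∀ i, y i ∈ Ioo (0 : ℝ) 1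
    · rw [indicator_of_mem (mem_univ_pi.2 h)]; simp
    · rw [likelihood_of_notMem hθ h, indicator_of_notMem (mt mem_univ_pi.1 h), mul_zero]
  · exact integrableOn_const (by simp)
  · refine tendsto_const_nhds.congr fun n => ?_
    have := isProbabilityMeasure_sampleLaw (n := n) hθ₀
    symm
    rw [← measure_univ (μ := sampleLaw triDensity n θ₀)]
    refine measure_congr ?_
    filter_upwards [sampleLaw_ae hθ₀] with y hy
    refine eq_true ?_
    intro θ hθ _
    rw [indicator_of_mem (by simpa using hy), jacobian_triDGA hy hθ, Pi.one_apply, one_mul]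
    exact triJac_le hθ

/-! ### The Jacobian -/

lemma triLimit_sq {θ₀ θ : ℝ} :
    triLimit θ₀ θ ^ 2 = ∫ y, triGradient y θ ^ 2 ∂(law triDensity θ₀) :=
  Real.sq_sqrt (integral_nonneg fun _ => sq_nonneg _)

lemma triLimit_nonneg {θ₀ θ : ℝ} : 0 ≤ triLimit θ₀ θ := Real.sqrt_nonneg _

lemma triGradient_sq_le {y θ : ℝ} (hθ : θ ∈ Ioo (0 : ℝ) 1) : triGradient y θ ^ 2 ≤ 1 / 4 := by
  have := pow_le_pow_left₀ (triGradient_nonneg (y := y) hθ) (triGradient_le hθ) 2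
  linarith

lemma abs_triGradient_sq_le {y θ : ℝ} (hθ : θ ∈ Ioo (0 : ℝ) 1) : |triGradient y θ ^ 2| ≤ 1 / 4 := by
  rw [abs_of_nonneg (sq_nonneg _)]; exact triGradient_sq_le hθ

lemma measurable_triLimit {θ₀ : ℝ} (hθ₀ : θ₀ ∈ Ioo (0 : ℝ) 1) : Measurable (triLimit θ₀) := by
  have := isProbabilityMeasure_law hθ₀
  have h : StronglyMeasurable (fun z : ℝ × ℝ => triGradient z.2 z.1 ^ 2) :=
    ((measurable_triGradient.comp measurable_swap).pow_const 2).stronglyMeasurable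
  exact (h.integral_prod_right' (ν := law triDensity θ₀)).measurable.sqrt

lemma integrable_triGradient_sq {θ₀ θ : ℝ} (hθ₀ : θ₀ ∈ Ioo (0 : ℝ) 1) (hθ : θ ∈ Ioo (0 : ℝ) 1) :
    Integrable (fun y => triGradient y θ ^ 2) (law triDensity θ₀) :=
  integrable_of_bound_law hθ₀ ((measurable_triGradient_left θ).pow_const 2)
    fun _ _ => abs_triGradient_sq_le hθ

lemma abs_triGradient_sq_sub_le {a y θ θ' : ℝ} (ha : 0 < a) (hθ : θ ∈ Icc a (1 - a))
    (hθ' : θ' ∈ Icc a (1 - a)) (hy : y ∈ Ioo (0 : ℝ) 1) :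
    |triGradient y θ ^ 2 - triGradient y θ' ^ 2| ≤ |θ - θ'| / a := by
  have m := Icc_subset_unit ha hθ
  have m' := Icc_subset_unit ha hθ'
  rw [sq_sub_sq, abs_mul, triGradient_of_mem m hy, triGradient_of_mem m' hy, ← sub_div, abs_div,
    abs_two]
  have h := abs_tent_sub_le ha hθ hθ' hy
  have p := tent_pos m hy
  have p' := tent_pos m' hy
  have q := tent_le_one (y := y) m
  have q' := tent_le_one (y := y) m'
  rw [abs_of_pos (by positivity)]
  have : tent y θ / 2 + tent y θ' / 2 ≤ 1 := by linarith
  nlinarith [abs_nonneg (tent y θ - tent y θ')]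

lemma abs_triLimit_sq_sub_le {a θ₀ θ θ' : ℝ} (hθ₀ : θ₀ ∈ Ioo (0 : ℝ) 1) (ha : 0 < a)
    (hθ : θ ∈ Icc a (1 - a)) (hθ' : θ' ∈ Icc a (1 - a)) :
    |triLimit θ₀ θ ^ 2 - triLimit θ₀ θ' ^ 2| ≤ |θ - θ'| / a := by
  rw [triLimit_sq, triLimit_sq, ← integral_sub
    (integrable_triGradient_sq hθ₀ (Icc_subset_unit ha hθ))
    (integrable_triGradient_sq hθ₀ (Icc_subset_unit ha hθ'))]
  exact abs_integral_law_le hθ₀ fun y hy => abs_triGradient_sq_sub_le ha hθ hθ' hy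

lemma abs_triJac_sq_sub_le {n : ℕ} (hn : 0 < n) {a θ θ' : ℝ} (ha : 0 < a)
    (hθ : θ ∈ Icc a (1 - a)) (hθ' : θ' ∈ Icc a (1 - a)) {y : Fin n → ℝ}
    (hy : ∀ i, y i ∈ Ioo (0 : ℝ) 1) :
    |triJac n y θ ^ 2 - triJac n y θ' ^ 2| ≤ |θ - θ'| / a := by
  have hn' : (0 : ℝ) < n := by exact_mod_cast hn
  rw [triJac_sq, triJac_sq, ← mul_sub, ← Finset.sum_sub_distrib, abs_mul,
    abs_of_pos (by positivity), one_div, inv_mul_le_iff₀ hn']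
  refine (Finset.abs_sum_le_sum_abs _ _).trans ?_
  refine (Finset.sum_le_sum fun i _ => abs_triGradient_sq_sub_le ha hθ hθ' (hy i)).trans_eq ?_
  simp

/-- The squared Jacobian is an empirical mean, so it concentrates at rate `n^{-1/2}`. -/
lemma integral_triJac_sq_sub_sq_le {n : ℕ} (hn : 0 < n) {θ₀ θ : ℝ} (hθ₀ : θ₀ ∈ Ioo (0 : ℝ) 1)
    (hθ : θ ∈ Ioo (0 : ℝ) 1) :
    ∫ y, (triJac n y θ ^ 2 - triLimit θ₀ θ ^ 2) ^ 2 ∂(sampleLaw triDensity n θ₀) ≤ 1 / n := by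
  have := isProbabilityMeasure_law hθ₀
  have hn' : (0 : ℝ) < n := by exact_mod_cast hn
  have l1 : 0 ≤ triLimit θ₀ θ ^ 2 := sq_nonneg _
  have l2 : triLimit θ₀ θ ^ 2 ≤ 1 / 4 := by
    rw [triLimit_sq]
    exact (le_abs_self _).trans (abs_integral_law_le hθ₀ fun y _ => abs_triGradient_sq_le hθ)
  set g : ℝ → ℝ := fun y => triGradient y θ ^ 2 - triLimit θ₀ θ ^ 2 with hg
  have bg : ∀ y, |g y| ≤ 1 := fun y => by
    have h1 := triGradient_sq_le (y := y) hθ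
    have h2 := sq_nonneg (triGradient y θ)
    rw [abs_le]; constructor <;> simp only [hg] <;> linarith
  have mg : Measurable g := ((measurable_triGradient_left θ).pow_const 2).sub_const _
  have h := integral_sum_sq_le (n := n) (law triDensity θ₀)
    (memLp_of_bound_law hθ₀ mg fun y _ => bg y)
  have e0 : ∫ x, g x ∂(law triDensity θ₀) = 0 := by
    simp only [hg]
    rw [integral_sub (integrable_triGradient_sq hθ₀ hθ) (integrable_const _), triLimit_sq]
    simp
  have e1 : ∫ x, g x ^ 2 ∂(law triDensity θ₀) ≤ 1 :=
    (le_abs_self _).trans (abs_integral_law_le hθ₀ fun y _ => by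
      rw [abs_pow]; exact pow_le_one₀ (abs_nonneg _) (bg y))
  have e2 : ∀ y : Fin n → ℝ, triJac n y θ ^ 2 - triLimit θ₀ θ ^ 2 = 1 / n * ∑ i, g (y i) := by
    intro y
    simp only [hg, triJac_sq, Finset.sum_sub_distrib, Finset.sum_const, Finset.card_univ,
      Fintype.card_fin, nsmul_eq_mul]
    field_simp
  simp_rw [e2, mul_pow]
  rw [integral_const_mul]
  rw [e0] at h
  have h' : ∫ y, (∑ i : Fin n, g (y i)) ^ 2 ∂(sampleLaw triDensity n θ₀) ≤ n := by
    refine h.trans ?_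
    nlinarith
  calc _ ≤ (1 / (n : ℝ)) ^ 2 * n := mul_le_mul_of_nonneg_left h' (by positivity)
    _ = _ := by field_simp

lemma measurable_triJac_left (n : ℕ) (θ : ℝ) :
    Measurable (fun y : Fin n → ℝ => triJac n y θ) := by
  unfold triJac
  refine (Measurable.const_mul (Finset.measurable_sum _ fun i _ => ?_) _).sqrt
  exact ((measurable_triGradient_left θ).comp (measurable_pi_apply i)).pow_const 2

lemma integrable_triJac_sq_sub_sq {n : ℕ} {θ₀ θ : ℝ} (hθ₀ : θ₀ ∈ Ioo (0 : ℝ) 1)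
    (hθ : θ ∈ Ioo (0 : ℝ) 1) (c : ℝ) :
    Integrable (fun y => (triJac n y θ ^ 2 - c) ^ 2) (sampleLaw triDensity n θ₀) := by
  have m := measurable_triJac_left n θ
  have m2 : Measurable (fun y : Fin n → ℝ => (triJac n y θ ^ 2 - c) ^ 2) := by fun_prop
  refine integrable_of_bound_sampleLaw hθ₀ m2 (C := (1 + |c|) ^ 2) fun y _ => ?_
  rw [abs_pow]
  refine pow_le_pow_left₀ (abs_nonneg _) ((abs_sub _ _).trans ?_) 2
  have h1 := triJac_le (n := n) (y := y) hθ
  have h2 := triJac_nonneg (n := n) (y := y) (θ := θ)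
  refine add_le_add ?_ le_rfl
  rw [abs_of_nonneg (sq_nonneg _), sq]
  exact mul_le_one₀ (h1.trans (by norm_num)) h2 (h1.trans (by norm_num))

/-- A lower bound for the square of the limiting density `π`, the same for all modes: the tent
function with any mode dominates `min y (1 - y)`. -/
def limitFloor (θ₀ : ℝ) : ℝ := ∫ y, min y (1 - y) ^ 2 / 4 ∂(law triDensity θ₀)

lemma min_sq_bound {y : ℝ} (hy : y ∈ Ioo (0 : ℝ) 1) : |min y (1 - y) ^ 2 / 4| ≤ 1 := by
  have h1 : 0 < min y (1 - y) := lt_min hy.1 (by linarith [hy.2])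
  have h2 : min y (1 - y) ≤ 1 := (min_le_left _ _).trans hy.2.le
  rw [abs_of_nonneg (by positivity)]
  nlinarith

lemma limitFloor_pos {θ₀ : ℝ} (hθ₀ : θ₀ ∈ Ioo (0 : ℝ) 1) : 0 < limitFloor θ₀ := by
  have := isProbabilityMeasure_law hθ₀
  have i : Integrable (fun y : ℝ => min y (1 - y) ^ 2 / 4) (law triDensity θ₀) :=
    integrable_of_bound_law hθ₀ (by fun_prop) fun y hy => min_sq_bound hy
  refine (integral_pos_iff_support_of_nonneg_ae (ae_of_all _ fun y => by positivity) i).2 ?_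
  rw [pos_iff_ne_zero]
  intro h
  have h1 : ∀ᵐ y ∂(law triDensity θ₀), False := by
    filter_upwards [law_triDensity_ae hθ₀, measure_eq_zero_iff_ae_notMem.1 h] with y hy hy2
    refine hy2 ?_
    have : 0 < min y (1 - y) := lt_min hy.1 (by linarith [hy.2])
    simp only [Function.mem_support]
    positivity
  simp at h1
  exact (IsProbabilityMeasure.ne_zero _) h1

lemma min_le_tent {y θ : ℝ} (hθ : θ ∈ Ioo (0 : ℝ) 1) (hy : y ∈ Ioo (0 : ℝ) 1) :
    min y (1 - y) ≤ tent y θ := by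
  have h1 := hθ.1
  have h2 : 0 < 1 - θ := by linarith [hθ.2]
  have h3 := hy.1
  have h4 : 0 < 1 - y := by linarith [hy.2]
  refine min_le_min ?_ ?_
  · rw [le_div_iff₀ h1]; nlinarith [hθ.2]
  · rw [le_div_iff₀ h2]; nlinarith

lemma limitFloor_le {θ₀ θ : ℝ} (hθ₀ : θ₀ ∈ Ioo (0 : ℝ) 1) (hθ : θ ∈ Ioo (0 : ℝ) 1) :
    limitFloor θ₀ ≤ triLimit θ₀ θ ^ 2 := by
  rw [triLimit_sq]
  refine integral_mono_of_nonneg (ae_of_all _ fun y => by positivity)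
    (integrable_triGradient_sq hθ₀ hθ) ?_
  filter_upwards [law_triDensity_ae hθ₀] with y hy
  have h1 : 0 < min y (1 - y) := lt_min hy.1 (by linarith [hy.2])
  have h2 := min_le_tent hθ hy
  rw [triGradient_of_mem hθ hy, div_pow]
  have := pow_le_pow_left₀ h1.le h2 2
  linarith

lemma triLimit_pos {θ₀ θ : ℝ} (hθ₀ : θ₀ ∈ Ioo (0 : ℝ) 1) (hθ : θ ∈ Ioo (0 : ℝ) 1) :
    0 < triLimit θ₀ θ := by
  have h := (limitFloor_pos hθ₀).trans_le (limitFloor_le hθ₀ hθ)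
  exact triLimit_nonneg.lt_of_ne fun h' => by simp [← h'] at h

lemma limitMass_tri {θ₀ : ℝ} (hθ₀ : θ₀ ∈ Ioo (0 : ℝ) 1) : LimitMass (triLimit θ₀) θ₀ := by
  refine ⟨?_, triLimit_pos hθ₀ hθ₀⟩
  have ha := margin_pos hθ₀
  have h : ContinuousAt (fun θ => triLimit θ₀ θ ^ 2) θ₀ := by
    rw [ContinuousAt, tendsto_iff_dist_tendsto_zero]
    refine squeeze_zero' (Eventually.of_forall fun _ => dist_nonneg)
      (g := fun θ => |θ - θ₀| / margin θ₀) ?_ ?_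
    · filter_upwards [Metric.closedBall_mem_nhds θ₀ ha] with θ hθ
      rw [Real.dist_eq]
      exact abs_triLimit_sq_sub_le hθ₀ ha (mem_Icc_margin (by simpa [Real.dist_eq] using hθ))
        (mem_Icc_margin_self hθ₀)
    · have : ContinuousAt (fun θ => |θ - θ₀| / margin θ₀) θ₀ := by fun_prop
      simpa [ContinuousAt] using this
  refine h.sqrt.congr (Eventually.of_forall fun θ => ?_)
  exact Real.sqrt_sq triLimit_nonneg

/-- Uniform convergence in probability of the Jacobian: pointwise convergence on a finite net, and
equicontinuity. -/
lemma jacobianConverges_tri {θ₀ : ℝ} (hθ₀ : θ₀ ∈ Ioo (0 : ℝ) 1) :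
    JacobianConverges triDensity (jacobian triDGA) (Ioo 0 1) θ₀ (margin θ₀) (triLimit θ₀) := by
  refine ⟨measurable_triLimit hθ₀, fun _ => triLimit_nonneg, fun ε hε => ?_⟩
  have ha := margin_pos hθ₀
  set a := margin θ₀ with hadef
  set c := limitFloor θ₀ with hc
  have hc0 : 0 < c := limitFloor_pos hθ₀
  -- an error `σ` of the squared Jacobian keeps it above `c / 2`, and is then a relative error of at
  -- most `ε / 2` of the Jacobian itself
  set σ := min (c / 2) (c * ε / 4) with hσ
  have hσ0 : 0 < σ := by positivity
  obtain ⟨T, hTsub, hTfin, hT⟩ := (isCompact_Icc (a := a) (b := 1 - a)).finite_cover_balls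
    (e := σ * a / 4) (by positivity)
  have hbound : ∀ n : ℕ, 0 < n → sampleLaw triDensity n θ₀
      {y | ENNReal.ofReal ε ≤ ⨆ θ ∈ Ioo 0 1 ∩ Metric.closedBall θ₀ a,
        ENNReal.ofReal |jacobian triDGA n y θ - triLimit θ₀ θ|
          / ENNReal.ofReal (jacobian triDGA n y θ)}
      ≤ ENNReal.ofReal (hTfin.toFinset.card * (1 / n / (σ / 2) ^ 2)) := by
    intro n hn
    have := isProbabilityMeasure_sampleLaw (n := n) hθ₀
    calc _ ≤ sampleLaw triDensity n θ₀ (⋃ t ∈ hTfin.toFinset,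
          {y | σ / 2 ≤ |triJac n y t ^ 2 - triLimit θ₀ t ^ 2|}) := by
          refine measure_mono_ae ?_
          filter_upwards [sampleLaw_ae hθ₀] with y hy
          refine fun (hbad : ENNReal.ofReal ε ≤ _) => ?_
          by_contra hcon
          replace hcon : y ∉ ⋃ t ∈ hTfin.toFinset,
            {y | σ / 2 ≤ |triJac n y t ^ 2 - triLimit θ₀ t ^ 2|} := hcon
          simp only [mem_iUnion, not_exists, mem_ofPred_eq, not_le] at hcon
          refine absurd hbad (not_le.2 ?_)
          refine lt_of_le_of_lt (b := ENNReal.ofReal (ε / 2)) ?_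
            ((ENNReal.ofReal_lt_ofReal_iff hε).2 (by linarith))
          refine iSup₂_le fun θ hθ => ?_
          have hθm : θ ∈ Icc a (1 - a) := mem_Icc_margin (by simpa [Real.dist_eq] using hθ.2)
          rw [jacobian_triDGA hy hθ.1]
          have hJ0 := triJac_pos hn hy hθ.1
          obtain ⟨t, ht, hdt⟩ := mem_iUnion₂.1 (hT hθm)
          rw [Metric.mem_ball, Real.dist_eq] at hdt
          have h1 := hcon t (hTfin.mem_toFinset.2 ht)
          have h2 := abs_triJac_sq_sub_le hn ha hθm (hTsub ht) hy
          have h3 := abs_triLimit_sq_sub_le hθ₀ ha hθm (hTsub ht)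
          have h4 : |θ - t| / a ≤ σ / 4 := by
            rw [div_le_iff₀ ha]; linarith
          have h5 : |triJac n y θ ^ 2 - triLimit θ₀ θ ^ 2| ≤ σ := by
            rw [abs_le] at *
            rw [abs_lt] at h1
            constructor <;> linarith [h1.1, h1.2, h2.1, h2.2, h3.1, h3.2]
          have h6 : c / 2 ≤ triJac n y θ ^ 2 := by
            have := limitFloor_le hθ₀ hθ.1
            have h7 : σ ≤ c / 2 := min_le_left _ _
            linarith [(abs_le.1 h5).1]
          rw [← ENNReal.ofReal_div_of_pos hJ0]
          refine ENNReal.ofReal_le_ofReal ?_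
          rw [div_le_iff₀ hJ0]
          have h8 : |triJac n y θ - triLimit θ₀ θ| * (triJac n y θ + triLimit θ₀ θ) ≤ σ := by
            refine le_trans (le_of_eq ?_) h5
            rw [sq_sub_sq, abs_mul, abs_of_nonneg
              (add_nonneg triJac_nonneg triLimit_nonneg), mul_comm]
          have h9 : σ ≤ c * ε / 4 := min_le_right _ _
          have h10 : |triJac n y θ - triLimit θ₀ θ| * triJac n y θ
              ≤ ε / 2 * triJac n y θ * triJac n y θ := by
            have : 0 ≤ |triJac n y θ - triLimit θ₀ θ| * triLimit θ₀ θ :=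
              mul_nonneg (abs_nonneg _) triLimit_nonneg
            nlinarith
          exact le_of_mul_le_mul_right h10 hJ0
      _ ≤ ∑ t ∈ hTfin.toFinset, sampleLaw triDensity n θ₀
          {y | σ / 2 ≤ |triJac n y t ^ 2 - triLimit θ₀ t ^ 2|} := measure_biUnion_finset_le _ _
      _ ≤ ∑ t ∈ hTfin.toFinset, ENNReal.ofReal (1 / n / (σ / 2) ^ 2) := by
          refine Finset.sum_le_sum fun t ht => ?_
          have m := Icc_subset_unit ha (hTsub (hTfin.mem_toFinset.1 ht))
          refine (measure_abs_ge_le (integrable_triJac_sq_sub_sq hθ₀ m _) (by positivity)).trans ?_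
          refine ENNReal.ofReal_le_ofReal ?_
          gcongr
          exact integral_triJac_sq_sub_sq_le hn hθ₀ m
      _ = _ := by
          rw [Finset.sum_const, nsmul_eq_mul, ENNReal.ofReal_mul (by positivity),
            ENNReal.ofReal_natCast]
  have hlim : Tendsto (fun n : ℕ => ENNReal.ofReal
      (hTfin.toFinset.card * (1 / (n : ℝ) / (σ / 2) ^ 2))) atTop (𝓝 0) := by
    rw [← ENNReal.ofReal_zero]
    refine ENNReal.tendsto_ofReal ?_
    have := ((tendsto_one_div_atTop_nhds_zero_nat (𝕜 := ℝ)).div_const ((σ / 2) ^ 2)).const_mul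
      (hTfin.toFinset.card : ℝ)
    simpa using this
  refine tendsto_of_tendsto_of_tendsto_of_le_of_le' tendsto_const_nhds hlim
    (Eventually.of_forall fun _ => zero_le) ?_
  filter_upwards [eventually_gt_atTop 0] with n hn using hbound n hn

lemma bvMAssumptions_tri {θ₀ : ℝ} (hθ₀ : θ₀ ∈ Ioo (0 : ℝ) 1) :
    BvMAssumptions triDensity (jacobian triDGA) (Ioo 0 1) θ₀ (triScore θ₀) (triLimit θ₀) := by
  refine ⟨⟨isDQM_tri hθ₀, ?_⟩, margin θ₀, margin_pos hθ₀, jacobianConverges_tri hθ₀,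
    limitMass_tri hθ₀, _, _, likelihoodSplits_tri hθ₀, expConsistentTests_tri hθ₀⟩
  rw [fisherInfo_tri hθ₀]
  exact inv_ne_zero (mul_pos hθ₀.1 (by linarith [hθ₀.2])).ne'

lemma triLimit_self {θ₀ : ℝ} (hθ₀ : θ₀ ∈ Ioo (0 : ℝ) 1) : triLimit θ₀ θ₀ = √(1 / 8) := by
  have h1 := hθ₀.1
  have h2 : 0 < 1 - θ₀ := by linarith [hθ₀.2]
  unfold triLimit
  congr 1
  rw [integral_law _ hθ₀]
  have e : ∀ y, triGradient y θ₀ ^ 2 * triDensity y θ₀ = triDensity y θ₀ ^ 3 / 16 := fun y => by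
    rw [triGradient_eq_density]; ring
  simp_rw [e]
  have hsupp : ∫ y, triDensity y θ₀ ^ 3 / 16 = ∫ y in Ioc 0 1, triDensity y θ₀ ^ 3 / 16 := by
    refine (setIntegral_eq_integral_of_forall_compl_eq_zero fun y hy => ?_).symm
    rw [triDensity_of_notMem hθ₀ fun h => hy ⟨h.1, h.2.le⟩]; simp
  have hint : Integrable (fun y => triDensity y θ₀ ^ 3 / 16) := by
    refine ((integrable_triDensity hθ₀).const_mul (1 / 4)).mono'
      (((measurable_triDensity_left θ₀).pow_const 3).div_const _).aestronglyMeasurable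
      (ae_of_all _ fun y => ?_)
    have p := triDensity_nonneg (y := y) hθ₀
    have q := triDensity_le_two (y := y) hθ₀
    rw [Real.norm_of_nonneg (by positivity)]
    have : triDensity y θ₀ ^ 2 ≤ 4 := by nlinarith
    nlinarith
  rw [hsupp, ← intervalIntegral.integral_of_le zero_le_one,
    ← intervalIntegral.integral_add_adjacent_intervals (b := θ₀) hint.intervalIntegrable
      hint.intervalIntegrable]
  have e1 : ∫ y in (0 : ℝ)..θ₀, triDensity y θ₀ ^ 3 / 16
      = ∫ y in (0 : ℝ)..θ₀, y ^ 3 * (1 / (2 * θ₀ ^ 3)) := by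
    refine intervalIntegral.integral_congr fun y hy => ?_
    rw [uIcc_of_le h1.le] at hy
    rw [triDensity_eq hθ₀, tent_of_le hθ₀ hy.2, max_eq_right (div_nonneg hy.1 h1.le)]
    field_simp; ring
  have e2 : ∫ y in θ₀..1, triDensity y θ₀ ^ 3 / 16
      = ∫ y in θ₀..1, (1 - y) ^ 3 * (1 / (2 * (1 - θ₀) ^ 3)) := by
    refine intervalIntegral.integral_congr fun y hy => ?_
    rw [uIcc_of_le hθ₀.2.le] at hy
    rw [triDensity_eq hθ₀, tent_of_ge hθ₀ hy.1, max_eq_right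
      (div_nonneg (by linarith [hy.2]) h2.le)]
    field_simp; ring
  rw [e1, e2, intervalIntegral.integral_mul_const, intervalIntegral.integral_mul_const,
    intervalIntegral.integral_comp_sub_left (fun x => x ^ 3) 1, integral_pow, integral_pow]
  field_simp
  ring

/-! ### Local asymptotic normality in mean -/

/-- The log-likelihood ratio of a sample, between the modes `θ + δ` and `θ`. -/
def sumLogRatio (θ δ : ℝ) {n : ℕ} (y : Fin n → ℝ) : ℝ := ∑ i, logRatio θ δ (y i)

/-- The sum of the scores of a sample. -/
def sumScore (θ : ℝ) {n : ℕ} (y : Fin n → ℝ) : ℝ := ∑ i, triScore θ (y i)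

/-- The logarithm of the approximation of the likelihood ratio by a Gaussian shift experiment. -/
def gaussExponent (θ δ : ℝ) {n : ℕ} (y : Fin n → ℝ) : ℝ :=
  δ * sumScore θ y - n * δ ^ 2 * (θ * (1 - θ))⁻¹ / 2

lemma measurable_sum_eval {g : ℝ → ℝ} (hg : Measurable g) (n : ℕ) :
    Measurable (fun y : Fin n → ℝ => ∑ i, g (y i)) :=
  Finset.measurable_sum _ fun i _ => hg.comp (measurable_pi_apply i)

lemma measurable_sumLogRatio (θ δ : ℝ) (n : ℕ) :
    Measurable (sumLogRatio θ δ : (Fin n → ℝ) → ℝ) :=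
  measurable_sum_eval (measurable_logRatio θ δ) n

lemma measurable_sumScore (θ : ℝ) (n : ℕ) : Measurable (sumScore θ : (Fin n → ℝ) → ℝ) :=
  measurable_sum_eval (measurable_triScore θ) n

lemma measurable_gaussExponent (θ δ : ℝ) (n : ℕ) :
    Measurable (gaussExponent θ δ : (Fin n → ℝ) → ℝ) :=
  ((measurable_sumScore θ n).const_mul δ).sub_const _

lemma sum_logRem {θ δ : ℝ} {n : ℕ} (y : Fin n → ℝ) :
    ∑ i, logRem θ δ (y i) = sumLogRatio θ δ y - gaussExponent θ δ y := by
  simp only [logRem, sumLogRatio, gaussExponent, sumScore, Finset.sum_add_distrib,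
    Finset.sum_sub_distrib, Finset.mul_sum, Finset.sum_const, Finset.card_univ, Fintype.card_fin,
    nsmul_eq_mul]
  ring

lemma abs_sum_le_of_box {n : ℕ} {g : ℝ → ℝ} {C : ℝ} (hg : ∀ y ∈ Ioo (0 : ℝ) 1, |g y| ≤ C)
    {y : Fin n → ℝ} (hy : ∀ i, y i ∈ Ioo (0 : ℝ) 1) : |∑ i, g (y i)| ≤ n * C := by
  refine (Finset.abs_sum_le_sum_abs _ _).trans ?_
  refine (Finset.sum_le_sum fun i _ => hg _ (hy i)).trans_eq ?_
  simp

lemma abs_logRatio_le_one {θ δ y : ℝ} (hθ : θ ∈ Ioo (0 : ℝ) 1) (hδ : |δ| ≤ margin θ)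
    (hy : y ∈ Ioo (0 : ℝ) 1) : |logRatio θ δ y| ≤ 1 :=
  (abs_logRatio_le hθ hδ hy).trans ((div_le_one (margin_pos hθ)).2 hδ)

lemma abs_sumScore_le {θ : ℝ} (hθ : θ ∈ Ioo (0 : ℝ) 1) {n : ℕ} {y : Fin n → ℝ}
    (hy : ∀ i, y i ∈ Ioo (0 : ℝ) 1) : |sumScore θ y| ≤ n * (1 / margin θ) :=
  abs_sum_le_of_box (g := triScore θ) (fun _ _ => abs_triScore_le_margin hθ) hy

lemma abs_gaussExponent_le {θ δ : ℝ} (hθ : θ ∈ Ioo (0 : ℝ) 1) {n : ℕ} {y : Fin n → ℝ}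
    (hy : ∀ i, y i ∈ Ioo (0 : ℝ) 1) : |gaussExponent θ δ y|
      ≤ |δ| * (n * (1 / margin θ)) + |n * δ ^ 2 * (θ * (1 - θ))⁻¹ / 2| := by
  refine (abs_sub _ _).trans (add_le_add ?_ le_rfl)
  rw [abs_mul]
  exact mul_le_mul_of_nonneg_left (abs_sumScore_le hθ hy) (abs_nonneg _)

lemma integrable_exp_sq {n : ℕ} {θ : ℝ} (hθ : θ ∈ Ioo (0 : ℝ) 1) {X : (Fin n → ℝ) → ℝ}
    (hX : Measurable X) {C : ℝ} (h : ∀ y, (∀ i, y i ∈ Ioo (0 : ℝ) 1) → |X y| ≤ C) :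
    Integrable (fun y => Real.exp (X y) ^ 2) (sampleLaw triDensity n θ) :=
  integrable_of_bound_sampleLaw hθ (hX.exp.pow_const 2) (C := Real.exp C ^ 2) fun y hy => by
    rw [abs_of_nonneg (by positivity)]
    gcongr
    exact (le_abs_self _).trans (h y hy)

/-- The likelihood ratio is bounded in `L²` over local neighbourhoods of the true mode. -/
lemma integral_exp_sumLogRatio_sq_le {n : ℕ} {θ δ : ℝ} (hθ : θ ∈ Ioo (0 : ℝ) 1)
    (hδ : |δ| ≤ margin θ) :
    ∫ y : Fin n → ℝ, Real.exp (sumLogRatio θ δ y) ^ 2 ∂(sampleLaw triDensity n θ)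
      ≤ Real.exp (4 / margin θ ^ 2 * (n * δ ^ 2)) := by
  have := isProbabilityMeasure_law hθ
  have e : ∀ y : Fin n → ℝ, Real.exp (sumLogRatio θ δ y) ^ 2
      = ∏ i, Real.exp (logRatio θ δ (y i)) ^ 2 := fun y => by
    rw [sumLogRatio, Real.exp_sum, Finset.prod_pow]
  simp_rw [e]
  rw [sampleLaw, integral_fintype_prod_eq_pow (fun x => Real.exp (logRatio θ δ x) ^ 2),
    Fintype.card_fin]
  refine (pow_le_pow_left₀ (integral_nonneg fun _ => by positivity)
    (integral_exp_two_logRatio_le hθ hδ) n).trans_eq ?_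
  rw [← Real.exp_nat_mul]; congr 1; ring

/-- The Gaussian approximation of the likelihood ratio is bounded in `L²` over local
neighbourhoods of the true mode. -/
lemma integral_exp_gaussExponent_sq_le {n : ℕ} {θ δ : ℝ} (hθ : θ ∈ Ioo (0 : ℝ) 1)
    (hδ : |2 * δ| ≤ margin θ) :
    ∫ y : Fin n → ℝ, Real.exp (gaussExponent θ δ y) ^ 2 ∂(sampleLaw triDensity n θ)
      ≤ Real.exp (4 / margin θ ^ 2 * (n * δ ^ 2)) := by
  have := isProbabilityMeasure_law hθ
  have hI : 0 < (θ * (1 - θ))⁻¹ := inv_pos.2 (mul_pos hθ.1 (by linarith [hθ.2]))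
  have e : ∀ y : Fin n → ℝ, Real.exp (gaussExponent θ δ y) ^ 2
      = Real.exp (-(n * δ ^ 2 * (θ * (1 - θ))⁻¹)) * ∏ i, Real.exp (2 * δ * triScore θ (y i)) :=
    fun y => by
      rw [← Real.exp_sum, ← Real.exp_add, ← Real.exp_nat_mul, ← Finset.mul_sum, gaussExponent,
        sumScore]
      congr 1; push_cast; ring
  simp_rw [e]
  rw [integral_const_mul, sampleLaw, integral_fintype_prod_eq_pow
    (fun x => Real.exp (2 * δ * triScore θ x)), Fintype.card_fin]
  have h1 := pow_le_pow_left₀ (integral_nonneg fun _ => by positivity)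
    (integral_exp_triScore_le hθ hδ) n
  have h2 : Real.exp (-(n * δ ^ 2 * (θ * (1 - θ))⁻¹)) ≤ 1 := by
    rw [Real.exp_le_one_iff, neg_nonpos]; positivity
  calc _ ≤ 1 * Real.exp (1 / margin θ ^ 2 * (2 * δ) ^ 2) ^ n :=
        mul_le_mul h2 h1 (pow_nonneg (integral_nonneg fun _ => by positivity) n) zero_le_one
    _ = _ := by rw [one_mul, ← Real.exp_nat_mul]; congr 1; ring

lemma abs_exp_sub_exp_le (x y : ℝ) :
    |Real.exp x - Real.exp y| ≤ |x - y| * (Real.exp x + Real.exp y) := by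
  wlog h : y ≤ x generalizing x y
  · rw [abs_sub_comm, abs_sub_comm x, add_comm]
    exact this y x (le_of_not_ge h)
  rw [abs_of_nonneg (sub_nonneg.2 (Real.exp_le_exp.2 h)), abs_of_nonneg (sub_nonneg.2 h)]
  have h1 : Real.exp x * (1 - Real.exp (y - x)) = Real.exp x - Real.exp y := by
    rw [mul_sub, ← Real.exp_add]; simp
  have h2 := Real.add_one_le_exp (y - x)
  have h3 : Real.exp x * (1 - Real.exp (y - x)) ≤ Real.exp x * (x - y) :=
    mul_le_mul_of_nonneg_left (by linarith) (Real.exp_pos x).le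
  have h4 : 0 ≤ (x - y) * Real.exp y := mul_nonneg (sub_nonneg.2 h) (Real.exp_pos y).le
  linarith

/-- The local likelihood ratio times the normalized Jacobian. -/
def localDensity (θ δ : ℝ) {n : ℕ} (y : Fin n → ℝ) : ℝ :=
  Real.exp (sumLogRatio θ δ y) * (triJac n y (θ + δ) / triLimit θ θ)

/-- Pointwise comparison of the local density with the Gaussian one, with squares only on the
right-hand side, so that second moments suffice. -/
lemma abs_localDensity_sub_le {θ δ κ : ℝ} (hθ : θ ∈ Ioo (0 : ℝ) 1) (hκ : 0 < κ) {n : ℕ}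
    (y : Fin n → ℝ) :
    |localDensity θ δ y - Real.exp (gaussExponent θ δ y)|
      ≤ 1 / κ * (∑ i, logRem θ δ (y i)) ^ 2
        + 1 / (κ * triLimit θ θ ^ 4) * (triJac n y (θ + δ) ^ 2 - triLimit θ θ ^ 2) ^ 2
        + 2 * κ * Real.exp (sumLogRatio θ δ y) ^ 2
        + κ * Real.exp (gaussExponent θ δ y) ^ 2 := by
  set Z := Real.exp (sumLogRatio θ δ y) with hZ
  set W := Real.exp (gaussExponent θ δ y) with hW
  set J := triJac n y (θ + δ) with hJ
  set p := triLimit θ θ with hp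
  have hp0 : 0 < p := triLimit_pos hθ hθ
  have hJ0 : 0 ≤ J := triJac_nonneg
  have hZ0 : 0 < Z := Real.exp_pos _
  have hW0 : 0 < W := Real.exp_pos _
  set R := ∑ i, logRem θ δ (y i) with hR
  have h1 : |Z - W| ≤ |R| * (Z + W) := by
    rw [hR, sum_logRem]; exact abs_exp_sub_exp_le _ _
  have h2 : localDensity θ δ y - W = (Z - W) + Z * ((J - p) / p) := by
    simp only [localDensity, ← hZ, ← hJ, ← hp]
    field_simp; ring
  -- products are split by the inequality of arithmetic and geometric means, with weight `κ`
  have h3 : |R| * (Z + W) ≤ 1 / κ * R ^ 2 + κ * (Z ^ 2 + W ^ 2) := by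
    rw [← sq_abs R]
    have e : 1 / κ * |R| ^ 2 = κ * (|R| / κ) ^ 2 := by field_simp
    have e2 : |R| = κ * (|R| / κ) := by field_simp
    rw [e]
    nth_rw 1 [e2]
    nlinarith [mul_nonneg hκ.le (sq_nonneg (|R| / κ - (Z + W) / 2)),
      mul_nonneg hκ.le (sq_nonneg (Z - W)), mul_nonneg hκ.le (sq_nonneg (Z + W))]
  have h4 : |J - p| ≤ |J ^ 2 - p ^ 2| / p := by
    rw [le_div_iff₀ hp0, sq_sub_sq, abs_mul, abs_of_nonneg (add_nonneg hJ0 hp0.le), mul_comm]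
    exact mul_le_mul_of_nonneg_right (by linarith) (abs_nonneg _)
  have h5 : |Z * ((J - p) / p)| ≤ 1 / (κ * p ^ 4) * (J ^ 2 - p ^ 2) ^ 2 + κ * Z ^ 2 := by
    rw [abs_mul, abs_div, abs_of_pos hZ0, abs_of_pos hp0]
    set q := |J ^ 2 - p ^ 2| / p ^ 2 with hq
    have h6 : |J - p| / p ≤ q := by
      refine (div_le_div_of_nonneg_right h4 hp0.le).trans_eq ?_
      rw [hq, div_div, ← sq]
    have e : 1 / (κ * p ^ 4) * (J ^ 2 - p ^ 2) ^ 2 = κ * (q / κ) ^ 2 := by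
      rw [hq, div_pow, div_pow, sq_abs]; field_simp
    have e2 : q = κ * (q / κ) := by field_simp
    rw [e]
    calc Z * (|J - p| / p) ≤ Z * (κ * (q / κ)) := by rw [← e2]; gcongr
      _ ≤ _ := by
        nlinarith [mul_nonneg hκ.le (sq_nonneg (q / κ - Z)),
          mul_nonneg hκ.le (sq_nonneg (q / κ)), mul_nonneg hκ.le (sq_nonneg Z)]
  rw [h2]
  refine (abs_add_le _ _).trans ?_
  linarith

/-- The local density converges to the Gaussian one in mean, uniformly for local parameters `h` in
a bounded set. -/
lemma exists_integral_localDensity_le {θ : ℝ} (hθ : θ ∈ Ioo (0 : ℝ) 1) {M η : ℝ} (hM : 0 < M)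
    (hη : 0 < η) : ∃ N : ℕ, 0 < N ∧ ∀ n ≥ N, ∀ h : ℝ, |h| ≤ M →
      |h / √n| ≤ margin θ ∧
      Integrable (fun y : Fin n → ℝ => |localDensity θ (h / √n) y
        - Real.exp (gaussExponent θ (h / √n) y)|) (sampleLaw triDensity n θ) ∧
      ∫ y : Fin n → ℝ, |localDensity θ (h / √n) y - Real.exp (gaussExponent θ (h / √n) y)|
        ∂(sampleLaw triDensity n θ) ≤ η := by
  have ha := margin_pos hθ
  set a := margin θ with hadef
  set p := triLimit θ θ with hp
  have hp0 : 0 < p := triLimit_pos hθ hθ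
  set K := Real.exp (4 / a ^ 2 * M ^ 2) with hK
  have hK0 : 0 < K := Real.exp_pos _
  -- `K` bounds the second moments of both exponentials, so that the terms with the factor `κ`, which
  -- are `3 κ K` in total, contribute `η / 2`
  set κ := η / (6 * K) with hκ
  have hκ0 : 0 < κ := by positivity
  set η₁ := min 1 (η * κ / (4 * (M ^ 2 + M ^ 4))) with hη₁
  have hη₁0 : 0 < η₁ := by positivity
  obtain ⟨d, hd, hmom⟩ := exists_logRem_moments_le hθ hη₁0
  obtain ⟨N₁, hN₁⟩ := exists_nat_ge ((M / min d (a / 2)) ^ 2)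
  obtain ⟨N₂, hN₂⟩ := exists_nat_ge ((2 + 2 * (M / a) ^ 2) / (κ * p ^ 4 * (η / 4)))
  refine ⟨max 1 (max N₁ N₂), by positivity, fun n hn h hh => ?_⟩
  have hn1 : 1 ≤ n := (le_max_left _ _).trans hn
  have hnN₁ : (N₁ : ℝ) ≤ n := by
    exact_mod_cast ((le_max_left _ _).trans (le_max_right _ _)).trans hn
  have hnN₂ : (N₂ : ℝ) ≤ n := by
    exact_mod_cast ((le_max_right _ _).trans (le_max_right _ _)).trans hn
  have hn0 : (0 : ℝ) < n := by exact_mod_cast hn1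
  have hs : 0 < √(n : ℝ) := Real.sqrt_pos.2 hn0
  set δ := h / √n with hδ
  have hδM : |δ| ≤ M / √n := by rw [hδ, abs_div, abs_of_pos hs]; gcongr
  have hδs : |δ| ≤ min d (a / 2) := by
    refine hδM.trans ?_
    rw [div_le_iff₀ hs, ← div_le_iff₀' (by positivity)]
    exact Real.le_sqrt_of_sq_le (hN₁.trans hnN₁)
  have hδd : |δ| ≤ d := hδs.trans (min_le_left _ _)
  have hδa2 : |δ| ≤ a / 2 := hδs.trans (min_le_right _ _)
  have hδa : |δ| ≤ a := by linarith
  have hnδ : n * δ ^ 2 = h ^ 2 := by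
    rw [hδ, div_pow, Real.sq_sqrt hn0.le]; field_simp
  have hh2 : h ^ 2 ≤ M ^ 2 := by rw [← sq_abs]; gcongr
  have hm : θ + δ ∈ Ioo (0 : ℝ) 1 := Icc_subset_unit ha (mem_Icc_margin_add hδa)
  have := isProbabilityMeasure_law hθ
  have := isProbabilityMeasure_sampleLaw (n := n) hθ
  -- the four second moments
  have EZ : ∫ y : Fin n → ℝ, Real.exp (sumLogRatio θ δ y) ^ 2 ∂(sampleLaw triDensity n θ) ≤ K := by
    refine (integral_exp_sumLogRatio_sq_le hθ hδa).trans (Real.exp_le_exp.2 ?_)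
    rw [hnδ]; gcongr
  have EW : ∫ y : Fin n → ℝ, Real.exp (gaussExponent θ δ y) ^ 2 ∂(sampleLaw triDensity n θ)
      ≤ K := by
    refine (integral_exp_gaussExponent_sq_le hθ ?_).trans (Real.exp_le_exp.2 ?_)
    · rw [abs_mul, abs_two]; linarith
    · rw [hnδ]; gcongr
  have bRem : ∀ y ∈ Ioo (0 : ℝ) 1, |logRem θ δ y|
      ≤ 1 + |δ| * (1 / a) + |δ ^ 2 * (θ * (1 - θ))⁻¹ / 2| := fun y hy => by
    refine (abs_add_le _ _).trans (add_le_add ((abs_sub _ _).trans (add_le_add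
      (abs_logRatio_le_one hθ hδa hy) ?_)) le_rfl)
    rw [abs_mul]
    exact mul_le_mul_of_nonneg_left (abs_triScore_le_margin hθ) (abs_nonneg _)
  have ER : ∫ y : Fin n → ℝ, (∑ i, logRem θ δ (y i)) ^ 2 ∂(sampleLaw triDensity n θ)
      ≤ η * κ / 4 := by
    refine (integral_sum_sq_le (law triDensity θ)
      (memLp_of_bound_law hθ (measurable_logRem θ δ) bRem)).trans ?_
    obtain ⟨m1, m2⟩ := hmom δ hδd
    have m3 := pow_le_pow_left₀ (abs_nonneg _) m1 2
    rw [sq_abs] at m3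
    have hη₁1 : η₁ ≤ 1 := min_le_left _ _
    have hη₁2 : η₁ * (M ^ 2 + M ^ 4) ≤ η * κ / 4 := by
      have := min_le_right 1 (η * κ / (4 * (M ^ 2 + M ^ 4)))
      rw [← hη₁, le_div_iff₀ (by positivity)] at this
      linarith
    calc _ ≤ n * (η₁ * δ ^ 2) + (n : ℝ) ^ 2 * (η₁ * δ ^ 2) ^ 2 := by gcongr
      _ = η₁ * (n * δ ^ 2) + η₁ ^ 2 * (n * δ ^ 2) ^ 2 := by ring
      _ = η₁ * h ^ 2 + η₁ ^ 2 * (h ^ 2) ^ 2 := by rw [hnδ]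
      _ ≤ η₁ * M ^ 2 + η₁ * (M ^ 2) ^ 2 := by
          gcongr
          nlinarith
      _ = η₁ * (M ^ 2 + M ^ 4) := by ring
      _ ≤ _ := hη₁2
  have iJ0 := integrable_triJac_sq_sub_sq (n := n) hθ hm (triLimit θ (θ + δ) ^ 2)
  have iJ := integrable_triJac_sq_sub_sq (n := n) hθ hm (p ^ 2)
  have EJ : ∫ y : Fin n → ℝ, (triJac n y (θ + δ) ^ 2 - p ^ 2) ^ 2 ∂(sampleLaw triDensity n θ)
      ≤ κ * p ^ 4 * (η / 4) := by
    have hl := abs_triLimit_sq_sub_le hθ ha (mem_Icc_margin_add hδa) (mem_Icc_margin_self hθ)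
    rw [add_sub_cancel_left] at hl
    have hl2 := pow_le_pow_left₀ (abs_nonneg _) (hl.trans (div_le_div_of_nonneg_right hδM ha.le)) 2
    rw [sq_abs] at hl2
    calc _ ≤ ∫ y : Fin n → ℝ, (2 * (triJac n y (θ + δ) ^ 2 - triLimit θ (θ + δ) ^ 2) ^ 2
          + 2 * (triLimit θ (θ + δ) ^ 2 - p ^ 2) ^ 2) ∂(sampleLaw triDensity n θ) := by
          refine integral_mono iJ ((iJ0.const_mul 2).add (integrable_const _)) fun y => ?_
          simp only
          nlinarith [sq_nonneg ((triJac n y (θ + δ) ^ 2 - triLimit θ (θ + δ) ^ 2)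
            - (triLimit θ (θ + δ) ^ 2 - p ^ 2))]
      _ = 2 * ∫ y : Fin n → ℝ, (triJac n y (θ + δ) ^ 2 - triLimit θ (θ + δ) ^ 2) ^ 2
            ∂(sampleLaw triDensity n θ) + 2 * (triLimit θ (θ + δ) ^ 2 - p ^ 2) ^ 2 := by
          rw [integral_add (iJ0.const_mul 2) (integrable_const _), integral_const_mul]; simp
      _ ≤ 2 * (1 / n) + 2 * (M / √n / a) ^ 2 := by
          gcongr
          exact integral_triJac_sq_sub_sq_le (by lia) hθ hm
      _ = (2 + 2 * (M / a) ^ 2) / n := by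
          rw [div_right_comm, div_pow (M / a), Real.sq_sqrt hn0.le]; ring
      _ ≤ _ := by
          have := hN₂.trans hnN₂
          rw [div_le_iff₀ (by positivity)] at this
          rw [div_le_iff₀ hn0]; linarith
  have iZ : Integrable (fun y : Fin n → ℝ => Real.exp (sumLogRatio θ δ y) ^ 2)
      (sampleLaw triDensity n θ) := integrable_exp_sq hθ (measurable_sumLogRatio θ δ n) fun y hy =>
    abs_sum_le_of_box (fun _ h => abs_logRatio_le_one hθ hδa h) hy
  have iW : Integrable (fun y : Fin n → ℝ => Real.exp (gaussExponent θ δ y) ^ 2)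
      (sampleLaw triDensity n θ) := integrable_exp_sq hθ (measurable_gaussExponent θ δ n)
    fun y hy => abs_gaussExponent_le hθ hy
  have iR : Integrable (fun y : Fin n → ℝ => (∑ i, logRem θ δ (y i)) ^ 2)
      (sampleLaw triDensity n θ) :=
    integrable_of_bound_sampleLaw hθ ((measurable_sum_eval (measurable_logRem θ δ) n).pow_const 2)
      fun y hy => by
        rw [abs_pow]
        exact pow_le_pow_left₀ (abs_nonneg _) (abs_sum_le_of_box bRem hy) 2
  have i1 : Integrable (fun y : Fin n → ℝ => 1 / κ * (∑ i, logRem θ δ (y i)) ^ 2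
      + 1 / (κ * p ^ 4) * (triJac n y (θ + δ) ^ 2 - p ^ 2) ^ 2) (sampleLaw triDensity n θ) :=
    (iR.const_mul _).add (iJ.const_mul _)
  have i2 : Integrable (fun y : Fin n → ℝ => 1 / κ * (∑ i, logRem θ δ (y i)) ^ 2
      + 1 / (κ * p ^ 4) * (triJac n y (θ + δ) ^ 2 - p ^ 2) ^ 2
      + 2 * κ * Real.exp (sumLogRatio θ δ y) ^ 2) (sampleLaw triDensity n θ) :=
    i1.add (iZ.const_mul _)
  have i3 : Integrable (fun y : Fin n → ℝ => 1 / κ * (∑ i, logRem θ δ (y i)) ^ 2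
      + 1 / (κ * p ^ 4) * (triJac n y (θ + δ) ^ 2 - p ^ 2) ^ 2
      + 2 * κ * Real.exp (sumLogRatio θ δ y) ^ 2
      + κ * Real.exp (gaussExponent θ δ y) ^ 2) (sampleLaw triDensity n θ) :=
    i2.add (iW.const_mul _)
  have mD : Measurable (fun y : Fin n → ℝ => |localDensity θ δ y
      - Real.exp (gaussExponent θ δ y)|) := by
    refine Measurable.abs (Measurable.sub (Measurable.mul ?_ ?_) ?_)
    · exact (measurable_sumLogRatio θ δ n).exp
    · exact (measurable_triJac_left n _).div_const _
    · exact (measurable_gaussExponent θ δ n).exp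
  have iD : Integrable (fun y : Fin n → ℝ => |localDensity θ δ y
      - Real.exp (gaussExponent θ δ y)|) (sampleLaw triDensity n θ) :=
    i3.mono' mD.aestronglyMeasurable (ae_of_all _ fun y => by
      rw [Real.norm_of_nonneg (abs_nonneg _)]
      exact abs_localDensity_sub_le hθ hκ0 y)
  refine ⟨hδa, iD, ?_⟩
  calc _ ≤ _ := integral_mono iD i3 fun y => abs_localDensity_sub_le hθ hκ0 y
    _ ≤ 1 / κ * (η * κ / 4) + 1 / (κ * p ^ 4) * (κ * p ^ 4 * (η / 4)) + 2 * κ * K + κ * K := by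
        rw [integral_add i2 (iW.const_mul _), integral_add i1 (iZ.const_mul _),
          integral_add (iR.const_mul _) (iJ.const_mul _), integral_const_mul, integral_const_mul,
          integral_const_mul, integral_const_mul]
        gcongr
    _ = η := by
        rw [hκ]; field_simp; ring

/-! ### Total variation distance -/

lemma tvDist_le_of_forall {μ ν : Measure ℝ} {C : ℝ}
    (h : ∀ B, MeasurableSet B → |μ.real B - ν.real B| ≤ C) : tvDist μ ν ≤ C := by
  have : Nonempty {B : Set ℝ // MeasurableSet B} := ⟨⟨∅, MeasurableSet.empty⟩⟩
  exact ciSup_le fun B => h B.1 B.2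

/-- One half of the comparison of two measures by the `L¹` distance of their densities. -/
lemma withDensity_ofReal_le_add {u v : ℝ → ℝ} (hv : Measurable v) {B : Set ℝ}
    (hB : MeasurableSet B) : volume.withDensity (fun x => ENNReal.ofReal (u x)) B
      ≤ volume.withDensity (fun x => ENNReal.ofReal (v x)) B
        + ∫⁻ x, ENNReal.ofReal |u x - v x| := by
  rw [withDensity_apply _ hB, withDensity_apply _ hB]
  calc _ ≤ ∫⁻ x in B, (ENNReal.ofReal (v x) + ENNReal.ofReal |u x - v x|) := by
        refine lintegral_mono fun x => ?_
        refine (ENNReal.ofReal_le_ofReal ?_).trans ENNReal.ofReal_add_le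
        linarith [le_abs_self (u x - v x)]
    _ = (∫⁻ x in B, ENNReal.ofReal (v x)) + ∫⁻ x in B, ENNReal.ofReal |u x - v x| :=
        lintegral_add_left hv.ennreal_ofReal _
    _ ≤ _ := add_le_add le_rfl (setLIntegral_le_lintegral _ _)

/-- The distance between normalized measures is at most twice the `L¹` distance of their densities
when one of the two densities is normalized. -/
lemma tvDist_le_lintegral {ν N : Measure ℝ} [IsProbabilityMeasure ν] [IsProbabilityMeasure N]
    {u v : ℝ → ℝ} (hu : Measurable u) (hv : Measurable v) {c : ℝ≥0∞}
    (hν : ν = c • volume.withDensity fun x => ENNReal.ofReal (u x))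
    (hN : N = volume.withDensity fun x => ENNReal.ofReal (v x)) :
    ENNReal.ofReal (tvDist ν N) ≤ 2 * ∫⁻ x, ENNReal.ofReal |u x - v x| := by
  set D := ∫⁻ x, ENNReal.ofReal |u x - v x| with hD
  set U := volume.withDensity fun x => ENNReal.ofReal (u x) with hU
  rcases eq_or_ne D ⊤ with h | hDtop
  · rw [h]; simp
  have h1 : ∀ B, MeasurableSet B → U B ≤ N B + D := fun B hB => by
    rw [hN]; exact withDensity_ofReal_le_add hv hB
  have h2 : ∀ B, MeasurableSet B → N B ≤ U B + D := fun B hB => by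
    have := withDensity_ofReal_le_add (u := v) hu hB
    simp_rw [abs_sub_comm (v _)] at this
    rwa [← hN] at this
  have hUfin : ∀ B, U B ≠ ⊤ := fun B => by
    refine ((measure_mono (subset_univ B)).trans_lt ((h1 _ MeasurableSet.univ).trans_lt ?_)).ne
    exact ENNReal.add_lt_top.2 ⟨measure_lt_top _ _, hDtop.lt_top⟩
  have h3 : ∀ B, MeasurableSet B → |U.real B - N.real B| ≤ D.toReal := fun B hB => by
    have a1 := ENNReal.toReal_mono (by simp [hDtop]) (h1 B hB)
    have a2 := ENNReal.toReal_mono (by simp [hDtop, hUfin]) (h2 B hB)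
    rw [ENNReal.toReal_add (measure_ne_top _ _) hDtop] at a1
    rw [ENNReal.toReal_add (hUfin B) hDtop] at a2
    simp only [Measure.real]
    rw [abs_le]; constructor <;> linarith
  have hνr : ∀ B, ν.real B = c.toReal * U.real B := fun B => by
    rw [hν]; simp [Measure.real]
  have huniv : c.toReal * U.real univ = 1 := by rw [← hνr]; simp
  have h4 := h3 univ MeasurableSet.univ
  rw [probReal_univ (μ := N)] at h4
  rw [show (2 : ℝ≥0∞) * D = ENNReal.ofReal (2 * D.toReal) by
    rw [ENNReal.ofReal_mul zero_le_two, ENNReal.ofReal_toReal hDtop]; simp]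
  refine ENNReal.ofReal_le_ofReal (tvDist_le_of_forall fun B hB => ?_)
  -- normalizing changes the measure of a set by at most the change of the total mass
  have h5 : |c.toReal * U.real B - U.real B| ≤ |U.real univ - 1| := by
    have hmono : U.real B ≤ U.real univ :=
      ENNReal.toReal_mono (hUfin _) (measure_mono (subset_univ B))
    have e : c.toReal * U.real B - U.real B = (c.toReal - 1) * U.real B := by ring
    have e2 : U.real univ - 1 = -((c.toReal - 1) * U.real univ) := by rw [sub_mul, huniv]; ring
    rw [e, e2, abs_neg, abs_mul, abs_mul, abs_of_nonneg (measureReal_nonneg (μ := U)),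
      abs_of_nonneg (measureReal_nonneg (μ := U))]
    exact mul_le_mul_of_nonneg_left hmono (abs_nonneg _)
  rw [hνr]
  have := abs_add_le (c.toReal * U.real B - U.real B) (U.real B - N.real B)
  rw [sub_add_sub_cancel] at this
  linarith [h3 B hB]

/-- Image of a measure with a density under a standardization `θ ↦ s (θ - θ₀)`. -/
lemma map_affine_withDensity {g : ℝ → ℝ≥0∞} (hg : Measurable g) {s : ℝ} (hs : 0 < s) (θ₀ : ℝ) :
    (volume.withDensity g).map (fun θ => s * (θ - θ₀))
      = ENNReal.ofReal s⁻¹ • volume.withDensity fun h => g (θ₀ + h / s) := by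
  have hm : Measurable fun θ : ℝ => s * (θ - θ₀) := by fun_prop
  ext B hB
  rw [Measure.map_apply hm hB, withDensity_apply _ (hm hB), Measure.smul_apply, smul_eq_mul,
    withDensity_apply _ hB, ← lintegral_indicator (hm hB), ← lintegral_indicator hB]
  set F : ℝ → ℝ≥0∞ := B.indicator fun h => g (θ₀ + h / s) with hF
  have mF : Measurable F := (hg.comp (by fun_prop)).indicator hB
  have e : ∀ θ, ((fun θ => s * (θ - θ₀)) ⁻¹' B).indicator g θ = F (s * (θ - θ₀)) := fun θ => by
    by_cases h : s * (θ - θ₀) ∈ B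
    · rw [hF, indicator_of_mem h, indicator_of_mem (show θ ∈ (fun θ => s * (θ - θ₀)) ⁻¹' B from h)]
      congr 1; field_simp; ring
    · rw [hF, indicator_of_notMem h, indicator_of_notMem (show θ ∉ (fun θ => s * (θ - θ₀)) ⁻¹' B from h)]
  simp_rw [e]
  rw [lintegral_sub_right_eq_self (fun θ => F (s * θ)) θ₀,
    ← lintegral_map mF (measurable_const_mul s), Real.map_volume_mul_left hs.ne',
    lintegral_smul_measure, abs_of_pos (inv_pos.2 hs), smul_eq_mul]

/-! ### The fiducial density -/

/-- The unnormalized generalized fiducial density, extended by zero. -/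
def gfdDensity (n : ℕ) (y : Fin n → ℝ) (θ : ℝ) : ℝ :=
  (Ioo (0 : ℝ) 1).indicator (fun t => likelihood triDensity n y t * triJac n y t) θ

lemma gfdDensity_of_mem {n : ℕ} {y : Fin n → ℝ} {θ : ℝ} (hθ : θ ∈ Ioo (0 : ℝ) 1) :
    gfdDensity n y θ = likelihood triDensity n y θ * triJac n y θ := indicator_of_mem hθ _

lemma gfdDensity_nonneg {n : ℕ} {y : Fin n → ℝ} {θ : ℝ} : 0 ≤ gfdDensity n y θ :=
  indicator_nonneg (fun _ ht => mul_nonneg (likelihood_nonneg ht) triJac_nonneg) _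

lemma measurable_gfdDensity (n : ℕ) :
    Measurable (fun z : (Fin n → ℝ) × ℝ => gfdDensity n z.1 z.2) := by
  have h : Measurable (fun z : (Fin n → ℝ) × ℝ =>
      likelihood triDensity n z.1 z.2 * triJac n z.1 z.2) :=
    (measurable_likelihood n).mul (measurable_triJac n)
  exact h.indicator (s := {z : (Fin n → ℝ) × ℝ | z.2 ∈ Ioo (0 : ℝ) 1})
    (measurable_snd measurableSet_Ioo)

lemma measurable_gfdDensity_right (n : ℕ) (y : Fin n → ℝ) : Measurable (gfdDensity n y) := by
  have h : Measurable (fun θ : ℝ => (y, θ)) := by fun_prop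
  have h2 := (measurable_gfdDensity n).comp h
  exact h2

lemma gfdDensity_le {n : ℕ} {y : Fin n → ℝ} {θ : ℝ} (hθ : θ ∈ Ioo (0 : ℝ) 1) :
    gfdDensity n y θ ≤ 2 ^ n := by
  rw [gfdDensity_of_mem hθ]
  calc _ ≤ (2 : ℝ) ^ n * 1 :=
        mul_le_mul (likelihood_le hθ) ((triJac_le hθ).trans (by norm_num)) triJac_nonneg (by positivity)
    _ = _ := mul_one _

lemma integrable_gfdDensity (n : ℕ) (y : Fin n → ℝ) : Integrable (gfdDensity n y) := by
  have h : IntegrableOn (gfdDensity n y) (Ioo 0 1) := by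
    refine Measure.integrableOn_of_bounded (M := 2 ^ n) (by simp)
      (measurable_gfdDensity_right n y).aestronglyMeasurable ?_
    filter_upwards [ae_restrict_mem measurableSet_Ioo] with θ hθ
    rw [Real.norm_of_nonneg gfdDensity_nonneg]
    exact gfdDensity_le hθ
  exact (integrableOn_iff_integrable_of_support_subset fun y hy => by
    by_contra h'
    exact hy (indicator_of_notMem h' _)).1 h

lemma gfdDensity_pos {n : ℕ} (hn : 0 < n) {y : Fin n → ℝ} (hy : ∀ i, y i ∈ Ioo (0 : ℝ) 1) {θ : ℝ}
    (hθ : θ ∈ Ioo (0 : ℝ) 1) : 0 < gfdDensity n y θ := by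
  rw [gfdDensity_of_mem hθ]
  exact mul_pos (likelihood_pos hθ hy) (triJac_pos hn hy hθ)

lemma integral_gfdDensity_pos {n : ℕ} (hn : 0 < n) {y : Fin n → ℝ}
    (hy : ∀ i, y i ∈ Ioo (0 : ℝ) 1) : 0 < ∫ θ, gfdDensity n y θ := by
  refine (integral_pos_iff_support_of_nonneg (fun _ => gfdDensity_nonneg)
    (integrable_gfdDensity n y)).2 ?_
  refine lt_of_lt_of_le ?_ (measure_mono (show Ioo (0 : ℝ) 1 ⊆ _ from fun θ hθ =>
    (gfdDensity_pos hn hy hθ).ne'))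
  simp

lemma triGFD_eq {n : ℕ} {y : Fin n → ℝ} (hy : ∀ i, y i ∈ Ioo (0 : ℝ) 1) :
    triGFD n y = volume.withDensity fun θ =>
      ENNReal.ofReal (gfdDensity n y θ / ∫ t, gfdDensity n y t) := by
  have e : ∫ t in Ioo 0 1, likelihood triDensity n y t * jacobian triDGA n y t
      = ∫ t, gfdDensity n y t := by
    unfold gfdDensity
    rw [integral_indicator measurableSet_Ioo]
    exact setIntegral_congr_fun measurableSet_Ioo fun t ht => by
      simp only [jacobian_triDGA hy ht]
  rw [triGFD, fiducialMeasure, e, ← withDensity_indicator measurableSet_Ioo]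
  congr 1
  ext θ
  by_cases h : θ ∈ Ioo (0 : ℝ) 1
  · rw [indicator_of_mem h, gfdDensity_of_mem h, jacobian_triDGA hy h]
  · rw [indicator_of_notMem h, gfdDensity, indicator_of_notMem h]; simp

lemma isProbabilityMeasure_triGFD {n : ℕ} (hn : 0 < n) {y : Fin n → ℝ}
    (hy : ∀ i, y i ∈ Ioo (0 : ℝ) 1) : IsProbabilityMeasure (triGFD n y) := by
  have hK := integral_gfdDensity_pos hn hy
  refine ⟨?_⟩
  rw [triGFD_eq hy, withDensity_apply _ MeasurableSet.univ, Measure.restrict_univ,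
    ← ofReal_integral_eq_lintegral_ofReal ((integrable_gfdDensity n y).div_const _)
      (ae_of_all _ fun θ => div_nonneg gfdDensity_nonneg hK.le), integral_div,
    div_self hK.ne', ENNReal.ofReal_one]

/-! ### Reduction of the total variation distance to a local integral -/

/-- The unnormalized fiducial density in the local parameter `h = √n (θ - θ₀)`, relative to its
approximate value at `h = 0`. -/
def scaledDensity (θ₀ : ℝ) (n : ℕ) (y : Fin n → ℝ) (h : ℝ) : ℝ :=
  gfdDensity n y (θ₀ + h / √n) / (likelihood triDensity n y θ₀ * triLimit θ₀ θ₀)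

lemma measurable_scaledDensity (θ₀ : ℝ) (n : ℕ) :
    Measurable (fun z : (Fin n → ℝ) × ℝ => scaledDensity θ₀ n z.1 z.2) := by
  refine Measurable.div ?_ ?_
  · have h : Measurable (fun z : (Fin n → ℝ) × ℝ => (z.1, θ₀ + z.2 / √(n : ℝ))) := by fun_prop
    have h2 := (measurable_gfdDensity n).comp h
    exact h2
  · exact ((measurable_likelihood_left n θ₀).comp measurable_fst).mul_const _

lemma measurable_gaussExponent_prod (θ₀ : ℝ) (n : ℕ) :
    Measurable (fun z : (Fin n → ℝ) × ℝ => gaussExponent θ₀ (z.2 / √n) z.1) := by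
  have h1 : Measurable (fun z : (Fin n → ℝ) × ℝ => sumScore θ₀ z.1) :=
    (measurable_sumScore θ₀ n).comp measurable_fst
  have h2 : Measurable (fun z : (Fin n → ℝ) × ℝ => z.2 / √(n : ℝ)) := by fun_prop
  exact (h2.mul h1).sub ((((h2.pow_const 2).const_mul _).mul_const _).div_const _)

lemma scaledDensity_eq_localDensity {θ₀ : ℝ} (hθ₀ : θ₀ ∈ Ioo (0 : ℝ) 1) {n : ℕ} {h : ℝ}
    (hh : |h / √n| ≤ margin θ₀) {y : Fin n → ℝ} (hy : ∀ i, y i ∈ Ioo (0 : ℝ) 1) :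
    scaledDensity θ₀ n y h = localDensity θ₀ (h / √n) y := by
  have m := Icc_subset_unit (margin_pos hθ₀) (mem_Icc_margin_add hh)
  rw [scaledDensity, gfdDensity_of_mem m, localDensity, sumLogRatio, Real.exp_sum,
    mul_div_mul_comm, likelihood, likelihood, ← Finset.prod_div_distrib]
  congr 1
  exact Finset.prod_congr rfl fun i _ => (exp_logRatio hθ₀ hh (hy i)).symm

/-- The `L¹` distance, in the local parameter, between the fiducial density and the Gaussian one. -/
def localError (θ₀ : ℝ) (n : ℕ) (y : Fin n → ℝ) : ℝ≥0∞ :=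
  ∫⁻ h, ENNReal.ofReal |scaledDensity θ₀ n y h - Real.exp (gaussExponent θ₀ (h / √n) y)|

lemma centering_tri {θ₀ : ℝ} (hθ₀ : θ₀ ∈ Ioo (0 : ℝ) 1) {n : ℕ} (y : Fin n → ℝ) :
    centering triDensity θ₀ (triScore θ₀) n y = θ₀ * (1 - θ₀) * (sumScore θ₀ y / √n) := by
  rw [centering, fisherInfo_tri hθ₀, inv_inv, ← Finset.mul_sum, sumScore]; ring

/-- The total variation distance to the Gaussian law is controlled by the local error. The factor
`exp (-Δ² / (2 I⁻¹))` that completes the square in the Gaussian exponent depends on the data, but is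
at most one. -/
lemma tvDist_le_localError {θ₀ : ℝ} (hθ₀ : θ₀ ∈ Ioo (0 : ℝ) 1) {n : ℕ} (hn : 0 < n)
    {y : Fin n → ℝ} (hy : ∀ i, y i ∈ Ioo (0 : ℝ) 1) :
    ENNReal.ofReal (tvDist ((triGFD n y).map (fun θ => √(n : ℝ) * (θ - θ₀)))
      (gaussianReal (centering triDensity θ₀ (triScore θ₀) n y)
        (fisherInfo triDensity θ₀ (triScore θ₀))⁻¹.toNNReal))
      ≤ 2 * (ENNReal.ofReal (√(2 * Real.pi * (θ₀ * (1 - θ₀))))⁻¹ * localError θ₀ n y) := by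
  have hn0 : (0 : ℝ) < n := by exact_mod_cast hn
  have hs : 0 < √(n : ℝ) := Real.sqrt_pos.2 hn0
  have hv0 : 0 < θ₀ * (1 - θ₀) := mul_pos hθ₀.1 (by linarith [hθ₀.2])
  have hp0 := triLimit_pos hθ₀ hθ₀
  have hl0 := likelihood_pos hθ₀ hy
  have hK := integral_gfdDensity_pos hn hy
  have := isProbabilityMeasure_triGFD hn hy
  have : IsProbabilityMeasure ((triGFD n y).map (fun θ => √(n : ℝ) * (θ - θ₀))) :=
    Measure.isProbabilityMeasure_map (by fun_prop)
  rw [fisherInfo_tri hθ₀, inv_inv]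
  set v : ℝ≥0 := (θ₀ * (1 - θ₀)).toNNReal with hv
  have hvr : (v : ℝ) = θ₀ * (1 - θ₀) := Real.coe_toNNReal _ hv0.le
  have hvne : v ≠ 0 := by
    intro h; rw [h] at hvr; simp only [NNReal.coe_zero] at hvr; linarith
  set Δ := centering triDensity θ₀ (triScore θ₀) n y with hΔ
  set S := sumScore θ₀ y / √(n : ℝ) with hS
  have hΔS : Δ = θ₀ * (1 - θ₀) * S := centering_tri hθ₀ y
  -- the constant that turns the Gaussian exponential into the Gaussian density
  set k := (√(2 * Real.pi * (θ₀ * (1 - θ₀))))⁻¹ * Real.exp (-(Δ ^ 2 / (2 * (θ₀ * (1 - θ₀))))) with hk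
  have hk0 : 0 < k := by
    have := Real.pi_pos
    positivity
  have hkle : k ≤ (√(2 * Real.pi * (θ₀ * (1 - θ₀))))⁻¹ := by
    refine mul_le_of_le_one_right (by positivity) ?_
    rw [Real.exp_le_one_iff, neg_nonpos]; positivity
  have hpdf : ∀ h, gaussianPDFReal Δ v h = k * Real.exp (gaussExponent θ₀ (h / √n) y) := fun h => by
    rw [gaussianPDFReal_def, hvr, hk]
    simp only
    rw [mul_assoc (√(2 * Real.pi * (θ₀ * (1 - θ₀))))⁻¹, ← Real.exp_add]
    congr 2
    have e : h / √(n : ℝ) * sumScore θ₀ y = h * S := by rw [hS]; ring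
    rw [gaussExponent, e, div_pow, Real.sq_sqrt hn0.le, hΔS]
    have h1 := hθ₀.1.ne'
    have h2 : 1 - θ₀ ≠ 0 := by linarith [hθ₀.2]
    field_simp
    ring
  have mu : Measurable (scaledDensity θ₀ n y) := by
    have h : Measurable (fun t : ℝ => (y, t)) := by fun_prop
    have h2 := (measurable_scaledDensity θ₀ n).comp h
    exact h2
  have mw : Measurable (fun h : ℝ => gaussExponent θ₀ (h / √n) y) := by
    unfold gaussExponent; fun_prop
  set C := likelihood triDensity n y θ₀ * triLimit θ₀ θ₀ / ((∫ t, gfdDensity n y t) * k) with hC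
  have hmap : (triGFD n y).map (fun θ => √(n : ℝ) * (θ - θ₀))
      = (ENNReal.ofReal (√(n : ℝ))⁻¹ * ENNReal.ofReal C) •
        volume.withDensity fun h => ENNReal.ofReal (k * scaledDensity θ₀ n y h) := by
    rw [triGFD_eq hy, map_affine_withDensity
      ((measurable_gfdDensity_right n y).div_const _).ennreal_ofReal hs, mul_smul,
      ← withDensity_smul _ (mu.const_mul k).ennreal_ofReal]
    congr 2
    ext h
    simp only [Pi.smul_apply, smul_eq_mul]
    rw [← ENNReal.ofReal_mul (by positivity)]
    congr 1
    rw [scaledDensity, hC]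
    field_simp
  have hgauss : gaussianReal Δ v = volume.withDensity fun h =>
      ENNReal.ofReal (k * Real.exp (gaussExponent θ₀ (h / √n) y)) := by
    rw [gaussianReal_of_var_ne_zero _ hvne]
    congr 1
    ext h
    rw [gaussianPDF, hpdf]
  refine (tvDist_le_lintegral (mu.const_mul k) (mw.exp.const_mul k) hmap hgauss).trans ?_
  gcongr
  rw [localError, ← lintegral_const_mul' _ _ ENNReal.ofReal_ne_top]
  refine lintegral_mono fun h => ?_
  simp only
  rw [← ENNReal.ofReal_mul (by positivity), ← mul_sub, abs_mul, abs_of_pos hk0]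
  gcongr

/-! ### The Bernstein–von Mises property -/

/-- Gaussian tail bound: half of the exponent is spent on the tail, the other half on
integrability. -/
lemma lintegral_gaussian_tail_le {c M : ℝ} (hc : 0 < c) (hM : 0 ≤ M) :
    ∫⁻ h in {h : ℝ | M < |h|}, ENNReal.ofReal (Real.exp (-c * h ^ 2))
      ≤ ENNReal.ofReal (Real.exp (-(c / 2 * M ^ 2)) * √(Real.pi / (c / 2))) := by
  have hS : MeasurableSet {h : ℝ | M < |h|} := measurableSet_lt measurable_const measurable_norm
  rw [ENNReal.ofReal_mul (Real.exp_pos _).le, ← integral_gaussian (c / 2),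
    ofReal_integral_eq_lintegral_ofReal (integrable_exp_neg_mul_sq (by positivity))
      (ae_of_all _ fun _ => (Real.exp_pos _).le), ← lintegral_const_mul' _ _ ENNReal.ofReal_ne_top]
  refine le_trans (setLIntegral_mono' hS fun h hh => ?_) (setLIntegral_le_lintegral _ _)
  rw [← ENNReal.ofReal_mul (Real.exp_pos _).le, ← Real.exp_add]
  refine ENNReal.ofReal_le_ofReal (Real.exp_le_exp.2 ?_)
  have : M ^ 2 ≤ h ^ 2 := by
    rw [← sq_abs h]; exact pow_le_pow_left₀ hM (le_of_lt hh) 2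
  nlinarith

/-- The mass of the fiducial density outside a neighbourhood of order `n^{-1/2}` is small in mean,
on the event that the test accepts. -/
lemma lintegral_scaledDensity_tail_le {θ₀ : ℝ} (hθ₀ : θ₀ ∈ Ioo (0 : ℝ) 1) {n : ℕ} (hn : 0 < n)
    (M : ℝ) :
    ∫⁻ y in {y : Fin n → ℝ | |countStat θ₀ y| < √n * margin θ₀ * M / 2},
      (∫⁻ h in {h : ℝ | M < |h|}, ENNReal.ofReal (scaledDensity θ₀ n y h))
        ∂(sampleLaw triDensity n θ₀)
      ≤ ENNReal.ofReal (1 / triLimit θ₀ θ₀) * ∫⁻ h in {h : ℝ | M < |h|},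
          ENNReal.ofReal (Real.exp (-(margin θ₀ ^ 2 / 2) * h ^ 2)) := by
  have hn0 : (0 : ℝ) < n := by exact_mod_cast hn
  have hs : 0 < √(n : ℝ) := Real.sqrt_pos.2 hn0
  have ha := margin_pos hθ₀
  have hp0 := triLimit_pos hθ₀ hθ₀
  have := isProbabilityMeasure_sampleLaw (n := n) hθ₀
  have hH : MeasurableSet {h : ℝ | M < |h|} := measurableSet_lt measurable_const measurable_norm
  set S := {y : Fin n → ℝ | |countStat θ₀ y| < √n * margin θ₀ * M / 2} with hS
  have mS : MeasurableSet S := measurableSet_lt (measurable_countStat θ₀ n).abs measurable_const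
  have mjoint := (measurable_scaledDensity θ₀ n).ennreal_ofReal
  -- after exchanging the integrals, the likelihood at `θ₀` cancels, and what remains for each `h` is
  -- the probability under the mode `θ₀ + h / √n` that the test accepts
  rw [lintegral_lintegral_swap mjoint.aemeasurable, ← lintegral_const_mul' _ _ ENNReal.ofReal_ne_top]
  refine setLIntegral_mono' hH fun h (hh : M < |h|) => ?_
  have my : Measurable fun y : Fin n → ℝ => ENNReal.ofReal (scaledDensity θ₀ n y h) := by
    have h1 : Measurable (fun y : Fin n → ℝ => (y, h)) := by fun_prop
    have h2 := mjoint.comp h1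
    exact h2
  by_cases hm : θ₀ + h / √n ∈ Ioo (0 : ℝ) 1
  · rw [sampleLaw_eq_withDensity hθ₀, setLIntegral_withDensity_eq_setLIntegral_mul _
      (measurable_likelihood_left n θ₀).ennreal_ofReal my mS]
    have hpt : ∀ y : Fin n → ℝ, ((fun y => ENNReal.ofReal (likelihood triDensity n y θ₀))
        * fun y => ENNReal.ofReal (scaledDensity θ₀ n y h)) y
        ≤ ENNReal.ofReal (1 / (2 * triLimit θ₀ θ₀))
          * ENNReal.ofReal (likelihood triDensity n y (θ₀ + h / √n)) := fun y => by
      simp only [Pi.mul_apply]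
      rw [← ENNReal.ofReal_mul (likelihood_nonneg hθ₀), ← ENNReal.ofReal_mul (by positivity)]
      refine ENNReal.ofReal_le_ofReal ?_
      rw [scaledDensity, gfdDensity_of_mem hm]
      rcases (likelihood_nonneg (y := y) hθ₀).eq_or_lt with h0 | h0
      · rw [← h0]; simp only [zero_mul]
        exact mul_nonneg (by positivity) (likelihood_nonneg hm)
      · have hJ := triJac_le (n := n) (y := y) hm
        have hl := likelihood_nonneg (y := y) hm
        calc _ = likelihood triDensity n y (θ₀ + h / √n) * triJac n y (θ₀ + h / √n)
              / triLimit θ₀ θ₀ := by field_simp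
          _ ≤ likelihood triDensity n y (θ₀ + h / √n) * (1 / 2) / triLimit θ₀ θ₀ := by gcongr
          _ = _ := by field_simp
    refine (lintegral_mono hpt).trans ?_
    rw [lintegral_const_mul' _ _ ENNReal.ofReal_ne_top, ← withDensity_apply _ mS,
      ← sampleLaw_eq_withDensity hm]
    have := isProbabilityMeasure_sampleLaw (n := n) hm
    have habs : |θ₀ + h / √n - θ₀| = |h| / √n := by
      rw [add_sub_cancel_left, abs_div, abs_of_pos hs]
    have h3 := sampleLaw_countStat_lt (n := n) (t := √n * margin θ₀ * M / 2) hm hθ₀ (by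
      rw [habs]
      have e : (n : ℝ) * (margin θ₀ * (|h| / √n)) = √n * margin θ₀ * |h| := by
        nth_rw 1 [← Real.mul_self_sqrt hn0.le]; field_simp
      rw [e]; gcongr)
    rw [habs] at h3
    rw [← ofReal_measureReal, ← ENNReal.ofReal_mul (by positivity),
      ← ENNReal.ofReal_mul (by positivity)]
    refine ENNReal.ofReal_le_ofReal ?_
    calc _ ≤ 1 / (2 * triLimit θ₀ θ₀) * (2 * Real.exp (-(n * (margin θ₀ * (|h| / √n)) ^ 2 / 2))) := by
          gcongr
      _ = _ := by
          have e : -((n : ℝ) * (margin θ₀ * (|h| / √n)) ^ 2 / 2)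
              = -(margin θ₀ ^ 2 / 2) * h ^ 2 := by
            rw [mul_pow, div_pow, Real.sq_sqrt hn0.le, sq_abs]; field_simp
          rw [e]; field_simp
  · have : ∀ y : Fin n → ℝ, ENNReal.ofReal (scaledDensity θ₀ n y h) = 0 := fun y => by
      rw [scaledDensity, gfdDensity, indicator_of_notMem hm]; simp
    simp only [this, lintegral_zero, zero_le]

/-- The local error converges to zero in mean over bounded sets of the local parameter. -/
lemma exists_lintegral_local_le {θ₀ : ℝ} (hθ₀ : θ₀ ∈ Ioo (0 : ℝ) 1) {M η : ℝ} (hM : 0 < M)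
    (hη : 0 < η) : ∃ N : ℕ, 0 < N ∧ ∀ n ≥ N,
      ∫⁻ y : Fin n → ℝ, (∫⁻ h in {h : ℝ | M < |h|}ᶜ,
        ENNReal.ofReal |scaledDensity θ₀ n y h - Real.exp (gaussExponent θ₀ (h / √n) y)|)
        ∂(sampleLaw triDensity n θ₀) ≤ ENNReal.ofReal η := by
  obtain ⟨N, hN0, hN⟩ := exists_integral_localDensity_le hθ₀ hM (η := η / (2 * M)) (by positivity)
  refine ⟨N, hN0, fun n hn => ?_⟩
  have := isProbabilityMeasure_sampleLaw (n := n) hθ₀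
  have hH : MeasurableSet {h : ℝ | M < |h|} := measurableSet_lt measurable_const measurable_norm
  have mjoint := ((measurable_scaledDensity θ₀ n).sub
    (measurable_gaussExponent_prod θ₀ n).exp).abs.ennreal_ofReal
  rw [lintegral_lintegral_swap mjoint.aemeasurable]
  have hvol : volume ({h : ℝ | M < |h|}ᶜ) = ENNReal.ofReal (2 * M) := by
    have : ({h : ℝ | M < |h|}ᶜ) = Icc (-M) M := by
      ext h; simp [abs_le]
    rw [this, Real.volume_Icc]; congr 1; ring
  calc _ ≤ ∫⁻ _ in {h : ℝ | M < |h|}ᶜ, ENNReal.ofReal (η / (2 * M)) := by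
        refine setLIntegral_mono' hH.compl fun h hh => ?_
        obtain ⟨h1, h2, h3⟩ := hN n hn h (not_lt.1 hh)
        refine le_trans (le_of_eq ?_) (ENNReal.ofReal_le_ofReal h3)
        rw [ofReal_integral_eq_lintegral_ofReal h2 (ae_of_all _ fun _ => abs_nonneg _)]
        refine lintegral_congr_ae ?_
        filter_upwards [sampleLaw_ae hθ₀] with y hy
        rw [scaledDensity_eq_localDensity hθ₀ h1 hy]
    _ = _ := by
        rw [setLIntegral_const, hvol, ← ENNReal.ofReal_mul (by positivity)]
        congr 1; field_simp

/-- The centring sequence is bounded in probability. -/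
lemma sampleLaw_sumScore_ge {θ₀ : ℝ} (hθ₀ : θ₀ ∈ Ioo (0 : ℝ) 1) {n : ℕ} (hn : 0 < n) {M : ℝ}
    (hM : 0 < M) :
    sampleLaw triDensity n θ₀ {y | √n * M ≤ |sumScore θ₀ y|}
      ≤ ENNReal.ofReal ((θ₀ * (1 - θ₀))⁻¹ / M ^ 2) := by
  have hn0 : (0 : ℝ) < n := by exact_mod_cast hn
  have hs : 0 < √(n : ℝ) := Real.sqrt_pos.2 hn0
  have := isProbabilityMeasure_law hθ₀
  have := isProbabilityMeasure_sampleLaw (n := n) hθ₀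
  have hi : Integrable (fun y : Fin n → ℝ => sumScore θ₀ y ^ 2) (sampleLaw triDensity n θ₀) :=
    integrable_of_bound_sampleLaw hθ₀ ((measurable_sumScore θ₀ n).pow_const 2)
      (C := (n * (1 / margin θ₀)) ^ 2) fun y hy => by
        rw [abs_pow]; exact pow_le_pow_left₀ (abs_nonneg _) (abs_sumScore_le hθ₀ hy) 2
  refine (measure_abs_ge_le hi (by positivity)).trans (ENNReal.ofReal_le_ofReal ?_)
  have h := integral_sum_sq_le (n := n) (law triDensity θ₀) (memLp_of_bound_law hθ₀
    (measurable_triScore θ₀) (C := 1 / margin θ₀) fun y _ => abs_triScore_le_margin hθ₀)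
  rw [integral_triScore hθ₀, integral_triScore_sq hθ₀] at h
  have h' : ∫ y : Fin n → ℝ, sumScore θ₀ y ^ 2 ∂(sampleLaw triDensity n θ₀)
      ≤ n * (θ₀ * (1 - θ₀))⁻¹ := by
    refine h.trans_eq ?_; ring
  rw [mul_pow, Real.sq_sqrt hn0.le]
  calc _ ≤ n * (θ₀ * (1 - θ₀))⁻¹ / (n * M ^ 2) := by gcongr
    _ = _ := by field_simp

/-- If the centring is bounded, the linear term of the Gaussian exponent takes away at most half of
the quadratic one on the tails. -/
lemma lintegral_gaussExponent_tail_le {θ₀ : ℝ} (hθ₀ : θ₀ ∈ Ioo (0 : ℝ) 1) {n : ℕ} (hn : 0 < n)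
    {M : ℝ} {y : Fin n → ℝ}
    (hy : |sumScore θ₀ y| < √n * ((θ₀ * (1 - θ₀))⁻¹ * M / 4)) :
    ∫⁻ h in {h : ℝ | M < |h|}, ENNReal.ofReal (Real.exp (gaussExponent θ₀ (h / √n) y))
      ≤ ∫⁻ h in {h : ℝ | M < |h|}, ENNReal.ofReal (Real.exp (-((θ₀ * (1 - θ₀))⁻¹ / 4) * h ^ 2)) := by
  have hn0 : (0 : ℝ) < n := by exact_mod_cast hn
  have hs : 0 < √(n : ℝ) := Real.sqrt_pos.2 hn0
  have hI : 0 < (θ₀ * (1 - θ₀))⁻¹ := inv_pos.2 (mul_pos hθ₀.1 (by linarith [hθ₀.2]))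
  have hH : MeasurableSet {h : ℝ | M < |h|} := measurableSet_lt measurable_const measurable_norm
  refine setLIntegral_mono' hH fun h (hh : M < |h|) => ?_
  refine ENNReal.ofReal_le_ofReal (Real.exp_le_exp.2 ?_)
  set I := (θ₀ * (1 - θ₀))⁻¹ with hIdef
  have h1 : h / √n * sumScore θ₀ y ≤ |h| * (I * M / 4) := by
    refine (le_abs_self _).trans ?_
    rw [abs_mul, abs_div, abs_of_pos hs, div_mul_eq_mul_div, div_le_iff₀ hs, mul_assoc]
    refine mul_le_mul_of_nonneg_left ?_ (abs_nonneg _)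
    linarith
  have h2 : |h| * (I * M / 4) ≤ I / 4 * h ^ 2 := by
    rw [← sq_abs h]
    have := mul_le_mul_of_nonneg_left hh.le (show 0 ≤ |h| * I / 4 by positivity)
    linarith
  rw [gaussExponent, div_pow, Real.sq_sqrt hn0.le, ← hIdef]
  have e : (n : ℝ) * (h ^ 2 / n) * I / 2 = I / 2 * h ^ 2 := by field_simp
  rw [e]
  linarith

/-- The local error converges to zero in probability. -/
lemma tendsto_localError {θ₀ : ℝ} (hθ₀ : θ₀ ∈ Ioo (0 : ℝ) 1) {ε : ℝ} (hε : 0 < ε) :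
    Tendsto (fun n : ℕ => sampleLaw triDensity n θ₀ {y | ENNReal.ofReal ε ≤ localError θ₀ n y})
      atTop (𝓝 0) := by
  have ha := margin_pos hθ₀
  have hp0 := triLimit_pos hθ₀ hθ₀
  set a := margin θ₀ with hadef
  set p := triLimit θ₀ θ₀ with hp
  set I := (θ₀ * (1 - θ₀))⁻¹ with hIdef
  have hI : 0 < I := inv_pos.2 (mul_pos hθ₀.1 (by linarith [hθ₀.2]))
  -- error terms that depend only on the radius `M` of the local neighbourhood
  set T : ℝ → ℝ → ℝ := fun c M => Real.exp (-(c / 2 * M ^ 2)) * √(Real.pi / (c / 2)) with hT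
  have hTlim : ∀ c, 0 < c → Tendsto (T c) atTop (𝓝 0) := fun c hc => by
    have h1 : Tendsto (fun M : ℝ => c / 2 * M ^ 2) atTop atTop :=
      (tendsto_pow_atTop two_ne_zero).const_mul_atTop (by positivity)
    have := (Real.tendsto_exp_neg_atTop_nhds_zero.comp h1).mul_const (√(Real.pi / (c / 2)))
    simpa [hT, Function.comp_def] using this
  have hTnn : ∀ c M, 0 ≤ T c M := fun c M => by positivity
  set q : ℝ → ℝ := fun M => 2 * Real.exp (-(a ^ 2 * M ^ 2 / 2)) + I / (I * M / 4) ^ 2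
    + 3 / ε * (1 / p * T (a ^ 2 / 2) M) with hq
  have hqlim : Tendsto q atTop (𝓝 0) := by
    have h1 : Tendsto (fun M : ℝ => a ^ 2 * M ^ 2 / 2) atTop atTop := by
      have : Tendsto (fun M : ℝ => a ^ 2 / 2 * M ^ 2) atTop atTop :=
        (tendsto_pow_atTop two_ne_zero).const_mul_atTop (by positivity)
      refine this.congr fun M => by ring
    have h2 : Tendsto (fun M : ℝ => I / (I * M / 4) ^ 2) atTop (𝓝 0) := by
      refine Tendsto.const_div_atTop ?_ I
      have : Tendsto (fun M : ℝ => (I / 4) ^ 2 * M ^ 2) atTop atTop :=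
        (tendsto_pow_atTop two_ne_zero).const_mul_atTop (by positivity)
      refine this.congr fun M => by ring
    have h3 := ((Real.tendsto_exp_neg_atTop_nhds_zero.comp h1).const_mul 2).add h2 |>.add
      (((hTlim (a ^ 2 / 2) (by positivity)).const_mul (1 / p)).const_mul (3 / ε))
    simpa [hq, Function.comp_def] using h3
  rw [ENNReal.tendsto_nhds_zero]
  intro τ' hτ'
  obtain ⟨τ, hτ, hττ'⟩ : ∃ τ : ℝ, 0 < τ ∧ ENNReal.ofReal τ ≤ τ' := by
    rcases eq_or_ne τ' ⊤ with rfl | h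
    · exact ⟨1, one_pos, le_top⟩
    · exact ⟨τ'.toReal, ENNReal.toReal_pos hτ'.ne' h, (ENNReal.ofReal_toReal h).le⟩
  -- the radius `M` is fixed first, and the sample size is chosen depending on it
  obtain ⟨M, hMq, hMT, hM⟩ := ((hqlim.eventually (gt_mem_nhds (half_pos hτ))).and
    (((hTlim (I / 4) (by positivity)).eventually (gt_mem_nhds (show 0 < ε / 3 by positivity))).and
      (eventually_gt_atTop 0))).exists
  obtain ⟨N, hN0, hN⟩ := exists_lintegral_local_le hθ₀ hM (η := τ / 2 * (ε / 3)) (by positivity)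
  filter_upwards [eventually_ge_atTop N] with n hn
  have hn1 : 0 < n := hN0.trans_le hn
  have hn0 : (0 : ℝ) < n := by exact_mod_cast hn1
  have hs : 0 < √(n : ℝ) := Real.sqrt_pos.2 hn0
  have := isProbabilityMeasure_sampleLaw (n := n) hθ₀
  set P := sampleLaw triDensity n θ₀ with hP
  have hH : MeasurableSet {h : ℝ | M < |h|} := measurableSet_lt measurable_const measurable_norm
  set S := {y : Fin n → ℝ | |countStat θ₀ y| < √n * a * M / 2} with hS
  have mS : MeasurableSet S := measurableSet_lt (measurable_countStat θ₀ n).abs measurable_const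
  have mjoint := ((measurable_scaledDensity θ₀ n).sub
    (measurable_gaussExponent_prod θ₀ n).exp).abs.ennreal_ofReal
  set A : (Fin n → ℝ) → ℝ≥0∞ := fun y => ∫⁻ h in {h : ℝ | M < |h|}ᶜ,
    ENNReal.ofReal |scaledDensity θ₀ n y h - Real.exp (gaussExponent θ₀ (h / √n) y)| with hA
  set B : (Fin n → ℝ) → ℝ≥0∞ := fun y => ∫⁻ h in {h : ℝ | M < |h|},
    ENNReal.ofReal (scaledDensity θ₀ n y h) with hB
  have mA : Measurable A := mjoint.lintegral_prod_right'
  have mB : Measurable B := (measurable_scaledDensity θ₀ n).ennreal_ofReal.lintegral_prod_right'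
  have hε3 : 0 < ε / 3 := by positivity
  -- a large local error has one of four causes: the test rejects, the centring is large, the error for
  -- `|h| ≤ M` is large, or the fiducial mass for `|h| > M` is large although the test accepts
  have hsub : {y | ENNReal.ofReal ε ≤ localError θ₀ n y} ⊆
      ({y | √n * a * M / 2 ≤ |countStat θ₀ y|} ∪ {y | √n * (I * M / 4) ≤ |sumScore θ₀ y|})
      ∪ ({y | ENNReal.ofReal (ε / 3) ≤ A y} ∪ {y | ENNReal.ofReal (ε / 3) ≤ S.indicator B y}) := by
    intro y hy
    by_contra hcon
    simp only [mem_union, mem_ofPred_eq, not_or, not_le] at hcon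
    obtain ⟨⟨c1, c2⟩, c3, c4⟩ := hcon
    rw [indicator_of_mem (show y ∈ S from c1)] at c4
    have hy' : ENNReal.ofReal ε ≤ localError θ₀ n y := hy
    refine absurd hy' (not_le.2 ?_)
    have hC := (lintegral_gaussExponent_tail_le hθ₀ hn1 c2).trans
      (lintegral_gaussian_tail_le (c := I / 4) (by positivity) hM.le)
    have hC' : ∫⁻ h in {h : ℝ | M < |h|}, ENNReal.ofReal
        (Real.exp (gaussExponent θ₀ (h / √n) y)) < ENNReal.ofReal (ε / 3) :=
      hC.trans_lt ((ENNReal.ofReal_lt_ofReal_iff hε3).2 hMT)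
    have mu : Measurable fun h => ENNReal.ofReal (scaledDensity θ₀ n y h) := by
      have h : Measurable (fun t : ℝ => (y, t)) := by fun_prop
      have h2 := (measurable_scaledDensity θ₀ n).ennreal_ofReal.comp h
      exact h2
    calc localError θ₀ n y
        = (∫⁻ h in {h : ℝ | M < |h|}, ENNReal.ofReal |scaledDensity θ₀ n y h
            - Real.exp (gaussExponent θ₀ (h / √n) y)|) + A y :=
          (lintegral_add_compl _ hH).symm
      _ ≤ (B y + ∫⁻ h in {h : ℝ | M < |h|}, ENNReal.ofReal
            (Real.exp (gaussExponent θ₀ (h / √n) y))) + A y := by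
          refine add_le_add ?_ le_rfl
          rw [hB, ← lintegral_add_left mu]
          refine lintegral_mono fun h => ?_
          refine (ENNReal.ofReal_le_ofReal (abs_sub _ _)).trans ?_
          rw [abs_of_pos (Real.exp_pos _), abs_of_nonneg]
          · exact ENNReal.ofReal_add_le
          · exact div_nonneg gfdDensity_nonneg (mul_nonneg (likelihood_nonneg hθ₀) hp0.le)
      _ < ENNReal.ofReal (ε / 3) + ENNReal.ofReal (ε / 3) + ENNReal.ofReal (ε / 3) :=
          ENNReal.add_lt_add (ENNReal.add_lt_add c4 hC') c3
      _ = ENNReal.ofReal ε := by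
          rw [← ENNReal.ofReal_add hε3.le hε3.le, ← ENNReal.ofReal_add (by positivity) hε3.le]
          congr 1; ring
  have b1 : P {y | √n * a * M / 2 ≤ |countStat θ₀ y|}
      ≤ ENNReal.ofReal (2 * Real.exp (-(a ^ 2 * M ^ 2 / 2))) := by
    rw [← ofReal_measureReal]
    refine ENNReal.ofReal_le_ofReal ((sampleLaw_countStat_ge hθ₀ (by positivity)).trans_eq ?_)
    congr 3
    rw [div_pow, mul_pow, mul_pow, Real.sq_sqrt hn0.le]; field_simp
  have b2 := sampleLaw_sumScore_ge hθ₀ hn1 (M := I * M / 4) (by positivity)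
  rw [← hIdef] at b2
  have hne : ENNReal.ofReal (ε / 3) ≠ 0 := by simpa using hε3
  have b3 : P {y | ENNReal.ofReal (ε / 3) ≤ A y} ≤ ENNReal.ofReal (τ / 2) := by
    refine (meas_ge_le_lintegral_div mA.aemeasurable hne ENNReal.ofReal_ne_top).trans ?_
    refine (ENNReal.div_le_div_right (hN n hn) _).trans_eq ?_
    rw [← ENNReal.ofReal_div_of_pos hε3]
    congr 1; field_simp
  have b4 : P {y | ENNReal.ofReal (ε / 3) ≤ S.indicator B y}
      ≤ ENNReal.ofReal (3 / ε * (1 / p * T (a ^ 2 / 2) M)) := by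
    refine (meas_ge_le_lintegral_div (mB.indicator mS).aemeasurable hne
      ENNReal.ofReal_ne_top).trans ?_
    rw [lintegral_indicator mS]
    refine (ENNReal.div_le_div_right ((lintegral_scaledDensity_tail_le hθ₀ hn1 M).trans
      (mul_le_mul_right (lintegral_gaussian_tail_le (by positivity) hM.le) _)) _).trans_eq ?_
    rw [← ENNReal.ofReal_mul (by positivity), ← ENNReal.ofReal_div_of_pos hε3]
    congr 1
    simp only [hT, ← hadef, ← hp]
    field_simp
  have e1 : 0 ≤ I / (I * M / 4) ^ 2 := by positivity
  have e2 : 0 ≤ 3 / ε * (1 / p * T (a ^ 2 / 2) M) := by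
    have := hTnn (a ^ 2 / 2) M
    positivity
  calc P {y | ENNReal.ofReal ε ≤ localError θ₀ n y}
      ≤ (ENNReal.ofReal (2 * Real.exp (-(a ^ 2 * M ^ 2 / 2)))
          + ENNReal.ofReal (I / (I * M / 4) ^ 2))
        + (ENNReal.ofReal (τ / 2) + ENNReal.ofReal (3 / ε * (1 / p * T (a ^ 2 / 2) M))) :=
        (measure_mono hsub).trans ((measure_union_le _ _).trans (add_le_add
          ((measure_union_le _ _).trans (add_le_add b1 b2))
          ((measure_union_le _ _).trans (add_le_add b3 b4))))
    _ = ENNReal.ofReal (q M + τ / 2) := by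
        rw [← ENNReal.ofReal_add (by positivity) e1, ← ENNReal.ofReal_add (by positivity) e2,
          ← ENNReal.ofReal_add (by positivity) (by positivity)]
        congr 1; simp only [hq]; ring
    _ ≤ ENNReal.ofReal τ := ENNReal.ofReal_le_ofReal (by linarith)
    _ ≤ τ' := hττ'

lemma bernsteinVonMises_triGFD {θ₀ : ℝ} (hθ₀ : θ₀ ∈ Ioo (0 : ℝ) 1) :
    BernsteinVonMises triDensity triGFD θ₀ (triScore θ₀) := by
  intro ε hε
  have hv0 : 0 < θ₀ * (1 - θ₀) := mul_pos hθ₀.1 (by linarith [hθ₀.2])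
  set k := (√(2 * Real.pi * (θ₀ * (1 - θ₀))))⁻¹ with hk
  have hk0 : 0 < k := by
    have := Real.pi_pos
    positivity
  refine tendsto_of_tendsto_of_tendsto_of_le_of_le' tendsto_const_nhds
    (tendsto_localError hθ₀ (ε := ε / (2 * k)) (by positivity))
    (Eventually.of_forall fun _ => zero_le) ?_
  filter_upwards [eventually_gt_atTop 0] with n hn
  refine measure_mono_ae ?_
  filter_upwards [sampleLaw_ae hθ₀] with y hy
  intro (hbad : ε ≤ _)
  have h := (ENNReal.ofReal_le_ofReal hbad).trans (tvDist_le_localError hθ₀ hn hy)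
  change ENNReal.ofReal (ε / (2 * k)) ≤ localError θ₀ n y
  rw [← hk, ← mul_assoc, ← ENNReal.ofReal_ofNat 2, ← ENNReal.ofReal_mul zero_le_two] at h
  rw [ENNReal.ofReal_div_of_pos (by positivity)]
  exact ENNReal.div_le_of_le_mul' h

/-! ### The modified fiducial distribution -/

lemma minSq_nonneg {n : ℕ} (y : Fin n → ℝ) : 0 ≤ minSq y := Real.iInf_nonneg fun _ => sq_nonneg _

lemma minSqCompl_nonneg {n : ℕ} (y : Fin n → ℝ) : 0 ≤ minSqCompl y :=
  Real.iInf_nonneg fun _ => sq_nonneg _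

lemma minSq_le {n : ℕ} (y : Fin n → ℝ) (i : Fin n) : minSq y ≤ y i ^ 2 :=
  ciInf_le (Finite.bddBelow_range _) i

lemma minSqCompl_le {n : ℕ} (y : Fin n → ℝ) (i : Fin n) : minSqCompl y ≤ (1 - y i) ^ 2 :=
  ciInf_le (Finite.bddBelow_range _) i

lemma minSq_add_minSqCompl_le_one {n : ℕ} (hn : 0 < n) {y : Fin n → ℝ}
    (hy : ∀ i, y i ∈ Ioo (0 : ℝ) 1) : minSq y + minSqCompl y ≤ 1 := by
  have h := hy ⟨0, hn⟩
  have := minSq_le y ⟨0, hn⟩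
  have := minSqCompl_le y ⟨0, hn⟩
  nlinarith [h.1, h.2]

lemma isProbabilityMeasure_triModGFD {n : ℕ} (hn : 0 < n) {y : Fin n → ℝ}
    (hy : ∀ i, y i ∈ Ioo (0 : ℝ) 1) : IsProbabilityMeasure (triModGFD n y) := by
  have := isProbabilityMeasure_triGFD hn hy
  have h1 := minSq_nonneg y
  have h2 := minSqCompl_nonneg y
  have h3 := minSq_add_minSqCompl_le_one hn hy
  refine ⟨?_⟩
  simp only [triModGFD, Measure.add_apply, Measure.smul_apply, measure_univ, smul_eq_mul, mul_one]
  rw [← ENNReal.ofReal_add h2 h1, ← ENNReal.ofReal_add (by positivity) (by linarith),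
    ← ENNReal.ofReal_one]
  congr 1; ring

lemma tvDist_triModGFD_le {n : ℕ} (hn : 0 < n) {y : Fin n → ℝ} (hy : ∀ i, y i ∈ Ioo (0 : ℝ) 1) :
    tvDist (triModGFD n y) (triGFD n y) ≤ minSq y + minSqCompl y := by
  have := isProbabilityMeasure_triGFD hn hy
  have h1 := minSq_nonneg y
  have h2 := minSqCompl_nonneg y
  have h3 := minSq_add_minSqCompl_le_one hn hy
  refine tvDist_le_of_forall fun B _ => ?_
  have e : (triModGFD n y).real B = minSqCompl y * (Measure.dirac (0 : ℝ)).real B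
      + minSq y * (Measure.dirac (1 : ℝ)).real B
      + (1 - minSq y - minSqCompl y) * (triGFD n y).real B := by
    have hf : ∀ (x : ℝ) (μ : Measure ℝ) [IsFiniteMeasure μ], (ENNReal.ofReal x • μ) B ≠ ⊤ :=
      fun x μ _ => ENNReal.mul_ne_top ENNReal.ofReal_ne_top (measure_ne_top _ _)
    rw [triModGFD, measureReal_add_apply (ENNReal.add_ne_top.2 ⟨hf _ _, hf _ _⟩) (hf _ _),
      measureReal_add_apply (hf _ _) (hf _ _), measureReal_ennreal_smul_apply,
      measureReal_ennreal_smul_apply, measureReal_ennreal_smul_apply, ENNReal.toReal_ofReal h1,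
      ENNReal.toReal_ofReal h2, ENNReal.toReal_ofReal (by linarith)]
  rw [e]
  have b0 := measureReal_le_one (μ := Measure.dirac (0 : ℝ)) (s := B)
  have b1 := measureReal_le_one (μ := Measure.dirac (1 : ℝ)) (s := B)
  have b2 := measureReal_le_one (μ := triGFD n y) (s := B)
  have c0 := measureReal_nonneg (μ := Measure.dirac (0 : ℝ)) (s := B)
  have c1 := measureReal_nonneg (μ := Measure.dirac (1 : ℝ)) (s := B)
  have c2 := measureReal_nonneg (μ := triGFD n y) (s := B)
  generalize (Measure.dirac (0 : ℝ)).real B = p at *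
  generalize (Measure.dirac (1 : ℝ)).real B = q at *
  generalize (triGFD n y).real B = r at *
  rw [abs_le]
  constructor <;> nlinarith

lemma abs_measureReal_sub_le_tvDist {μ ν : Measure ℝ} [IsProbabilityMeasure μ]
    [IsProbabilityMeasure ν] {B : Set ℝ} (hB : MeasurableSet B) :
    |μ.real B - ν.real B| ≤ tvDist μ ν := by
  refine le_ciSup (f := fun B : {B : Set ℝ // MeasurableSet B} => |μ.real B.1 - ν.real B.1|)
    ⟨1, ?_⟩ ⟨B, hB⟩
  rintro _ ⟨C, rfl⟩
  have b1 := measureReal_le_one (μ := μ) (s := C.1)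
  have b2 := measureReal_le_one (μ := ν) (s := C.1)
  have c1 := measureReal_nonneg (μ := μ) (s := C.1)
  have c2 := measureReal_nonneg (μ := ν) (s := C.1)
  exact abs_le.2 ⟨by linarith, by linarith⟩

lemma tvDist_map_triangle {μ ν ρ : Measure ℝ} [IsProbabilityMeasure μ] [IsProbabilityMeasure ν]
    [IsProbabilityMeasure ρ] {φ : ℝ → ℝ} (hφ : Measurable φ) :
    tvDist (μ.map φ) ρ ≤ tvDist μ ν + tvDist (ν.map φ) ρ := by
  have := Measure.isProbabilityMeasure_map (μ := ν) hφ.aemeasurable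
  refine tvDist_le_of_forall fun B hB => ?_
  rw [map_measureReal_apply hφ hB]
  have h1 := abs_measureReal_sub_le_tvDist (μ := μ) (ν := ν) (hφ hB)
  have h2 := abs_measureReal_sub_le_tvDist (μ := ν.map φ) (ν := ρ) hB
  rw [map_measureReal_apply hφ hB] at h2
  exact (abs_sub_le _ _ _).trans (add_le_add h1 h2)

/-- A triangular law charges every open set that meets the unit interval. -/
lemma law_triDensity_lt_one {θ : ℝ} (hθ : θ ∈ Ioo (0 : ℝ) 1) {g : ℝ → ℝ} (hg : Continuous g)
    {ε x : ℝ} (hx : x ∈ Ioo (0 : ℝ) 1) (hgx : g x < ε) :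
    law triDensity θ {z | ε ≤ g z} < 1 := by
  have := isProbabilityMeasure_law hθ
  have hU : IsOpen {z | g z < ε} := isOpen_lt hg continuous_const
  have h0 : law triDensity θ {z | g z < ε} ≠ 0 := by
    intro h
    rw [law, withDensity_apply_eq_zero' (measurable_triDensity_left θ).ennreal_ofReal.aemeasurable]
      at h
    have hpos : 0 < volume (Ioo (0 : ℝ) 1 ∩ {z | g z < ε}) :=
      (isOpen_Ioo.inter hU).measure_pos _ ⟨x, hx, hgx⟩
    refine hpos.ne' (measure_mono_null ?_ h)
    rintro z ⟨hz, hz'⟩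
    refine ⟨?_, hz'⟩
    change ENNReal.ofReal _ ≠ 0
    simpa using triDensity_pos hθ hz
  refine lt_of_le_of_ne prob_le_one fun h => h0 ?_
  have hc : {z | g z < ε} = {z | ε ≤ g z}ᶜ := by ext z; simp
  rw [hc, prob_compl_eq_zero_iff (measurableSet_le measurable_const hg.measurable)]
  exact h

/-- The observations do not all stay away from an open set that meets the unit interval. -/
lemma tendsto_sampleLaw_forall {θ : ℝ} (hθ : θ ∈ Ioo (0 : ℝ) 1) {g : ℝ → ℝ} (hg : Continuous g)
    {ε x : ℝ} (hx : x ∈ Ioo (0 : ℝ) 1) (hgx : g x < ε) :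
    Tendsto (fun n : ℕ => sampleLaw triDensity n θ {y | ∀ i, ε ≤ g (y i)}) atTop (𝓝 0) := by
  have := isProbabilityMeasure_law hθ
  refine (ENNReal.tendsto_pow_atTop_nhds_zero_of_lt_one
    (law_triDensity_lt_one hθ hg hx hgx)).congr fun n => ?_
  have : {y : Fin n → ℝ | ∀ i, ε ≤ g (y i)} = Set.pi univ fun _ => {z | ε ≤ g z} := by
    ext y; simp
  rw [this, sampleLaw, Measure.pi_pi]
  simp

/-- Almost surely, some observation falls into a given open set that meets the unit interval: the
event that the first `n` observations miss it has a probability that decays geometrically. -/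
lemma infinitePi_exists {θ : ℝ} (hθ : θ ∈ Ioo (0 : ℝ) 1) {g : ℝ → ℝ} (hg : Continuous g)
    {ε x : ℝ} (hx : x ∈ Ioo (0 : ℝ) 1) (hgx : g x < ε) :
    ∀ᵐ y ∂(Measure.infinitePi (fun _ : ℕ => law triDensity θ)), ∃ i, g (y i) < ε := by
  have := isProbabilityMeasure_law hθ
  rw [ae_iff]
  refine le_antisymm (ge_of_tendsto' (ENNReal.tendsto_pow_atTop_nhds_zero_of_lt_one
    (law_triDensity_lt_one hθ hg hx hgx)) fun n => ?_) zero_le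
  have h := Measure.infinitePi_pi (μ := fun _ : ℕ => law triDensity θ) (s := Finset.range n)
    (t := fun _ => {z | ε ≤ g z}) fun _ _ => measurableSet_le measurable_const hg.measurable
  simp only [Finset.prod_const, Finset.card_range] at h
  rw [← h]
  refine measure_mono fun y hy i _ => ?_
  have hy' : ¬ ∃ i, g (y i) < ε := hy
  push Not at hy'
  exact hy' i

/-- A point near `0` whose reflection is near `1`, in the form in which it is used for the two
minima. -/
lemma exists_sq_lt {ε : ℝ} (hε : 0 < ε) : ∃ x ∈ Ioo (0 : ℝ) 1, x ^ 2 < ε ∧ (1 - (1 - x)) ^ 2 < ε := by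
  have h1 : min (1 / 2) (ε / 2) ≤ 1 / 2 := min_le_left _ _
  have h2 : min (1 / 2) (ε / 2) ≤ ε / 2 := min_le_right _ _
  have h0 : 0 < min (1 / 2) (ε / 2) := lt_min (by norm_num) (by positivity)
  refine ⟨min (1 / 2) (ε / 2), ⟨h0, by linarith⟩, by nlinarith, by nlinarith⟩

lemma tendsto_minSq_add_minSqCompl_ae {θ₀ : ℝ} (hθ₀ : θ₀ ∈ Ioo (0 : ℝ) 1) :
    ∀ᵐ y ∂(Measure.infinitePi (fun _ : ℕ => law triDensity θ₀)),
      Tendsto (fun n : ℕ => minSq (fun i : Fin n => y i) + minSqCompl (fun i : Fin n => y i))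
        atTop (𝓝 0) := by
  have h1 : ∀ k : ℕ, ∀ᵐ y ∂(Measure.infinitePi (fun _ : ℕ => law triDensity θ₀)),
      ∃ i, y i ^ 2 < 1 / ((k : ℝ) + 1) := fun k => by
    obtain ⟨x, hx, hx1, -⟩ := exists_sq_lt (ε := 1 / ((k : ℝ) + 1)) (by positivity)
    exact infinitePi_exists hθ₀ (g := fun x => x ^ 2) (by fun_prop) hx hx1
  have h2 : ∀ k : ℕ, ∀ᵐ y ∂(Measure.infinitePi (fun _ : ℕ => law triDensity θ₀)),
      ∃ i, (1 - y i) ^ 2 < 1 / ((k : ℝ) + 1) := fun k => by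
    obtain ⟨x, hx, -, hx1⟩ := exists_sq_lt (ε := 1 / ((k : ℝ) + 1)) (by positivity)
    exact infinitePi_exists hθ₀ (g := fun x => (1 - x) ^ 2) (by fun_prop)
      (x := 1 - x) ⟨by linarith [hx.2], by linarith [hx.1]⟩ hx1
  filter_upwards [ae_all_iff.2 h1, ae_all_iff.2 h2] with y hy1 hy2
  rw [Metric.tendsto_atTop]
  intro ε hε
  obtain ⟨k, hk⟩ := exists_nat_one_div_lt (half_pos hε)
  obtain ⟨i, hi⟩ := hy1 k
  obtain ⟨j, hj⟩ := hy2 k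
  refine ⟨max i j + 1, fun n hn => ?_⟩
  have hi' := minSq_le (fun i : Fin n => y i) ⟨i, by omega⟩
  have hj' := minSqCompl_le (fun i : Fin n => y i) ⟨j, by omega⟩
  dsimp only at hi' hj'
  rw [Real.dist_eq, sub_zero, abs_of_nonneg (add_nonneg (minSq_nonneg _) (minSqCompl_nonneg _))]
  linarith

lemma bernsteinVonMises_triModGFD {θ₀ : ℝ} (hθ₀ : θ₀ ∈ Ioo (0 : ℝ) 1) :
    BernsteinVonMises triDensity triModGFD θ₀ (triScore θ₀) := by
  intro ε hε
  obtain ⟨x, hx, hx1, hx2⟩ := exists_sq_lt (ε := ε / 4) (by positivity)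
  have l1 := tendsto_sampleLaw_forall hθ₀ (g := fun x => x ^ 2) (by fun_prop) hx hx1
  have l2 := tendsto_sampleLaw_forall hθ₀ (g := fun x => (1 - x) ^ 2) (by fun_prop) (x := 1 - x)
    ⟨by linarith [hx.2], by linarith [hx.1]⟩ hx2
  have l3 := (bernsteinVonMises_triGFD hθ₀ (ε / 2) (by positivity)).add (l1.add l2)
  rw [add_zero, add_zero] at l3
  refine tendsto_of_tendsto_of_tendsto_of_le_of_le' tendsto_const_nhds l3
    (Eventually.of_forall fun _ => zero_le) ?_
  filter_upwards [eventually_gt_atTop 0] with n hn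
  have hne : Nonempty (Fin n) := ⟨⟨0, hn⟩⟩
  refine (measure_mono_ae ?_).trans ((measure_union_le _ _).trans
    (add_le_add le_rfl (measure_union_le _ _)))
  filter_upwards [sampleLaw_ae hθ₀] with y hy
  intro (hbad : ε ≤ _)
  have := isProbabilityMeasure_triGFD hn hy
  have := isProbabilityMeasure_triModGFD hn hy
  have h := tvDist_map_triangle (μ := triModGFD n y) (ν := triGFD n y)
    (ρ := gaussianReal (centering triDensity θ₀ (triScore θ₀) n y)
      (fisherInfo triDensity θ₀ (triScore θ₀))⁻¹.toNNReal)
    (φ := fun θ => √(n : ℝ) * (θ - θ₀)) (by fun_prop)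
  have h' := tvDist_triModGFD_le hn hy
  by_contra hcon
  have hcon' : ¬ (ε / 2 ≤ tvDist ((triGFD n y).map (fun θ => √(n : ℝ) * (θ - θ₀)))
      (gaussianReal (centering triDensity θ₀ (triScore θ₀) n y)
        (fisherInfo triDensity θ₀ (triScore θ₀))⁻¹.toNNReal)
      ∨ (∀ i, ε / 4 ≤ y i ^ 2) ∨ ∀ i, ε / 4 ≤ (1 - y i) ^ 2) := hcon
  push Not at hcon'
  obtain ⟨c1, ⟨i, hi⟩, j, hj⟩ := hcon'
  have := minSq_le y i
  have := minSqCompl_le y j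
  linarith

/-! ### Local geometry of the fiducial curve -/

/-- The vector `y - G(u,θ)`, in the Euclidean space of samples. -/
def residual {n : ℕ} (y u : Fin n → ℝ) (θ : ℝ) : EuclideanSpace ℝ (Fin n) :=
  WithLp.toLp 2 fun i => y i - triDGA (u i) θ

/-- The velocity `∇_θ G(u,θ)` at `u = G⁻¹(y,θ)`, in the Euclidean space of samples. -/
def velocity {n : ℕ} (y : Fin n → ℝ) (θ : ℝ) : EuclideanSpace ℝ (Fin n) :=
  WithLp.toLp 2 fun i => triGradient (y i) θ

lemma misfit_eq_norm {n : ℕ} (y u : Fin n → ℝ) (θ : ℝ) :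
    misfit triDGA y u θ = ‖residual y u θ‖ := rfl

lemma abs_apply_le_norm {n : ℕ} (x : EuclideanSpace ℝ (Fin n)) (i : Fin n) : |x i| ≤ ‖x‖ :=
  PiLp.norm_apply_le x i

lemma norm_le_mul_of_forall {n : ℕ} {x : EuclideanSpace ℝ (Fin n)} {C : ℝ} (hC : 0 ≤ C)
    (h : ∀ i, |x i| ≤ C) : ‖x‖ ≤ n * C := by
  have e : ‖x‖ ^ 2 ≤ (n * C) ^ 2 := by
    rw [EuclideanSpace.norm_sq_eq]
    calc ∑ i, ‖x i‖ ^ 2 ≤ ∑ _i : Fin n, C ^ 2 :=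
          Finset.sum_le_sum fun i _ => pow_le_pow_left₀ (norm_nonneg _) (h i) 2
      _ = n * C ^ 2 := by simp
      _ ≤ n ^ 2 * C ^ 2 := by
          refine mul_le_mul_of_nonneg_right ?_ (sq_nonneg _)
          exact_mod_cast Nat.le_self_pow two_ne_zero n
      _ = _ := by ring
  exact le_of_sq_le_sq e (by positivity)

lemma triDGA_of_notMem {u θ : ℝ} (hθ : θ ∈ Ioo (0 : ℝ) 1) (hu : u ∉ Ioo (0 : ℝ) 1) :
    triDGA u θ = 0 := by
  have h1 : u ∉ Ioc 0 θ := fun h => hu ⟨h.1, h.2.trans_lt hθ.2⟩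
  have h2 : u ∉ Ioo θ 1 := fun h => hu ⟨hθ.1.trans h.1, h.2⟩
  simp [triDGA, h1, h2]

lemma continuousOn_triDGA (u : ℝ) : ContinuousOn (triDGA u) (Ioo 0 1) := by
  by_cases hu : u ∈ Ioo (0 : ℝ) 1
  · exact fun θ hθ => (hasDerivAt_triDGA hθ hu).continuousAt.continuousWithinAt
  · exact continuousOn_const.congr fun θ hθ => triDGA_of_notMem hθ hu

lemma continuousOn_misfit {n : ℕ} (y u : Fin n → ℝ) :
    ContinuousOn (misfit triDGA y u) (Ioo 0 1) := by
  have h : ContinuousOn (fun θ => (fun i => y i - triDGA (u i) θ)) (Ioo 0 1) :=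
    continuousOn_pi.2 fun i => continuousOn_const.sub (continuousOn_triDGA (u i))
  exact ((PiLp.continuous_toLp 2 _).comp_continuousOn h).norm

lemma measurable_residual {n : ℕ} (y : Fin n → ℝ) :
    Measurable (fun z : (Fin n → ℝ) × ℝ => residual y z.1 z.2) := by
  refine (WithLp.measurable_toLp 2 (Fin n → ℝ)).comp ?_
  refine measurable_pi_lambda _ fun i => measurable_const.sub ?_
  have h : Measurable (fun z : (Fin n → ℝ) × ℝ => (z.1 i, z.2)) := by fun_prop
  exact measurable_triDGA.comp h

lemma measurable_velocity {n : ℕ} (y : Fin n → ℝ) : Measurable (velocity y) := by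
  refine (WithLp.measurable_toLp 2 (Fin n → ℝ)).comp ?_
  refine measurable_pi_lambda _ fun i => ?_
  have h : Measurable (fun θ : ℝ => (y i, θ)) := by fun_prop
  exact measurable_triGradient.comp h

lemma norm_velocity {n : ℕ} (hn : 0 < n) (y : Fin n → ℝ) (θ : ℝ) :
    ‖velocity y θ‖ = √n * triJac n y θ := by
  have hn' : (0 : ℝ) < n := by exact_mod_cast hn
  rw [triJac, ← Real.sqrt_mul hn'.le, EuclideanSpace.norm_eq, ← mul_assoc, mul_one_div_cancel hn'.ne',
    one_mul]
  congr 1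
  exact Finset.sum_congr rfl fun i _ => by simp [velocity]

lemma norm_velocity_le {n : ℕ} (y : Fin n → ℝ) {θ : ℝ} (hθ : θ ∈ Ioo (0 : ℝ) 1) :
    ‖velocity y θ‖ ≤ n := by
  refine (norm_le_mul_of_forall zero_le_one fun i => ?_).trans_eq (mul_one _)
  change |triGradient (y i) θ| ≤ 1
  rw [abs_of_nonneg (triGradient_nonneg hθ)]
  linarith [triGradient_le (y := y i) hθ]

lemma le_tent {b x θ : ℝ} (hb : 0 < b) (hθ : θ ∈ Ioo (0 : ℝ) 1) (hx : x ∈ Icc b (1 - b)) :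
    b ≤ tent x θ := by
  refine le_min ((le_div_iff₀ hθ.1).2 ?_) ((le_div_iff₀ (by linarith [hθ.2])).2 ?_)
  · nlinarith [hθ.2, hx.1]
  · nlinarith [hθ.1, hx.2]

lemma le_norm_velocity {n : ℕ} (hn : 0 < n) {y : Fin n → ℝ} {b : ℝ} (hb : 0 < b)
    (hy : ∀ i, y i ∈ Icc b (1 - b)) {θ : ℝ} (hθ : θ ∈ Ioo (0 : ℝ) 1) :
    b / 2 ≤ ‖velocity y θ‖ := by
  refine le_trans ?_ (abs_apply_le_norm _ ⟨0, hn⟩)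
  change b / 2 ≤ |triGradient (y ⟨0, hn⟩) θ|
  have h := hy ⟨0, hn⟩
  rw [triGradient_of_mem hθ ⟨hb.trans_le h.1, by linarith [h.2]⟩]
  have := le_tent hb hθ h
  exact (by linarith : b / 2 ≤ _).trans (le_abs_self _)

lemma abs_tent_sub_tent_left_le {a x y θ : ℝ} (ha : 0 < a) (hθ : θ ∈ Icc a (1 - a)) :
    |tent x θ - tent y θ| ≤ |x - y| / a := by
  refine (abs_min_sub_min_le_max _ _ _ _).trans (max_le ?_ ?_)
  · rw [← sub_div, abs_div, abs_of_pos (ha.trans_le hθ.1)]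
    exact div_le_div_of_nonneg_left (abs_nonneg _) ha hθ.1
  · rw [← sub_div, abs_div, abs_of_pos (show 0 < 1 - θ by linarith [hθ.2]), abs_sub_comm x,
      sub_sub_sub_cancel_left]
    exact div_le_div_of_nonneg_left (abs_nonneg _) ha (by linarith [hθ.2])

lemma norm_velocity_sub_le {n : ℕ} {y : Fin n → ℝ} (hy : ∀ i, y i ∈ Ioo (0 : ℝ) 1) {a θ θ' : ℝ}
    (ha : 0 < a) (hθ : θ ∈ Icc a (1 - a)) (hθ' : θ' ∈ Icc a (1 - a)) :
    ‖velocity y θ - velocity y θ'‖ ≤ n / a * |θ - θ'| := by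
  refine (norm_le_mul_of_forall (C := |θ - θ'| / a) (by positivity) fun i => ?_).trans_eq (by ring)
  have m : θ ∈ Ioo (0 : ℝ) 1 := ⟨ha.trans_le hθ.1, by linarith [hθ.2]⟩
  have m' : θ' ∈ Ioo (0 : ℝ) 1 := ⟨ha.trans_le hθ'.1, by linarith [hθ'.2]⟩
  change |triGradient (y i) θ - triGradient (y i) θ'| ≤ _
  rw [triGradient_of_mem m (hy i), triGradient_of_mem m' (hy i), ← sub_div, abs_div, abs_two]
  have := abs_tent_sub_le ha hθ hθ' (hy i)
  linarith [abs_nonneg (tent (y i) θ - tent (y i) θ')]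

lemma abs_triDGA_sub_le {u θ θ' : ℝ} (hu : u ∈ Ioo (0 : ℝ) 1) (hθ : θ ∈ Ioo (0 : ℝ) 1)
    (hθ' : θ' ∈ Ioo (0 : ℝ) 1) : |triDGA u θ' - triDGA u θ| ≤ |θ' - θ| := by
  have h := Convex.norm_image_sub_le_of_norm_hasDerivWithin_le (C := 1) (s := Ioo (0 : ℝ) 1)
    (f := triDGA u) (fun t ht => (hasDerivAt_triDGA ht hu).hasDerivWithinAt) (fun t ht => ?_)
    (convex_Ioo 0 1) hθ hθ'
  · simpa using h
  · have h1 := tent_pos ht (triDGA_mem ht hu)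
    have h2 := tent_le_one (y := triDGA u t) ht
    rw [Real.norm_eq_abs, abs_of_nonneg (by positivity)]
    linarith

/-- Monotonicity in the parameter keeps `G(u,·)` between its values at the ends of an interval. -/
lemma monotoneOn_triDGA {u : ℝ} (hu : u ∈ Ioo (0 : ℝ) 1) : MonotoneOn (triDGA u) (Ioo 0 1) := by
  refine monotoneOn_of_deriv_nonneg (convex_Ioo 0 1) (continuousOn_triDGA u) ?_ ?_
  · rw [interior_Ioo]
    exact fun t ht => (hasDerivAt_triDGA ht hu).differentiableAt.differentiableWithinAt
  · rw [interior_Ioo]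
    intro t ht
    rw [(hasDerivAt_triDGA ht hu).deriv]
    exact (half_pos (tent_pos ht (triDGA_mem ht hu))).le

/-- Away from the ends of the unit interval, the algorithm moves at a speed bounded below. -/
lemma mul_abs_sub_le_abs_triDGA_sub {b u θ θ' : ℝ} (hb : 0 < b) (hu : u ∈ Ioo (0 : ℝ) 1)
    (hθ : θ ∈ Ioo (0 : ℝ) 1) (hθ' : θ' ∈ Ioo (0 : ℝ) 1) (hG : triDGA u θ ∈ Icc b (1 - b))
    (hG' : triDGA u θ' ∈ Icc b (1 - b)) :
    b / 2 * |θ' - θ| ≤ |triDGA u θ' - triDGA u θ| := by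
  wlog h : θ ≤ θ' generalizing θ θ'
  · rw [abs_sub_comm θ', abs_sub_comm (triDGA u θ')]
    exact this hθ' hθ hG' hG (le_of_not_ge h)
  rw [abs_of_nonneg (sub_nonneg.2 h)]
  refine le_trans ?_ (le_abs_self _)
  have hsub : Icc θ θ' ⊆ Ioo 0 1 := fun t ht => ⟨hθ.1.trans_le ht.1, ht.2.trans_lt hθ'.2⟩
  refine Convex.mul_sub_le_image_sub_of_le_deriv (convex_Icc θ θ')
    ((continuousOn_triDGA u).mono hsub) ?_ ?_ θ (left_mem_Icc.2 h) θ' (right_mem_Icc.2 h) h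
  · exact fun t ht => (hasDerivAt_triDGA (hsub (interior_subset ht))
      hu).differentiableAt.differentiableWithinAt
  · intro t ht
    have ht' := interior_subset ht
    have ht0 := hsub ht'
    rw [(hasDerivAt_triDGA ht0 hu).deriv]
    have m1 := monotoneOn_triDGA hu hθ ht0 ht'.1
    have m2 := monotoneOn_triDGA hu ht0 hθ' ht'.2
    have := le_tent hb ht0 ⟨hG.1.trans m1, m2.trans hG'.2⟩
    linarith

lemma norm_residual_sub_le {n : ℕ} {y u : Fin n → ℝ} (hu : ∀ i, u i ∈ Ioo (0 : ℝ) 1) {θ θ' : ℝ}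
    (hθ : θ ∈ Ioo (0 : ℝ) 1) (hθ' : θ' ∈ Ioo (0 : ℝ) 1) :
    ‖residual y u θ - residual y u θ'‖ ≤ n * |θ - θ'| := by
  refine norm_le_mul_of_forall (abs_nonneg _) fun i => ?_
  change |(y i - triDGA (u i) θ) - (y i - triDGA (u i) θ')| ≤ _
  rw [sub_sub_sub_cancel_left, abs_sub_comm θ]
  exact abs_triDGA_sub_le (hu i) hθ hθ'

/-- Parameters with small residuals are close to each other; a single coordinate suffices to see
this. -/
lemma mul_abs_sub_le_of_norm_residual_le {n : ℕ} (hn : 0 < n) {y u : Fin n → ℝ} {b : ℝ}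
    (hb : 0 < b) (hy : ∀ i, y i ∈ Icc (2 * b) (1 - 2 * b)) (hu : ∀ i, u i ∈ Ioo (0 : ℝ) 1)
    {θ θ' : ℝ} (hθ : θ ∈ Ioo (0 : ℝ) 1) (hθ' : θ' ∈ Ioo (0 : ℝ) 1) (h : ‖residual y u θ‖ ≤ b)
    (h' : ‖residual y u θ'‖ ≤ b) :
    b / 2 * |θ' - θ| ≤ ‖residual y u θ‖ + ‖residual y u θ'‖ := by
  have k : |y ⟨0, hn⟩ - triDGA (u ⟨0, hn⟩) θ| ≤ ‖residual y u θ‖ :=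
    abs_apply_le_norm (residual y u θ) ⟨0, hn⟩
  have k' : |y ⟨0, hn⟩ - triDGA (u ⟨0, hn⟩) θ'| ≤ ‖residual y u θ'‖ :=
    abs_apply_le_norm (residual y u θ') ⟨0, hn⟩
  have hy0 := hy ⟨0, hn⟩
  have l := abs_le.1 (k.trans h)
  have l' := abs_le.1 (k'.trans h')
  refine (mul_abs_sub_le_abs_triDGA_sub hb (hu ⟨0, hn⟩) hθ hθ'
    ⟨by linarith [hy0.1], by linarith [hy0.2]⟩ ⟨by linarith [hy0.1], by linarith [hy0.2]⟩).trans ?_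
  rw [← sub_sub_sub_cancel_left _ _ (y ⟨0, hn⟩)]
  exact (abs_sub _ _).trans (add_le_add k k')

/-- The residual is affine in the parameter up to a quadratic error, with a slope that depends on
the data only. -/
lemma norm_residual_linearization_le {n : ℕ} {y u : Fin n → ℝ} (hy : ∀ i, y i ∈ Ioo (0 : ℝ) 1)
    (hu : ∀ i, u i ∈ Ioo (0 : ℝ) 1) {a θ θ' : ℝ} (ha : 0 < a) (hθ : θ ∈ Icc a (1 - a))
    (hθ' : θ' ∈ Icc a (1 - a)) :
    ‖residual y u θ' - residual y u θ + (θ' - θ) • velocity y θ‖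
      ≤ n / a * (|θ' - θ| * (|θ' - θ| + ‖residual y u θ‖)) := by
  have hK := Icc_subset_unit ha
  refine (norm_le_mul_of_forall (C := (‖residual y u θ‖ + |θ' - θ|) / a * |θ' - θ|)
    (by positivity) fun i => ?_).trans_eq (by ring)
  change |(y i - triDGA (u i) θ') - (y i - triDGA (u i) θ) + (θ' - θ) * triGradient (y i) θ| ≤ _
  rw [triGradient_of_mem (hK hθ) (hy i)]
  set w := tent (y i) θ / 2 with hw
  have hsub : uIcc θ θ' ⊆ Icc a (1 - a) := uIcc_subset_Icc hθ hθ'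
  have h := Convex.norm_image_sub_le_of_norm_hasDerivWithin_le
    (C := (‖residual y u θ‖ + |θ' - θ|) / a) (s := uIcc θ θ')
    (f := fun t => triDGA (u i) t - t * w) (f' := fun t => tent (triDGA (u i) t) t / 2 - 1 * w)
    (fun t ht => ((hasDerivAt_triDGA (hK (hsub ht)) (hu i)).sub
      ((hasDerivAt_id t).mul_const w)).hasDerivWithinAt) (fun t ht => ?_)
    (convex_uIcc θ θ') left_mem_uIcc right_mem_uIcc
  · rw [Real.norm_eq_abs, Real.norm_eq_abs, ← abs_neg] at h
    refine (le_of_eq ?_).trans h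
    congr 1; ring
  · have htK := hsub ht
    have htθ : |t - θ| ≤ |θ' - θ| := abs_sub_left_of_mem_uIcc ht
    have h1 := abs_triDGA_sub_le (hu i) (hK hθ) (hK htK)
    have h2 : |y i - triDGA (u i) θ| ≤ ‖residual y u θ‖ := abs_apply_le_norm (residual y u θ) i
    have h3 := abs_tent_sub_tent_left_le (x := triDGA (u i) t) (y := y i) ha htK
    have h4 := abs_tent_sub_le ha htK hθ (hy i)
    have h5 : |triDGA (u i) t - y i| ≤ |θ' - θ| + ‖residual y u θ‖ := by
      have := abs_sub_le (triDGA (u i) t) (triDGA (u i) θ) (y i)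
      rw [abs_sub_comm (triDGA (u i) θ) (y i)] at this
      linarith
    rw [one_mul, hw, ← sub_div, Real.norm_eq_abs, abs_div, abs_two, div_le_iff₀ two_pos,
      div_mul_eq_mul_div]
    refine (abs_sub_le _ (tent (y i) t) _).trans ?_
    refine (add_le_add h3 h4).trans ?_
    rw [← add_div]
    exact div_le_div_of_nonneg_right (by linarith [norm_nonneg (residual y u θ)]) ha.le

/-- At a minimizer the residual is orthogonal to the velocity up to a quadratic error. -/
lemma abs_inner_residual_velocity_le {n : ℕ} (hn : 0 < n) {y u : Fin n → ℝ}
    (hy : ∀ i, y i ∈ Ioo (0 : ℝ) 1) (hu : ∀ i, u i ∈ Ioo (0 : ℝ) 1) {a θ : ℝ} (ha : 0 < a)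
    (hθ : θ ∈ Icc a (1 - a)) (hmin : IsMinOn (misfit triDGA y u) (Ioo 0 1) θ) :
    |inner ℝ (residual y u θ) (velocity y θ)| ≤ n / a * ‖residual y u θ‖ ^ 2 := by
  have hθ0 := Icc_subset_unit ha hθ
  have hsq : ∀ t, misfit triDGA y u t ^ 2 = ∑ i, (y i - triDGA (u i) t) ^ 2 := fun t => by
    rw [misfit_eq_norm, EuclideanSpace.norm_sq_eq]
    simp [residual]
  have hd : HasDerivAt (fun t => ∑ i, (y i - triDGA (u i) t) ^ 2)
      (∑ i, (2 : ℕ) * (y i - triDGA (u i) θ) ^ (2 - 1) * (0 - tent (triDGA (u i) θ) θ / 2)) θ :=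
    HasDerivAt.fun_sum fun i _ => ((hasDerivAt_const θ (y i)).sub
      (hasDerivAt_triDGA hθ0 (hu i))).pow 2
  have hloc : IsLocalMin (fun t => ∑ i, (y i - triDGA (u i) t) ^ 2) θ := by
    filter_upwards [Ioo_mem_nhds hθ0.1 hθ0.2] with t ht
    rw [← hsq, ← hsq]
    exact pow_le_pow_left₀ (norm_nonneg _) (hmin ht) 2
  -- the first-order condition says that the residual is orthogonal to the gradient at `G(u,θ)`, which
  -- differs from the velocity, the gradient at `y`, by the order of the residual
  have h0 := hloc.hasDerivAt_eq_zero hd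
  have e : inner ℝ (residual y u θ) (velocity y θ)
      = ∑ i, (y i - triDGA (u i) θ) * ((tent (y i) θ - tent (triDGA (u i) θ) θ) / 2) := by
    have e1 : inner ℝ (residual y u θ) (velocity y θ)
        = ∑ i, (y i - triDGA (u i) θ) * (tent (y i) θ / 2) := by
      rw [PiLp.inner_apply]
      refine Finset.sum_congr rfl fun i _ => ?_
      change inner ℝ (y i - triDGA (u i) θ) (triGradient (y i) θ) = _
      rw [triGradient_of_mem hθ0 (hy i)]
      simp [mul_comm]
    have e2 : ∑ i, (2 : ℕ) * (y i - triDGA (u i) θ) ^ (2 - 1) * (0 - tent (triDGA (u i) θ) θ / 2)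
        = -2 * ∑ i, (y i - triDGA (u i) θ) * (tent (triDGA (u i) θ) θ / 2) := by
      rw [Finset.mul_sum]
      exact Finset.sum_congr rfl fun i _ => by push_cast; ring
    rw [e2] at h0
    have e3 : ∑ i, (y i - triDGA (u i) θ) * (tent (triDGA (u i) θ) θ / 2) = 0 := by linarith
    rw [e1, ← sub_zero (∑ i, _), ← e3, ← Finset.sum_sub_distrib]
    exact Finset.sum_congr rfl fun i _ => by ring
  have hn1 : (1 : ℝ) ≤ n := by exact_mod_cast hn
  rw [e, ← misfit_eq_norm, hsq, Finset.mul_sum]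
  refine (Finset.abs_sum_le_sum_abs _ _).trans (Finset.sum_le_sum fun i _ => ?_)
  have h3 := abs_tent_sub_tent_left_le (x := y i) (y := triDGA (u i) θ) ha hθ
  rw [abs_mul, abs_div, abs_two, ← sq_abs (y i - _)]
  calc _ ≤ |y i - triDGA (u i) θ| * (|y i - triDGA (u i) θ| / a) := by
        refine mul_le_mul_of_nonneg_left ?_ (abs_nonneg _)
        linarith [abs_nonneg (tent (y i) θ - tent (triDGA (u i) θ) θ)]
    _ = 1 / a * |y i - triDGA (u i) θ| ^ 2 := by ring
    _ ≤ _ := by gcongr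

/-! ### A measurable pseudo-inverse -/

/-- By continuity, the infimum may be taken over a countable dense set. -/
lemma measurable_iInf_of_continuousOn {X : Type*} [MeasurableSpace X] {S : Set ℝ} {f : X → ℝ → ℝ}
    (hf : ∀ θ, Measurable (fun u => f u θ)) (hc : ∀ u, ContinuousOn (f u) S) :
    Measurable (fun u => ⨅ θ : S, f u θ) := by
  obtain ⟨T, hTc, hTd⟩ := TopologicalSpace.exists_countable_dense S
  have := hTc.to_subtype
  have e : (fun u => ⨅ θ : S, f u θ) = fun u => ⨅ t : T, f u t := by
    ext u
    exact (hTd.ciInf' (f := fun θ : S => f u θ) (continuousOn_iff_continuous_domRestrict.1 (hc u))).symm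
  rw [e]
  exact Measurable.iInf fun t => hf t

lemma measurable_misfit {n : ℕ} (y : Fin n → ℝ) :
    Measurable (fun z : (Fin n → ℝ) × ℝ => misfit triDGA y z.1 z.2) :=
  (measurable_residual y).norm

lemma measurable_misfit_comp {n : ℕ} (y : Fin n → ℝ) {Q : (Fin n → ℝ) → ℝ} (hQ : Measurable Q) :
    Measurable (fun u => misfit triDGA y u (Q u)) := by
  have h2 := (measurable_misfit y).comp (measurable_id.prodMk hQ)
  exact h2

/-- The infimum over the parameter set of the distance between the data and the generated
sample. -/
def bestMisfit {n : ℕ} (y u : Fin n → ℝ) : ℝ := ⨅ θ : Ioo (0 : ℝ) 1, misfit triDGA y u θ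

lemma measurable_bestMisfit {n : ℕ} (y : Fin n → ℝ) : Measurable (bestMisfit y) :=
  measurable_iInf_of_continuousOn (fun _ => measurable_misfit_comp y measurable_const)
    (continuousOn_misfit y)

lemma bddBelow_misfit {n : ℕ} (y u : Fin n → ℝ) (S : Set ℝ) :
    BddBelow (range fun θ : S => misfit triDGA y u θ) :=
  ⟨0, by rintro _ ⟨θ, rfl⟩; exact norm_nonneg _⟩

lemma mem_argminSet_iff {n : ℕ} {y u : Fin n → ℝ} {θ : ℝ} :
    θ ∈ argminSet triDGA (Ioo 0 1) y u ↔ θ ∈ Ioo (0 : ℝ) 1 ∧ misfit triDGA y u θ ≤ bestMisfit y u := by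
  have : Nonempty (Ioo (0 : ℝ) 1) := ⟨⟨1 / 2, by norm_num, by norm_num⟩⟩
  refine and_congr_right fun _ => ⟨fun h => le_ciInf fun t => h t.2, fun h t ht => ?_⟩
  exact h.trans (ciInf_le (bddBelow_misfit y u _) (⟨t, ht⟩ : Ioo (0 : ℝ) 1))

lemma Icc_half_subset {t : ℝ} (ht : t < 1 / 2) : Icc (1 / 2 - t) (1 / 2 + t) ⊆ Ioo 0 1 :=
  fun θ hθ => ⟨by linarith [hθ.1], by linarith [hθ.2]⟩

/-- A nonempty argmin set has a point closest to the centre of the parameter set. -/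
lemma exists_argmin_closest {n : ℕ} {y u : Fin n → ℝ}
    (h : (argminSet triDGA (Ioo 0 1) y u).Nonempty) :
    ∃ θ, IsLeast ((fun θ : ℝ => |θ - 1 / 2|) '' argminSet triDGA (Ioo 0 1) y u) |θ - 1 / 2|
      ∧ θ ∈ argminSet triDGA (Ioo 0 1) y u := by
  obtain ⟨θ₁, h₁⟩ := h
  set t := |θ₁ - 1 / 2| with ht
  have ht2 : t < 1 / 2 := abs_lt.2 ⟨by linarith [h₁.1.1], by linarith [h₁.1.2]⟩
  have hsub := Icc_half_subset ht2
  set K := Icc (1 / 2 - t) (1 / 2 + t) ∩ misfit triDGA y u ⁻¹' Iic (bestMisfit y u) with hK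
  have hKc : IsCompact K := by
    refine isCompact_Icc.of_isClosed_subset ?_ inter_subset_left
    exact ((continuousOn_misfit y u).mono hsub).preimage_isClosed_of_isClosed isClosed_Icc
      isClosed_Iic
  have hmem : ∀ θ ∈ argminSet triDGA (Ioo 0 1) y u, |θ - 1 / 2| ≤ t → θ ∈ K := fun θ hθ hle =>
    ⟨by have := abs_le.1 hle; exact ⟨by linarith, by linarith⟩, (mem_argminSet_iff.1 hθ).2⟩
  obtain ⟨θ, hθ, hmin⟩ := hKc.exists_isMinOn ⟨θ₁, hmem θ₁ h₁ le_rfl⟩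
    (f := fun θ : ℝ => |θ - 1 / 2|) (by fun_prop)
  have hθa : θ ∈ argminSet triDGA (Ioo 0 1) y u := mem_argminSet_iff.2 ⟨hsub hθ.1, hθ.2⟩
  refine ⟨θ, ⟨⟨θ, hθa, rfl⟩, ?_⟩, hθa⟩
  rintro _ ⟨θ', hθ', rfl⟩
  rcases le_total |θ' - 1 / 2| t with h | h
  · exact hmin (hmem θ' hθ' h)
  · exact (hmin (hmem θ₁ h₁ le_rfl)).trans h

open Classical in
/-- The distance from the centre of the parameter set to the argmin set, with value `1/2` when
the argmin set is empty. -/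
def centralGap {n : ℕ} (y u : Fin n → ℝ) : ℝ :=
  if (argminSet triDGA (Ioo 0 1) y u).Nonempty then
    sInf ((fun θ : ℝ => |θ - 1 / 2|) '' argminSet triDGA (Ioo 0 1) y u) else 1 / 2

lemma centralGap_le_iff {n : ℕ} {y u : Fin n → ℝ} {t : ℝ} (ht : t < 1 / 2) :
    centralGap y u ≤ t ↔ ∃ θ ∈ argminSet triDGA (Ioo 0 1) y u, |θ - 1 / 2| ≤ t := by
  unfold centralGap
  split_ifs with h
  · obtain ⟨θ, hθ, hθa⟩ := exists_argmin_closest h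
    rw [hθ.csInf_eq]
    refine ⟨fun hle => ⟨θ, hθa, hle⟩, ?_⟩
    rintro ⟨θ', h', hle⟩
    exact (hθ.2 ⟨θ', h', rfl⟩).trans hle
  · refine ⟨fun hle => absurd hle (not_le.2 ht), ?_⟩
    rintro ⟨θ', h', -⟩
    exact absurd ⟨θ', h'⟩ h

/-- The parameter set is open, but on its compact symmetric subintervals the minimum is attained, so
the existence of a minimizer there is a comparison of two measurable infima. -/
lemma exists_argmin_iff_iInf_le {n : ℕ} {y u : Fin n → ℝ} {t : ℝ} (h0 : 0 ≤ t) (ht : t < 1 / 2) :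
    (∃ θ ∈ argminSet triDGA (Ioo 0 1) y u, |θ - 1 / 2| ≤ t) ↔
      ⨅ θ : Icc (1 / 2 - t) (1 / 2 + t), misfit triDGA y u θ ≤ bestMisfit y u := by
  have hsub := Icc_half_subset ht
  have hne : (Icc (1 / 2 - t) (1 / 2 + t)).Nonempty := ⟨1 / 2, by linarith, by linarith⟩
  have := hne.to_subtype
  constructor
  · rintro ⟨θ, hθ, hle⟩
    have h := abs_le.1 hle
    exact (ciInf_le (bddBelow_misfit y u _) (⟨θ, by linarith, by linarith⟩ :
      Icc (1 / 2 - t) (1 / 2 + t))).trans (mem_argminSet_iff.1 hθ).2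
  · intro h
    obtain ⟨θ, hθ, hmin⟩ := isCompact_Icc.exists_isMinOn hne ((continuousOn_misfit y u).mono hsub)
    refine ⟨θ, mem_argminSet_iff.2 ⟨hsub hθ, le_trans (le_ciInf fun s => hmin s.2) h⟩, ?_⟩
    exact abs_le.2 ⟨by linarith [hθ.1], by linarith [hθ.2]⟩

lemma measurable_centralGap {n : ℕ} (y : Fin n → ℝ) : Measurable (centralGap y) := by
  refine measurable_of_Iic fun t => ?_
  rcases lt_or_ge t 0 with h0 | h0
  · convert! MeasurableSet.empty
    refine eq_empty_of_forall_notMem fun u (hu : centralGap y u ≤ t) => ?_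
    obtain ⟨θ, -, h⟩ := (centralGap_le_iff (by linarith)).1 hu
    linarith [abs_nonneg (θ - 1 / 2)]
  rcases lt_or_ge t (1 / 2) with ht | ht
  · have e : centralGap y ⁻¹' Iic t = {u | ⨅ θ : Icc (1 / 2 - t) (1 / 2 + t), misfit triDGA y u θ
        ≤ bestMisfit y u} := by
      ext u
      exact (centralGap_le_iff ht).trans (exists_argmin_iff_iInf_le h0 ht)
    rw [e]
    exact measurableSet_le (measurable_iInf_of_continuousOn
      (fun _ => measurable_misfit_comp y measurable_const)
      fun u => (continuousOn_misfit y u).mono (Icc_half_subset ht)) (measurable_bestMisfit y)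
  · convert! MeasurableSet.univ
    refine eq_univ_of_forall fun u => ?_
    change centralGap y u ≤ t
    by_cases h : (argminSet triDGA (Ioo 0 1) y u).Nonempty
    · obtain ⟨θ, hθ⟩ := h
      have h1 : |θ - 1 / 2| < 1 / 2 := abs_lt.2 ⟨by linarith [hθ.1.1], by linarith [hθ.1.2]⟩
      exact ((centralGap_le_iff h1).2 ⟨θ, hθ, le_rfl⟩).trans (h1.le.trans ht)
    · rw [centralGap, if_neg h]; exact ht

/-- A minimizer closest to the centre of the parameter set is a measurable choice: it is one of
the two points at distance `centralGap` from the centre. -/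
lemma exists_isPseudoInverse {n : ℕ} (y : Fin n → ℝ) :
    ∃ Q, IsPseudoInverse triDGA (Ioo 0 1) y Q := by
  have md := measurable_centralGap y
  have ms : MeasurableSet {u | misfit triDGA y u (1 / 2 - centralGap y u) ≤ bestMisfit y u} :=
    measurableSet_le (measurable_misfit_comp y (measurable_const.sub md)) (measurable_bestMisfit y)
  classical
  refine ⟨fun u => if misfit triDGA y u (1 / 2 - centralGap y u) ≤ bestMisfit y u then
    1 / 2 - centralGap y u else 1 / 2 + centralGap y u,
    Measurable.ite ms (measurable_const.sub md) (measurable_const.add md), fun u _ hne => ?_⟩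
  obtain ⟨θ, hθ, hθa⟩ := exists_argmin_closest hne
  have hd : centralGap y u = |θ - 1 / 2| := by rw [centralGap, if_pos hne, hθ.csInf_eq]
  have hlt : |θ - 1 / 2| < 1 / 2 := abs_lt.2 ⟨by linarith [hθa.1.1], by linarith [hθa.1.2]⟩
  have h0 := abs_nonneg (θ - 1 / 2)
  dsimp only
  split_ifs with h
  · exact mem_argminSet_iff.2 ⟨⟨by linarith, by linarith⟩, h⟩
  · rcases abs_choice (θ - 1 / 2) with h' | h'
    · have e : 1 / 2 + centralGap y u = θ := by rw [hd, h']; ring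
      rwa [e]
    · have e : 1 / 2 - centralGap y u = θ := by rw [hd, h']; ring
      rw [e] at h
      exact absurd (mem_argminSet_iff.1 hθa).2 h

lemma measurableSet_box (n : ℕ) : MeasurableSet {u : Fin n → ℝ | ∀ i, u i ∈ Ioo (0 : ℝ) 1} := by
  have e : {u : Fin n → ℝ | ∀ i, u i ∈ Ioo (0 : ℝ) 1} = Set.pi univ fun _ => Ioo 0 1 := by
    ext u; simp
  rw [e]
  exact MeasurableSet.univ_pi fun _ => measurableSet_Ioo

lemma mem_nearSet_iff {n : ℕ} {y : Fin n → ℝ} {Q : (Fin n → ℝ) → ℝ}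
    (hQ : IsPseudoInverse triDGA (Ioo 0 1) y Q) {u : Fin n → ℝ} {ε : ℝ} :
    u ∈ nearSet triDGA (Ioo 0 1) y ε ↔ (∀ i, u i ∈ Ioo (0 : ℝ) 1) ∧
      Q u ∈ argminSet triDGA (Ioo 0 1) y u ∧ misfit triDGA y u (Q u) ≤ ε := by
  refine and_congr_right fun hu => ⟨?_, fun h => ⟨Q u, h⟩⟩
  rintro ⟨θ, hθ, hle⟩
  have h := hQ.2 u hu ⟨θ, hθ⟩
  exact ⟨h, (h.2 hθ.1).trans hle⟩

lemma measurableSet_nearSet {n : ℕ} (y : Fin n → ℝ) (ε : ℝ) :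
    MeasurableSet (nearSet triDGA (Ioo 0 1) y ε) := by
  obtain ⟨Q, hQ⟩ := exists_isPseudoInverse y
  have e : nearSet triDGA (Ioo 0 1) y ε = {u | ∀ i, u i ∈ Ioo (0 : ℝ) 1} ∩
      (Q ⁻¹' Ioo 0 1 ∩ {u | misfit triDGA y u (Q u) ≤ bestMisfit y u}
        ∩ {u | misfit triDGA y u (Q u) ≤ ε}) := by
    ext u
    rw [mem_nearSet_iff hQ, mem_argminSet_iff]
    rfl
  rw [e]
  have hm := measurable_misfit_comp y hQ.1
  exact (measurableSet_box n).inter (((hQ.1 measurableSet_Ioo).inter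
    (measurableSet_le hm (measurable_bestMisfit y))).inter (measurableSet_le hm measurable_const))

/-! ### Cylinders of residuals -/

/-- The vectors `e` whose component along `w` is `t w` with `|t| ≤ r`, and whose component
orthogonal to `w` has norm at most `r`. -/
def cylinder {n : ℕ} (w : EuclideanSpace ℝ (Fin n)) (r : ℝ) : Set (EuclideanSpace ℝ (Fin n)) :=
  {e | |inner ℝ e w| ≤ r * ‖w‖ ^ 2 ∧ ‖e‖ ^ 2 * ‖w‖ ^ 2 - inner ℝ e w ^ 2 ≤ r ^ 2 * ‖w‖ ^ 2}

lemma mem_cylinder {n : ℕ} {w e : EuclideanSpace ℝ (Fin n)} {r : ℝ} : e ∈ cylinder w r ↔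
    |inner ℝ e w| ≤ r * ‖w‖ ^ 2 ∧ ‖e‖ ^ 2 * ‖w‖ ^ 2 - inner ℝ e w ^ 2 ≤ r ^ 2 * ‖w‖ ^ 2 := Iff.rfl

lemma measurableSet_cylinder {n : ℕ} (w : EuclideanSpace ℝ (Fin n)) (r : ℝ) :
    MeasurableSet (cylinder w r) := by
  have h1 : IsClosed {e : EuclideanSpace ℝ (Fin n) | |inner ℝ e w| ≤ r * ‖w‖ ^ 2} :=
    isClosed_le (by fun_prop) (by fun_prop)
  have h2 : IsClosed {e : EuclideanSpace ℝ (Fin n) |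
      ‖e‖ ^ 2 * ‖w‖ ^ 2 - inner ℝ e w ^ 2 ≤ r ^ 2 * ‖w‖ ^ 2} :=
    isClosed_le (by fun_prop) (by fun_prop)
  exact (h1.inter h2).measurableSet

lemma norm_le_of_mem_cylinder {n : ℕ} {w e : EuclideanSpace ℝ (Fin n)} {r : ℝ} (hr : 0 ≤ r)
    (hw : w ≠ 0) (he : e ∈ cylinder w r) : ‖e‖ ≤ (1 + ‖w‖) * r := by
  have hw' : 0 < ‖w‖ ^ 2 := pow_pos (norm_pos_iff.2 hw) 2
  have h1 : inner ℝ e w ^ 2 ≤ (r * ‖w‖ ^ 2) ^ 2 := sq_le_sq' (abs_le.1 he.1).1 (abs_le.1 he.1).2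
  refine le_of_sq_le_sq ?_ (by positivity)
  refine le_of_mul_le_mul_right ?_ hw'
  have h2 := he.2
  have h3 : 0 ≤ ‖w‖ * r ^ 2 * ‖w‖ ^ 2 := by positivity
  nlinarith

open scoped Pointwise in
lemma cylinder_eq_smul {n : ℕ} (w : EuclideanSpace ℝ (Fin n)) {r : ℝ} (hr : 0 < r) :
    cylinder w r = r • cylinder w 1 := by
  ext e
  rw [mem_smul_set_iff_inv_smul_mem₀ hr.ne', mem_cylinder, mem_cylinder, inner_smul_left, norm_smul,
    Real.norm_eq_abs, mul_pow, sq_abs, RCLike.conj_to_real, abs_mul, abs_of_pos (inv_pos.2 hr),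
    inv_mul_le_iff₀ hr, mul_pow, one_pow, one_mul]
  refine and_congr_right fun _ => ?_
  rw [show r⁻¹ ^ 2 * ‖e‖ ^ 2 * ‖w‖ ^ 2 - r⁻¹ ^ 2 * inner ℝ e w ^ 2
    = (r ^ 2)⁻¹ * (‖e‖ ^ 2 * ‖w‖ ^ 2 - inner ℝ e w ^ 2) by rw [inv_pow]; ring,
    inv_mul_le_iff₀ (by positivity)]

/-- A reflection maps one unit axis to the other. -/
lemma volume_cylinder_unit {n : ℕ} {v v' : EuclideanSpace ℝ (Fin n)} (hv : ‖v‖ = 1)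
    (hv' : ‖v'‖ = 1) : volume (cylinder v 1) = volume (cylinder v' 1) := by
  set ρ := Submodule.reflection (Submodule.span ℝ {v - v'})ᗮ with hρ
  have h : ρ v = v' := Submodule.reflection_sub (hv.trans hv'.symm)
  rw [← ρ.measurePreserving.measure_preimage (measurableSet_cylinder v' 1).nullMeasurableSet]
  congr 1
  ext e
  rw [mem_preimage, mem_cylinder, mem_cylinder, ← h, ρ.inner_map_map, ρ.norm_map, ρ.norm_map]

/-- Stretching space along the axis by the factor `c`, which is the determinant of the stretching,
maps the cylinder about `v` to the one about `c v`. -/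
lemma volume_cylinder_smul {n : ℕ} {v : EuclideanSpace ℝ (Fin n)} (hv : ‖v‖ = 1) {c : ℝ}
    (hc : 0 < c) : volume (cylinder (c • v) 1) = ENNReal.ofReal c * volume (cylinder v 1) := by
  set T := LinearMap.transvection ((c - 1) • (innerSL ℝ v).toLinearMap) v with hT
  have hTx : ∀ x, T x = x + ((c - 1) * inner ℝ v x) • v := fun x => by
    rw [hT, LinearMap.transvection.apply]; rfl
  have hdet : LinearMap.det T = c := by
    rw [hT, LinearMap.transvection.det]
    change 1 + (c - 1) * inner ℝ v v = c
    rw [real_inner_self_eq_norm_sq, hv]; ring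
  have hpre : T ⁻¹' cylinder (c • v) 1 = cylinder v 1 := by
    ext x
    have hn : ‖T x‖ ^ 2 = ‖x‖ ^ 2 + (c ^ 2 - 1) * inner ℝ x v ^ 2 := by
      rw [hTx, norm_add_sq_real, inner_smul_right, norm_smul, hv, Real.norm_eq_abs, mul_one, sq_abs,
        real_inner_comm]
      ring
    have hi : inner ℝ (T x) (c • v) = c ^ 2 * inner ℝ x v := by
      rw [hTx, inner_smul_right, inner_add_left, inner_smul_left, real_inner_self_eq_norm_sq, hv,
        RCLike.conj_to_real, real_inner_comm]
      ring
    rw [mem_preimage, mem_cylinder, mem_cylinder, hn, hi, norm_smul, hv, Real.norm_eq_abs,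
      abs_of_pos hc, mul_one, abs_mul, abs_of_pos (pow_pos hc 2), one_mul, one_pow, one_mul, one_mul,
      mul_one]
    refine and_congr (by rw [mul_le_iff_le_one_right (pow_pos hc 2)]) ?_
    rw [show (‖x‖ ^ 2 + (c ^ 2 - 1) * inner ℝ x v ^ 2) * c ^ 2 - (c ^ 2 * inner ℝ x v) ^ 2
      = c ^ 2 * (‖x‖ ^ 2 - inner ℝ x v ^ 2) by ring, mul_le_iff_le_one_right (pow_pos hc 2)]
  have h := Measure.addHaar_preimage_linearMap (volume : Measure (EuclideanSpace ℝ (Fin n)))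
    (f := T) (by rw [hdet]; exact hc.ne') (cylinder (c • v) 1)
  rw [hpre, hdet, abs_of_pos (inv_pos.2 hc)] at h
  rw [h, ← mul_assoc, ← ENNReal.ofReal_mul hc.le, mul_inv_cancel₀ hc.ne', ENNReal.ofReal_one,
    one_mul]

/-- The volume of a cylinder depends only on its radius and the norm of its axis. -/
lemma exists_volume_cylinder {n : ℕ} (hn : 0 < n) : ∃ κ : ℝ, 0 < κ ∧
    ∀ w : EuclideanSpace ℝ (Fin n), w ≠ 0 → ∀ r, 0 < r →
      volume (cylinder w r) = ENNReal.ofReal (κ * ‖w‖ * r ^ n) := by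
  set v₀ : EuclideanSpace ℝ (Fin n) := EuclideanSpace.single ⟨0, hn⟩ 1 with hv₀
  have h₀ : ‖v₀‖ = 1 := by simp [hv₀]
  have hv0 : v₀ ≠ 0 := norm_pos_iff.1 (by rw [h₀]; exact one_pos)
  have hsub : cylinder v₀ 1 ⊆ Metric.closedBall 0 2 := fun e he => by
    have := norm_le_of_mem_cylinder zero_le_one hv0 he
    rw [h₀] at this
    rw [mem_closedBall_zero_iff]; linarith
  have hfin : volume (cylinder v₀ 1) ≠ ⊤ :=
    ((measure_mono hsub).trans_lt (isCompact_closedBall _ _).measure_lt_top).ne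
  have hpos : volume (cylinder v₀ 1) ≠ 0 := by
    have hb : Metric.ball (0 : EuclideanSpace ℝ (Fin n)) 1 ⊆ cylinder v₀ 1 := fun e he => by
      rw [mem_ball_zero_iff] at he
      have h1 := abs_real_inner_le_norm e v₀
      have h2 : ‖e‖ ^ 2 ≤ 1 := pow_le_one₀ (norm_nonneg _) he.le
      rw [mem_cylinder, h₀]
      rw [h₀] at h1
      exact ⟨by linarith, by nlinarith [sq_nonneg (inner ℝ e v₀)]⟩
    exact ((Metric.measure_ball_pos volume 0 one_pos).trans_le (measure_mono hb)).ne'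
  refine ⟨(volume (cylinder v₀ 1)).toReal, ENNReal.toReal_pos hpos hfin, fun w hw r hr => ?_⟩
  have hw' : 0 < ‖w‖ := norm_pos_iff.2 hw
  have hv : ‖‖w‖⁻¹ • w‖ = 1 := by rw [norm_smul, norm_inv, norm_norm, inv_mul_cancel₀ hw'.ne']
  have e : cylinder w 1 = cylinder (‖w‖ • (‖w‖⁻¹ • w)) 1 := by
    rw [smul_smul, mul_inv_cancel₀ hw'.ne', one_smul]
  rw [cylinder_eq_smul w hr, Measure.addHaar_smul, e, volume_cylinder_smul hv hw',
    volume_cylinder_unit hv h₀, finrank_euclideanSpace_fin, abs_of_pos (pow_pos hr n),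
    ENNReal.ofReal_mul (by positivity), ENNReal.ofReal_mul ENNReal.toReal_nonneg,
    ENNReal.ofReal_toReal hfin]
  ring

lemma tendsto_cylinder_smallSets {n : ℕ} {w : EuclideanSpace ℝ (Fin n)} (hw : w ≠ 0) :
    Tendsto (cylinder w) (𝓝[>] 0) (𝓝 (0 : EuclideanSpace ℝ (Fin n))).smallSets := by
  rw [Metric.nhds_basis_closedBall.smallSets.tendsto_right_iff]
  intro δ hδ
  have hpos : 0 < δ / (1 + ‖w‖) := by positivity
  filter_upwards [Ioo_mem_nhdsGT hpos] with r hr e he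
  rw [mem_closedBall_zero_iff]
  refine (norm_le_of_mem_cylinder hr.1.le hw he).trans ?_
  have := (lt_div_iff₀ (by positivity)).1 hr.2
  linarith

/-! ### The law of the residual -/

instance (n : ℕ) : IsProbabilityMeasure (uniformLaw n) := by
  unfold uniformLaw
  infer_instance

lemma uniformLaw_ae (n : ℕ) : ∀ᵐ u ∂(uniformLaw n), ∀ i, u i ∈ Ioo (0 : ℝ) 1 :=
  ae_all_iff.2 fun i => (Measure.tendsto_eval_ae_ae (i := i)).eventually
    (ae_restrict_mem measurableSet_Ioo)

/-- The data-generating algorithm, applied to a uniform sample, generates the sample law. -/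
lemma map_uniformLaw {n : ℕ} {θ : ℝ} (hθ : θ ∈ Ioo (0 : ℝ) 1) :
    (uniformLaw n).map (fun u i => triDGA (u i) θ) = sampleLaw triDensity n θ := by
  have h := isProbabilityMeasure_law hθ
  have hm := map_triDGA hθ
  have : ∀ _ : Fin n, SigmaFinite ((volume.restrict (Ioo (0 : ℝ) 1)).map fun u => triDGA u θ) :=
    fun _ => by rw [hm]; infer_instance
  rw [uniformLaw, Measure.pi_map_pi (f := fun _ u => triDGA u θ)
    fun _ => (measurable_triDGA_left θ).aemeasurable, hm, sampleLaw]

lemma continuous_triDensity {θ : ℝ} (hθ : θ ∈ Ioo (0 : ℝ) 1) :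
    Continuous (fun y => triDensity y θ) := by
  have e : (fun y => triDensity y θ) = fun y => 2 * max 0 (min (y / θ) ((1 - y) / (1 - θ))) := by
    ext y; exact triDensity_eq hθ
  rw [e]
  fun_prop

/-- The density of the residual at a uniform sample: the likelihood at `y - e`. -/
def residualDensity {n : ℕ} (y : Fin n → ℝ) (θ : ℝ) (e : EuclideanSpace ℝ (Fin n)) : ℝ :=
  likelihood triDensity n (fun i => y i - e i) θ

lemma continuous_residualDensity {n : ℕ} (y : Fin n → ℝ) {θ : ℝ} (hθ : θ ∈ Ioo (0 : ℝ) 1) :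
    Continuous (residualDensity y θ) := by
  unfold residualDensity likelihood
  refine continuous_finsetProd _ fun i _ => (continuous_triDensity hθ).comp ?_
  fun_prop

lemma uniformLaw_residual {n : ℕ} (y : Fin n → ℝ) {θ : ℝ} (hθ : θ ∈ Ioo (0 : ℝ) 1)
    {S : Set (EuclideanSpace ℝ (Fin n))} (hS : MeasurableSet S) :
    uniformLaw n {u | residual y u θ ∈ S} = ∫⁻ e in S, ENNReal.ofReal (residualDensity y θ e) := by
  have hT : MeasurePreserving (fun x : Fin n → ℝ => WithLp.toLp 2 (y - x)) volume volume :=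
    (PiLp.volume_preserving_toLp (Fin n)).comp (Measure.measurePreserving_sub_left volume y)
  have hG : Measurable (fun (u : Fin n → ℝ) i => triDGA (u i) θ) :=
    measurable_pi_lambda _ fun i => (measurable_triDGA_left θ).comp (measurable_pi_apply i)
  have e1 : {u | residual y u θ ∈ S} = (fun (u : Fin n → ℝ) i => triDGA (u i) θ) ⁻¹'
      ((fun x : Fin n → ℝ => WithLp.toLp 2 (y - x)) ⁻¹' S) := rfl
  rw [e1, ← Measure.map_apply hG (hT.measurable hS), map_uniformLaw hθ,
    sampleLaw_eq_withDensity hθ, withDensity_apply _ (hT.measurable hS),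
    ← hT.setLIntegral_comp_preimage hS
      (continuous_residualDensity y hθ).measurable.ennreal_ofReal]
  refine lintegral_congr fun x => ?_
  simp [residualDensity]

lemma uniformLaw_real_residual {n : ℕ} (y : Fin n → ℝ) {θ : ℝ} (hθ : θ ∈ Ioo (0 : ℝ) 1)
    {S : Set (EuclideanSpace ℝ (Fin n))} (hS : MeasurableSet S) :
    (uniformLaw n).real {u | residual y u θ ∈ S} = ∫ e in S, residualDensity y θ e := by
  rw [Measure.real, uniformLaw_residual y hθ hS, integral_eq_lintegral_of_nonneg_ae
    (f := residualDensity y θ)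
    (ae_of_all _ fun e => likelihood_nonneg hθ) (continuous_residualDensity y hθ).aestronglyMeasurable]

lemma uniformLaw_residual_le {n : ℕ} (y : Fin n → ℝ) {θ : ℝ} (hθ : θ ∈ Ioo (0 : ℝ) 1)
    {S : Set (EuclideanSpace ℝ (Fin n))} (hS : MeasurableSet S) :
    uniformLaw n {u | residual y u θ ∈ S} ≤ 2 ^ n * volume S := by
  rw [uniformLaw_residual y hθ hS]
  calc ∫⁻ e in S, ENNReal.ofReal (residualDensity y θ e)
      ≤ ∫⁻ _ in S, ENNReal.ofReal (2 ^ n) :=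
        lintegral_mono fun e => ENNReal.ofReal_le_ofReal (likelihood_le hθ)
    _ = _ := by rw [setLIntegral_const, ENNReal.ofReal_pow zero_le_two, ENNReal.ofReal_ofNat]

/-- The probability that the residual lies in a small cylinder is asymptotically the density of the
residual at zero, which is the likelihood, times the volume of the cylinder. -/
lemma tendsto_uniformLaw_cylinder {n : ℕ} {κ : ℝ} (hκ : 0 < κ)
    (hvol : ∀ w : EuclideanSpace ℝ (Fin n), w ≠ 0 → ∀ r, 0 < r →
      volume (cylinder w r) = ENNReal.ofReal (κ * ‖w‖ * r ^ n))
    (y : Fin n → ℝ) {θ : ℝ} (hθ : θ ∈ Ioo (0 : ℝ) 1) {w : EuclideanSpace ℝ (Fin n)} (hw : w ≠ 0) :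
    Tendsto (fun r => (uniformLaw n).real {u | residual y u θ ∈ cylinder w r} / r ^ n) (𝓝[>] 0)
      (𝓝 (κ * ‖w‖ * likelihood triDensity n y θ)) := by
  have hc := continuous_residualDensity y hθ
  have h := hc.continuousAt.integral_sub_linear_isLittleO_ae (μ := volume) (x := 0)
    hc.stronglyMeasurable.stronglyMeasurableAtFilter (tendsto_cylinder_smallSets hw)
    (fun r => κ * ‖w‖ * r ^ n) (by
      filter_upwards [self_mem_nhdsWithin] with r hr
      have hr' : (0 : ℝ) < r := hr
      rw [Measure.real, hvol w hw r hr', ENNReal.toReal_ofReal (by positivity)])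
  have hw' := norm_pos_iff.2 hw
  have h2 := (h.tendsto_div_nhds_zero.mul_const (κ * ‖w‖)).add_const
    (κ * ‖w‖ * likelihood triDensity n y θ)
  rw [zero_mul, zero_add] at h2
  refine h2.congr' ?_
  filter_upwards [self_mem_nhdsWithin] with r hr
  have hr' : (0 : ℝ) < r := hr
  have e0 : residualDensity y θ 0 = likelihood triDensity n y θ := by simp [residualDensity]
  rw [uniformLaw_real_residual y hθ (measurableSet_cylinder w r), e0, smul_eq_mul]
  field_simp
  ring

/-! ### Cylinders and near-minimizers -/

lemma measurableSet_residual_cylinder {n : ℕ} (y : Fin n → ℝ) (r : ℝ) :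
    MeasurableSet {z : (Fin n → ℝ) × ℝ | residual y z.1 z.2 ∈ cylinder (velocity y z.2) r} := by
  have h1 := measurable_residual y
  have h2 : Measurable fun z : (Fin n → ℝ) × ℝ => velocity y z.2 :=
    (measurable_velocity y).comp measurable_snd
  have h3 : Measurable fun z : (Fin n → ℝ) × ℝ =>
      (inner ℝ (residual y z.1 z.2) (velocity y z.2) : ℝ) := h1.inner h2
  have s1 : MeasurableSet {z : (Fin n → ℝ) × ℝ |
      |inner ℝ (residual y z.1 z.2) (velocity y z.2)| ≤ r * ‖velocity y z.2‖ ^ 2} :=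
    measurableSet_le h3.abs ((h2.norm.pow_const 2).const_mul r)
  have s2 : MeasurableSet {z : (Fin n → ℝ) × ℝ |
      ‖residual y z.1 z.2‖ ^ 2 * ‖velocity y z.2‖ ^ 2
        - inner ℝ (residual y z.1 z.2) (velocity y z.2) ^ 2 ≤ r ^ 2 * ‖velocity y z.2‖ ^ 2} :=
    measurableSet_le (((h1.norm.pow_const 2).mul (h2.norm.pow_const 2)).sub (h3.pow_const 2))
      ((h2.norm.pow_const 2).const_mul (r ^ 2))
  exact s1.inter s2

/-- Near a minimizer `θ'`, the residual at `θ` has the component `(θ' - θ) w` along the velocity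
`w`, up to a quadratic error. -/
lemma abs_inner_residual_sub_le {n : ℕ} (hn : 0 < n) {y u : Fin n → ℝ}
    (hy : ∀ i, y i ∈ Ioo (0 : ℝ) 1) (hu : ∀ i, u i ∈ Ioo (0 : ℝ) 1) {a θ θ' δ : ℝ} (ha : 0 < a)
    (hθ : θ ∈ Icc a (1 - a)) (hθ' : θ' ∈ Icc a (1 - a))
    (hmin : IsMinOn (misfit triDGA y u) (Ioo 0 1) θ') (h1 : ‖residual y u θ‖ ≤ δ)
    (h2 : ‖residual y u θ'‖ ≤ δ) (h3 : |θ' - θ| ≤ δ) :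
    |inner ℝ (residual y u θ) (velocity y θ) - (θ' - θ) * ‖velocity y θ‖ ^ 2|
      ≤ (2 + 2 * n) * (n / a) * δ ^ 2 := by
  have hK := Icc_subset_unit ha
  have hδ : 0 ≤ δ := (abs_nonneg _).trans h3
  set e := residual y u θ with he
  set e' := residual y u θ' with he'
  set w := velocity y θ with hw
  set w' := velocity y θ' with hw'
  set R := e' - e + (θ' - θ) • w with hR
  have hL : (0 : ℝ) ≤ n / a := by positivity
  have bR : ‖R‖ ≤ n / a * (2 * δ ^ 2) := by
    refine (norm_residual_linearization_le hy hu ha hθ hθ').trans ?_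
    refine mul_le_mul_of_nonneg_left ?_ hL
    calc |θ' - θ| * (|θ' - θ| + ‖residual y u θ‖) ≤ δ * (δ + δ) := by gcongr
      _ = _ := by ring
  have e1 : inner ℝ e w - (θ' - θ) * ‖w‖ ^ 2 = inner ℝ e' w' + inner ℝ e' (w - w') - inner ℝ R w := by
    rw [hR, inner_add_left, inner_sub_left, inner_smul_left, real_inner_self_eq_norm_sq,
      inner_sub_right, RCLike.conj_to_real]
    ring
  have b1 : |inner ℝ e' w'| ≤ n / a * δ ^ 2 :=
    (abs_inner_residual_velocity_le hn hy hu ha hθ' hmin).trans (by gcongr)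
  have b2 : |inner ℝ e' (w - w')| ≤ n / a * δ ^ 2 := by
    refine (abs_real_inner_le_norm _ _).trans ?_
    have h4 := norm_velocity_sub_le hy ha hθ hθ'
    rw [abs_sub_comm] at h4
    calc ‖e'‖ * ‖w - w'‖ ≤ δ * (n / a * δ) := by
          gcongr
          exact h4.trans (by gcongr)
      _ = _ := by ring
  have b3 : |inner ℝ R w| ≤ n / a * (2 * δ ^ 2) * n :=
    (abs_real_inner_le_norm _ _).trans (mul_le_mul bR (norm_velocity_le y (hK hθ)) (norm_nonneg _)
      (by positivity))
  rw [e1]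
  calc _ ≤ |inner ℝ e' w' + inner ℝ e' (w - w')| + |inner ℝ R w| := abs_sub _ _
    _ ≤ |inner ℝ e' w'| + |inner ℝ e' (w - w')| + |inner ℝ R w| :=
        add_le_add (abs_add_le _ _) le_rfl
    _ ≤ n / a * δ ^ 2 + n / a * δ ^ 2 + n / a * (2 * δ ^ 2) * n := by linarith
    _ = _ := by ring

/-- Subtracting a multiple of `w` from `e` does not change the component orthogonal to `w`. -/
lemma norm_sq_mul_sub_inner_sq {n : ℕ} (e w : EuclideanSpace ℝ (Fin n)) (t : ℝ) :
    ‖e - t • w‖ ^ 2 * ‖w‖ ^ 2 - inner ℝ (e - t • w) w ^ 2 = ‖e‖ ^ 2 * ‖w‖ ^ 2 - inner ℝ e w ^ 2 := by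
  rw [norm_sub_sq_real, inner_sub_left, inner_smul_left, inner_smul_right, norm_smul,
    real_inner_self_eq_norm_sq, RCLike.conj_to_real, mul_pow, Real.norm_eq_abs, sq_abs]
  ring

/-- Parameters within `ε` of a minimizer with residual at most `ε` have their residual in a cylinder
of radius slightly more than `ε`. -/
lemma residual_mem_cylinder {n : ℕ} (hn : 0 < n) {y u : Fin n → ℝ} {b : ℝ} (hb : 0 < b)
    (hy : ∀ i, y i ∈ Icc b (1 - b)) (hu : ∀ i, u i ∈ Ioo (0 : ℝ) 1) {a θ θ' ε C : ℝ}
    (ha : 0 < a) (hε : ε ≤ a) (hθ' : θ' ∈ Icc (2 * a) (1 - 2 * a))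
    (hmin : IsMinOn (misfit triDGA y u) (Ioo 0 1) θ') (h2 : ‖residual y u θ'‖ ≤ ε)
    (h3 : |θ' - θ| ≤ ε)
    (hC : (2 + 2 * n) * (n / a) * (1 + n) ^ 2 ≤ C * (b / 2) ^ 2)
    (hC' : n / a * (2 * (1 + n) ^ 2) ≤ C) :
    residual y u θ ∈ cylinder (velocity y θ) (ε + C * ε ^ 2) := by
  have hε0 : 0 ≤ ε := (abs_nonneg _).trans h3
  have h3' := abs_le.1 h3
  have hK := Icc_subset_unit ha
  have hθ'K : θ' ∈ Icc a (1 - a) := ⟨by linarith [hθ'.1], by linarith [hθ'.2]⟩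
  have hθK : θ ∈ Icc a (1 - a) := ⟨by linarith [hθ'.1], by linarith [hθ'.2]⟩
  have hy0 : ∀ i, y i ∈ Ioo (0 : ℝ) 1 := fun i =>
    ⟨hb.trans_le (hy i).1, by linarith [(hy i).2]⟩
  have hn0 : (0 : ℝ) ≤ n := Nat.cast_nonneg n
  have h1 : ‖residual y u θ‖ ≤ (1 + n) * ε := by
    have := norm_residual_sub_le (y := y) hu (hK hθK) (hK hθ'K)
    rw [abs_sub_comm] at this
    have h4 : (n : ℝ) * |θ' - θ| ≤ n * ε := by gcongr
    have := norm_sub_norm_le (residual y u θ) (residual y u θ')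
    linarith
  have hle : ε ≤ (1 + n) * ε := by nlinarith
  have hi := abs_inner_residual_sub_le hn hy0 hu ha hθK hθ'K hmin h1 (h2.trans hle) (h3.trans hle)
  have hw := le_norm_velocity hn hb hy (hK hθK)
  have hw2 : (b / 2) ^ 2 ≤ ‖velocity y θ‖ ^ 2 := pow_le_pow_left₀ (by positivity) hw 2
  have hC0 : 0 ≤ C := le_trans (by positivity) hC'
  -- the component along the velocity is `θ' - θ` up to a quadratic error; the orthogonal one is bounded
  -- by the norm after subtracting `θ' - θ` times the velocity, that is, by the residual at `θ'`
  refine ⟨?_, ?_⟩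
  · have h5 : (2 + 2 * n) * (n / a) * ((1 + n) * ε) ^ 2 ≤ C * ε ^ 2 * ‖velocity y θ‖ ^ 2 := by
      calc (2 + 2 * n) * (n / a) * ((1 + n) * ε) ^ 2
          = (2 + 2 * n) * (n / a) * (1 + n) ^ 2 * ε ^ 2 := by ring
        _ ≤ C * (b / 2) ^ 2 * ε ^ 2 := by gcongr
        _ ≤ C * ‖velocity y θ‖ ^ 2 * ε ^ 2 := by gcongr
        _ = _ := by ring
    have h6 : |(θ' - θ) * ‖velocity y θ‖ ^ 2| ≤ ε * ‖velocity y θ‖ ^ 2 := by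
      rw [abs_mul, abs_of_nonneg (sq_nonneg ‖velocity y θ‖)]
      gcongr
    have h7 := abs_sub_abs_le_abs_sub (inner ℝ (residual y u θ) (velocity y θ))
      ((θ' - θ) * ‖velocity y θ‖ ^ 2)
    rw [add_mul]
    linarith
  · rw [← norm_sq_mul_sub_inner_sq _ _ (θ' - θ)]
    have h8 : ‖residual y u θ - (θ' - θ) • velocity y θ‖ ≤ ε + C * ε ^ 2 := by
      have h9 := norm_residual_linearization_le hy0 hu ha hθK hθ'K
      have h10 : n / a * (|θ' - θ| * (|θ' - θ| + ‖residual y u θ‖)) ≤ C * ε ^ 2 := by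
        calc n / a * (|θ' - θ| * (|θ' - θ| + ‖residual y u θ‖))
            ≤ n / a * (ε * (ε + (1 + n) * ε)) := by gcongr
          _ = n / a * (2 + n) * ε ^ 2 := by ring
          _ ≤ n / a * (2 * (1 + n) ^ 2) * ε ^ 2 := by gcongr; nlinarith
          _ ≤ C * ε ^ 2 := by gcongr
      have e : residual y u θ - (θ' - θ) • velocity y θ = residual y u θ'
          - (residual y u θ' - residual y u θ + (θ' - θ) • velocity y θ) := by abel
      rw [e]
      exact (norm_sub_le _ _).trans (add_le_add h2 (h9.trans h10))
    calc _ ≤ ‖residual y u θ - (θ' - θ) • velocity y θ‖ ^ 2 * ‖velocity y θ‖ ^ 2 :=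
          sub_le_self _ (sq_nonneg _)
      _ ≤ _ := by gcongr

/-- If the residual at some interior parameter is small, then the minimum is attained. -/
lemma argminSet_nonempty {n : ℕ} (hn : 0 < n) {y u : Fin n → ℝ} {b : ℝ} (hb : 0 < b)
    (hy : ∀ i, y i ∈ Icc (2 * b) (1 - 2 * b)) (hu : ∀ i, u i ∈ Ioo (0 : ℝ) 1) {a θ δ : ℝ}
    (ha : 0 < a) (hθ : θ ∈ Icc (2 * a) (1 - 2 * a)) (h1 : ‖residual y u θ‖ ≤ δ) (hδb : δ ≤ b)
    (hδ : 2 * δ ≤ b / 2 * a) : (argminSet triDGA (Ioo 0 1) y u).Nonempty := by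
  have hK := Icc_subset_unit ha
  have hθK : θ ∈ Icc a (1 - a) := ⟨by linarith [hθ.1], by linarith [hθ.2]⟩
  -- a minimizer over `[a, 1 - a]` minimizes over `(0,1)`: any better parameter has a small residual,
  -- hence is close to `θ` and lies in the smaller interval
  obtain ⟨θ', hθ', hmin⟩ := isCompact_Icc.exists_isMinOn ⟨θ, hθK⟩
    ((continuousOn_misfit y u).mono hK)
  refine ⟨θ', hK hθ', fun t ht => ?_⟩
  by_cases htK : t ∈ Icc a (1 - a)
  · exact hmin htK
  by_contra hlt
  have hlt' : misfit triDGA y u t < misfit triDGA y u θ' := not_le.1 hlt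
  have hle := hmin hθK
  have h2 : ‖residual y u t‖ ≤ δ := (hlt'.le.trans hle).trans h1
  have h3 := mul_abs_sub_le_of_norm_residual_le hn hb hy hu (hK hθK) ht (h1.trans hδb)
    (h2.trans hδb)
  have h4 : |t - θ| ≤ a := by
    refine le_of_mul_le_mul_left (a := b / 2) ?_ (by positivity)
    linarith
  have h5 := abs_le.1 h4
  exact htK ⟨by linarith [hθ.1], by linarith [hθ.2]⟩

/-- If the residual at an interior parameter lies in a cylinder of radius slightly less than `ε`,
then every minimizer has residual at most `ε` and is within `ε` of that parameter. -/
lemma argmin_of_mem_cylinder {n : ℕ} (hn : 0 < n) {y u : Fin n → ℝ} {b : ℝ} (hb : 0 < b)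
    (hb1 : b ≤ 1) (hy : ∀ i, y i ∈ Icc (2 * b) (1 - 2 * b)) (hu : ∀ i, u i ∈ Ioo (0 : ℝ) 1)
    {a θ θ' ε C : ℝ} (ha : 0 < a) (hε : 0 < ε) (hεb : (2 + n) / (b / 2) * ε ≤ b)
    (hεa : (2 + n) / (b / 2) * ε ≤ a) (hθ : θ ∈ Icc (2 * a) (1 - 2 * a))
    (hC : (2 + 2 * n) * (n / a) * ((2 + n) / (b / 2)) ^ 2 ≤ C * (b / 2) ^ 2)
    (hC' : n / a * (2 * (1 + n) ^ 2) ≤ C) (hCε : C * ε ≤ 1)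
    (hmem : residual y u θ ∈ cylinder (velocity y θ) (ε - C * ε ^ 2))
    (hθ' : θ' ∈ argminSet triDGA (Ioo 0 1) y u) :
    misfit triDGA y u θ' ≤ ε ∧ |θ' - θ| ≤ ε := by
  have hK := Icc_subset_unit ha
  have hθK : θ ∈ Icc a (1 - a) := ⟨by linarith [hθ.1], by linarith [hθ.2]⟩
  have hyb : ∀ i, y i ∈ Icc b (1 - b) := fun i => ⟨by linarith [(hy i).1], by linarith [(hy i).2]⟩
  have hy0 : ∀ i, y i ∈ Ioo (0 : ℝ) 1 := fun i =>
    ⟨hb.trans_le (hyb i).1, by linarith [(hyb i).2]⟩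
  have hn0 : (0 : ℝ) ≤ n := Nat.cast_nonneg n
  have hm : (2 : ℝ) + n ≤ (2 + n) / (b / 2) := by
    rw [le_div_iff₀ (by positivity)]; nlinarith
  have hmε : (2 + n) * ε ≤ (2 + n) / (b / 2) * ε := by gcongr
  have hw := le_norm_velocity hn hb hyb (hK hθK)
  have hw0 : 0 < ‖velocity y θ‖ := lt_of_lt_of_le (by positivity) hw
  have hw2 : (b / 2) ^ 2 ≤ ‖velocity y θ‖ ^ 2 := pow_le_pow_left₀ (by positivity) hw 2
  have hC0 : 0 ≤ C := le_trans (by positivity) hC'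
  set r := ε - C * ε ^ 2 with hr
  have hr0 : 0 ≤ r := by rw [hr]; nlinarith
  have hrε : r ≤ ε := by rw [hr]; nlinarith [mul_nonneg hC0 (sq_nonneg ε)]
  have h1 : ‖residual y u θ‖ ≤ (1 + n) * ε := by
    refine (norm_le_of_mem_cylinder hr0 (norm_pos_iff.1 hw0) hmem).trans ?_
    have := norm_velocity_le y (hK hθK)
    gcongr
  -- moving along the velocity removes the component of the residual along it
  set s := inner ℝ (residual y u θ) (velocity y θ) / ‖velocity y θ‖ ^ 2 with hs
  have hsr : |s| ≤ r := by
    rw [hs, abs_div, abs_of_pos (pow_pos hw0 2), div_le_iff₀ (pow_pos hw0 2)]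
    exact hmem.1
  have hsε := hsr.trans hrε
  have hεa' : ε ≤ a := by nlinarith
  have hsK : θ + s ∈ Icc a (1 - a) := by
    have := abs_le.1 (hsε.trans hεa')
    exact ⟨by linarith [hθ.1], by linarith [hθ.2]⟩
  have hperp : ‖residual y u θ - s • velocity y θ‖ ≤ r := by
    have h4 := norm_sq_mul_sub_inner_sq (residual y u θ) (velocity y θ) s
    have h5 : inner ℝ (residual y u θ - s • velocity y θ) (velocity y θ) = 0 := by
      rw [inner_sub_left, inner_smul_left, real_inner_self_eq_norm_sq, RCLike.conj_to_real, hs,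
        div_mul_cancel₀ _ (pow_pos hw0 2).ne', sub_self]
    rw [h5] at h4
    have h6 := hmem.2
    refine le_of_sq_le_sq ?_ hr0
    refine le_of_mul_le_mul_right ?_ (pow_pos hw0 2)
    linarith
  have hres : ‖residual y u (θ + s)‖ ≤ ε := by
    have h9 := norm_residual_linearization_le hy0 hu ha hθK hsK
    rw [add_sub_cancel_left] at h9
    have h10 : n / a * (|s| * (|s| + ‖residual y u θ‖)) ≤ C * ε ^ 2 := by
      calc n / a * (|s| * (|s| + ‖residual y u θ‖))
          ≤ n / a * (ε * (ε + (1 + n) * ε)) := by gcongr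
        _ = n / a * (2 + n) * ε ^ 2 := by ring
        _ ≤ n / a * (2 * (1 + n) ^ 2) * ε ^ 2 := by gcongr; nlinarith
        _ ≤ C * ε ^ 2 := by gcongr
    have e : residual y u (θ + s) = (residual y u θ - s • velocity y θ)
        + (residual y u (θ + s) - residual y u θ + s • velocity y θ) := by abel
    rw [e]
    refine (norm_add_le _ _).trans ((add_le_add hperp (h9.trans h10)).trans_eq ?_)
    rw [hr]; ring
  have h2 : ‖residual y u θ'‖ ≤ ε := (hθ'.2 (hK hsK)).trans hres
  refine ⟨h2, ?_⟩
  -- the minimizer is first located up to a constant times `ε`, then up to `ε`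
  set m := (2 + n) / (b / 2) with hmdef
  have hεm : ε ≤ m * ε := by nlinarith
  have h1m : ‖residual y u θ‖ ≤ m * ε := h1.trans (by nlinarith)
  have h3 := mul_abs_sub_le_of_norm_residual_le hn hb hy hu (hK hθK) hθ'.1 (h1m.trans hεb)
    (h2.trans (hεm.trans hεb))
  have h3m : |θ' - θ| ≤ m * ε := by
    refine le_of_mul_le_mul_left (a := b / 2) ?_ (by positivity)
    rw [← mul_assoc, hmdef, mul_div_cancel₀ _ (by positivity : b / 2 ≠ 0)]
    linarith
  have hθ'K : θ' ∈ Icc a (1 - a) := by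
    have := abs_le.1 (h3m.trans hεa)
    exact ⟨by linarith [hθ.1], by linarith [hθ.2]⟩
  have hi := abs_inner_residual_sub_le hn hy0 hu ha hθK hθ'K hθ'.2 h1m (h2.trans hεm) h3m
  have h5 : (2 + 2 * n) * (n / a) * (m * ε) ^ 2 ≤ C * ε ^ 2 * ‖velocity y θ‖ ^ 2 := by
    calc (2 + 2 * n) * (n / a) * (m * ε) ^ 2
        = (2 + 2 * n) * (n / a) * m ^ 2 * ε ^ 2 := by ring
      _ ≤ C * (b / 2) ^ 2 * ε ^ 2 := by gcongr
      _ ≤ C * ‖velocity y θ‖ ^ 2 * ε ^ 2 := by gcongr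
      _ = _ := by ring
  refine le_of_mul_le_mul_right ?_ (pow_pos hw0 2)
  have h7 := abs_sub_abs_le_abs_sub ((θ' - θ) * ‖velocity y θ‖ ^ 2)
    (inner ℝ (residual y u θ) (velocity y θ))
  rw [abs_sub_comm, abs_mul, abs_of_pos (pow_pos hw0 2)] at h7
  have h8 := hmem.1
  have h11 : r * ‖velocity y θ‖ ^ 2 = ε * ‖velocity y θ‖ ^ 2 - C * ε ^ 2 * ‖velocity y θ‖ ^ 2 := by
    rw [hr]; ring
  linarith

/-- The two inclusions between near-minimizers and cylinders, for all small `ε`, with a constant that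
does not depend on the uniform sample `u`. -/
lemma exists_cylinder_constant {n : ℕ} (hn : 0 < n) {y : Fin n → ℝ}
    (hy : ∀ i, y i ∈ Ioo (0 : ℝ) 1) {a : ℝ} (ha : 0 < a) :
    ∃ C : ℝ, 0 ≤ C ∧ ∀ᶠ ε in 𝓝[>] (0 : ℝ), C * ε < 1 ∧ ε ≤ a ∧
      ∀ u : Fin n → ℝ, (∀ i, u i ∈ Ioo (0 : ℝ) 1) →
        (∀ θ' ∈ Icc (2 * a) (1 - 2 * a), IsMinOn (misfit triDGA y u) (Ioo 0 1) θ' →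
          misfit triDGA y u θ' ≤ ε → ∀ θ, |θ' - θ| ≤ ε →
            residual y u θ ∈ cylinder (velocity y θ) (ε + C * ε ^ 2)) ∧
        (∀ θ ∈ Icc (2 * a) (1 - 2 * a),
          residual y u θ ∈ cylinder (velocity y θ) (ε - C * ε ^ 2) →
            (argminSet triDGA (Ioo 0 1) y u).Nonempty ∧
            ∀ θ' ∈ argminSet triDGA (Ioo 0 1) y u,
              misfit triDGA y u θ' ≤ ε ∧ |θ' - θ| ≤ ε) := by
  have : Nonempty (Fin n) := ⟨⟨0, hn⟩⟩
  obtain ⟨i₀, hi₀⟩ := Finite.exists_min fun i => min (y i) (1 - y i)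
  set b := min (y i₀) (1 - y i₀) / 2 with hb'
  have hb : 0 < b := half_pos (lt_min (hy i₀).1 (by linarith [(hy i₀).2]))
  have h2b : ∀ i, y i ∈ Icc (2 * b) (1 - 2 * b) := fun i => by
    have h1 := hi₀ i
    have h2 := min_le_left (y i) (1 - y i)
    have h3 := min_le_right (y i) (1 - y i)
    constructor <;> linarith
  have hb1 : b ≤ 1 := by
    have := h2b i₀
    linarith [this.1, this.2]
  have hyb : ∀ i, y i ∈ Icc b (1 - b) := fun i => ⟨by linarith [(h2b i).1], by linarith [(h2b i).2]⟩
  have hn0 : (0 : ℝ) ≤ n := Nat.cast_nonneg n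
  set m := (2 + n) / (b / 2) with hm
  have hm2 : (2 : ℝ) + n ≤ m := by rw [hm, le_div_iff₀ (by positivity)]; nlinarith
  have hm0 : 0 < m := by positivity
  set C := (2 + 2 * n) * (n / a) * m ^ 2 / (b / 2) ^ 2 + n / a * (2 * (1 + n) ^ 2) with hC
  have hC0 : 0 ≤ C := by positivity
  have hC1 : (2 + 2 * n) * (n / a) * m ^ 2 ≤ C * (b / 2) ^ 2 := by
    rw [← div_le_iff₀ (by positivity), hC]
    exact le_add_of_nonneg_right (by positivity)
  have hC2 : n / a * (2 * (1 + n) ^ 2) ≤ C := by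
    rw [hC]; exact le_add_of_nonneg_left (by positivity)
  have hC3 : (2 + 2 * n) * (n / a) * (1 + n) ^ 2 ≤ C * (b / 2) ^ 2 := by
    refine le_trans ?_ hC1
    gcongr
    linarith
  refine ⟨C, hC0, ?_⟩
  have e1 : ∀ k c : ℝ, 0 < c → ∀ᶠ ε in 𝓝[>] (0 : ℝ), k * ε < c := fun k c hc => by
    have h : Tendsto (fun ε : ℝ => k * ε) (𝓝 0) (𝓝 (k * 0)) := tendsto_id.const_mul k
    rw [mul_zero] at h
    exact (h.mono_left nhdsWithin_le_nhds).eventually (gt_mem_nhds hc)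
  filter_upwards [e1 C 1 one_pos, e1 m a ha, e1 m b hb, e1 (2 * (1 + n)) (b / 2 * a) (by positivity),
    self_mem_nhdsWithin] with ε h1 h2 h3 h4 h5
  have hε : (0 : ℝ) < ε := h5
  have hεa : ε ≤ a := by nlinarith
  refine ⟨h1, hεa, fun u hu => ⟨fun θ' hθ' hmin hle θ hθ =>
    residual_mem_cylinder hn hb hyb hu ha hεa hθ' hmin hle hθ hC3 hC2, fun θ hθ hmem =>
    ⟨?_, fun θ' hθ' => argmin_of_mem_cylinder hn hb hb1 h2b hu ha hε h3.le h2.le hθ hC1 hC2 h1.le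
      hmem hθ'⟩⟩⟩
  have hθ0 := Icc_subset_unit ha (⟨by linarith [hθ.1], by linarith [hθ.2]⟩ : θ ∈ Icc a (1 - a))
  have hw : velocity y θ ≠ 0 := norm_pos_iff.1
    (lt_of_lt_of_le (half_pos hb) (le_norm_velocity hn hb hyb hθ0))
  have hr0 : 0 ≤ ε - C * ε ^ 2 := by nlinarith
  have hle : ‖residual y u θ‖ ≤ (1 + n) * ε := by
    refine (norm_le_of_mem_cylinder hr0 hw hmem).trans ?_
    have h6 := norm_velocity_le y hθ0
    have h7 : ε - C * ε ^ 2 ≤ ε := by nlinarith [mul_nonneg hC0 (sq_nonneg ε)]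
    gcongr
  exact argminSet_nonempty hn hb h2b hu ha hθ hle (by nlinarith) (by linarith)

/-! ### The cylinder integral -/

/-- The `ψ`-weighted length of the set of parameters whose residual lies in the cylinder of radius
`r` about their velocity. -/
def cylinderMass {n : ℕ} (y : Fin n → ℝ) (ψ : ℝ → ℝ) (r : ℝ) (u : Fin n → ℝ) : ℝ :=
  ∫ θ in Ioo 0 1, {θ | residual y u θ ∈ cylinder (velocity y θ) r}.indicator ψ θ

lemma measurable_cylinder_indicator {n : ℕ} (y : Fin n → ℝ) {ψ : ℝ → ℝ} (hψ : Measurable ψ)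
    (r : ℝ) : Measurable (fun z : (Fin n → ℝ) × ℝ =>
      {θ | residual y z.1 θ ∈ cylinder (velocity y θ) r}.indicator ψ z.2) := by
  have h := (hψ.comp (measurable_snd (α := Fin n → ℝ))).indicator
    (measurableSet_residual_cylinder y r)
  exact h

lemma integrable_cylinder_indicator {n : ℕ} (y : Fin n → ℝ) {ψ : ℝ → ℝ} (hψ : Measurable ψ) {B : ℝ}
    (hB : ∀ θ, |ψ θ| ≤ B) (r : ℝ) : Integrable (fun z : (Fin n → ℝ) × ℝ =>
      {θ | residual y z.1 θ ∈ cylinder (velocity y θ) r}.indicator ψ z.2)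
      ((uniformLaw n).prod (volume.restrict (Ioo 0 1))) := by
  refine Integrable.of_bound (measurable_cylinder_indicator y hψ r).aestronglyMeasurable B
    (ae_of_all _ fun z => ?_)
  exact (norm_indicator_le_norm_self _ _).trans (hB _)

lemma integrable_cylinderMass {n : ℕ} (y : Fin n → ℝ) {ψ : ℝ → ℝ} (hψ : Measurable ψ) {B : ℝ}
    (hB : ∀ θ, |ψ θ| ≤ B) (r : ℝ) : Integrable (cylinderMass y ψ r) (uniformLaw n) :=
  (integrable_cylinder_indicator y hψ hB r).integral_prod_left

lemma integral_cylinderMass {n : ℕ} (y : Fin n → ℝ) {ψ : ℝ → ℝ} (hψ : Measurable ψ) {B : ℝ}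
    (hB : ∀ θ, |ψ θ| ≤ B) (r : ℝ) : ∫ u, cylinderMass y ψ r u ∂(uniformLaw n)
      = ∫ θ in Ioo 0 1, ψ θ *
        (uniformLaw n).real {u | residual y u θ ∈ cylinder (velocity y θ) r} := by
  unfold cylinderMass
  rw [integral_integral_swap (integrable_cylinder_indicator y hψ hB r)]
  refine integral_congr_ae (ae_of_all _ fun θ => ?_)
  have ms : MeasurableSet {u : Fin n → ℝ | residual y u θ ∈ cylinder (velocity y θ) r} := by
    have h : Measurable fun u : Fin n → ℝ => (u, θ) := by fun_prop
    have h2 := h (measurableSet_residual_cylinder y r)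
    exact h2
  have e : (fun u => {θ | residual y u θ ∈ cylinder (velocity y θ) r}.indicator ψ θ)
      = {u | residual y u θ ∈ cylinder (velocity y θ) r}.indicator fun _ => ψ θ := by
    ext u; simp [indicator]
  dsimp only
  rw [e, integral_indicator_const _ ms, smul_eq_mul, mul_comm]

/-- The cylinder integral is asymptotically the integral of `ψ` against the unnormalized
fiducial density: the volume of a cylinder contributes the norm of the velocity, which is the
Jacobian, and the law of the residual contributes the likelihood. -/
lemma tendsto_integral_cylinderMass {n : ℕ} (hn : 0 < n) {κ : ℝ} (hκ : 0 < κ)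
    (hvol : ∀ w : EuclideanSpace ℝ (Fin n), w ≠ 0 → ∀ r, 0 < r →
      volume (cylinder w r) = ENNReal.ofReal (κ * ‖w‖ * r ^ n))
    {y : Fin n → ℝ} (hy : ∀ i, y i ∈ Ioo (0 : ℝ) 1) {ψ : ℝ → ℝ} (hψ : Measurable ψ) {B : ℝ}
    (hB : ∀ θ, |ψ θ| ≤ B) :
    Tendsto (fun r => (∫ u, cylinderMass y ψ r u ∂(uniformLaw n)) / r ^ n) (𝓝[>] 0)
      (𝓝 (κ * √n * ∫ θ, ψ θ * gfdDensity n y θ)) := by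
  have hw : ∀ θ ∈ Ioo (0 : ℝ) 1, velocity y θ ≠ 0 := fun θ hθ => norm_pos_iff.1 (by
    rw [norm_velocity hn]
    have := triJac_pos hn hy hθ
    have : (0 : ℝ) < n := by exact_mod_cast hn
    positivity)
  have hB0 : 0 ≤ B := (abs_nonneg _).trans (hB 0)
  have e1 : κ * √n * ∫ θ, ψ θ * gfdDensity n y θ
      = ∫ θ in Ioo 0 1, ψ θ * (κ * ‖velocity y θ‖ * likelihood triDensity n y θ) := by
    rw [← integral_const_mul, ← integral_indicator measurableSet_Ioo]
    congr 1
    ext θ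
    by_cases hθ : θ ∈ Ioo (0 : ℝ) 1
    · rw [indicator_of_mem hθ, gfdDensity_of_mem hθ, norm_velocity hn]; ring
    · rw [indicator_of_notMem hθ, gfdDensity, indicator_of_notMem hθ]; simp
  simp_rw [integral_cylinderMass y hψ hB, ← integral_div]
  rw [e1]
  have mN : ∀ r, Measurable fun θ =>
      (uniformLaw n).real {u | residual y u θ ∈ cylinder (velocity y θ) r} := fun r => by
    have h := measurable_measure_prodMk_right (μ := uniformLaw n)
      (measurableSet_residual_cylinder y r)
    exact h.ennreal_toReal
  refine tendsto_integral_filter_of_dominated_convergence (fun _ => B * (2 ^ n * (κ * n)))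
    (Eventually.of_forall fun r => ((hψ.mul (mN r)).div_const _).aestronglyMeasurable) ?_
    (integrable_const _) ?_
  · filter_upwards [self_mem_nhdsWithin] with r hr
    have hr0 : (0 : ℝ) < r := hr
    filter_upwards [ae_restrict_mem measurableSet_Ioo] with θ hθ
    rw [norm_div, norm_mul, Real.norm_eq_abs, Real.norm_of_nonneg (pow_pos hr0 n).le,
      Real.norm_of_nonneg measureReal_nonneg, mul_div_assoc]
    refine mul_le_mul (hB θ) ?_ (by positivity) hB0
    rw [div_le_iff₀ (pow_pos hr0 n)]
    have h := uniformLaw_residual_le y hθ (measurableSet_cylinder (velocity y θ) r)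
    rw [hvol _ (hw θ hθ) r hr0] at h
    have h2 := ENNReal.toReal_mono (by finiteness) h
    rw [ENNReal.toReal_mul, ENNReal.toReal_pow, ENNReal.toReal_ofNat,
      ENNReal.toReal_ofReal (by positivity)] at h2
    refine h2.trans ?_
    have := norm_velocity_le y hθ
    calc (2 : ℝ) ^ n * (κ * ‖velocity y θ‖ * r ^ n) ≤ 2 ^ n * (κ * n * r ^ n) := by gcongr
      _ = _ := by ring
  · filter_upwards [ae_restrict_mem measurableSet_Ioo] with θ hθ
    simp_rw [mul_div_assoc]
    exact (tendsto_uniformLaw_cylinder hκ hvol y hθ (hw θ hθ)).const_mul _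

/-! ### Mass of the near-minimizers -/

/-- The event of having a near-minimizer in `S` has probability at most of the order `ε ^ (n - 1)`
times the length of a neighbourhood `T` of `S`: all parameters within `ε` of a near-minimizer have
a residual of order `ε`. -/
lemma exists_measure_nearSet_le {n : ℕ} (y : Fin n → ℝ) : ∃ V : ℝ, 0 ≤ V ∧
    ∀ Q, IsPseudoInverse triDGA (Ioo 0 1) y Q → ∀ S T : Set ℝ, MeasurableSet S → MeasurableSet T →
      ∀ ε, 0 < ε → ε ≤ 1 / 2 → (∀ s ∈ S, ∀ θ, |θ - s| ≤ ε → θ ∈ T) →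
        ε / ε ^ n * (uniformLaw n).real (nearSet triDGA (Ioo 0 1) y ε ∩ Q ⁻¹' S)
          ≤ V * volume.real (T ∩ Ioo 0 1) := by
  set V₀ := volume (Metric.ball (0 : EuclideanSpace ℝ (Fin n)) 1) with hV₀
  have hV₀fin : V₀ ≠ ⊤ := Metric.isBounded_ball.measure_lt_top.ne
  refine ⟨2 ^ n * ((1 + n) ^ n * V₀.toReal), by positivity, fun Q hQ S T hS hT ε hε hε2 hST => ?_⟩
  set A := nearSet triDGA (Ioo 0 1) y ε ∩ Q ⁻¹' S with hA
  have hAm : MeasurableSet A := (measurableSet_nearSet y ε).inter (hQ.1 hS)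
  have hTm : MeasurableSet (T ∩ Ioo 0 1) := hT.inter measurableSet_Ioo
  set R := (1 + n) * ε with hR
  have hR0 : 0 < R := by positivity
  have hTfin : volume (T ∩ Ioo (0 : ℝ) 1) ≠ ⊤ :=
    ((measure_mono inter_subset_right).trans_lt measure_Ioo_lt_top).ne
  have mW : MeasurableSet {z : (Fin n → ℝ) × ℝ | residual y z.1 z.2 ∈ Metric.closedBall 0 R} :=
    measurable_residual y Metric.isClosed_closedBall.measurableSet
  have mF : Measurable fun z : (Fin n → ℝ) × ℝ =>
      {z : (Fin n → ℝ) × ℝ | residual y z.1 z.2 ∈ Metric.closedBall 0 R}.indicator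
        (fun _ => (1 : ℝ≥0∞)) z := measurable_const.indicator mW
  have key : ∀ u ∈ A, ENNReal.ofReal ε ≤ ∫⁻ θ in T ∩ Ioo 0 1,
      {z : (Fin n → ℝ) × ℝ | residual y z.1 z.2 ∈ Metric.closedBall 0 R}.indicator
        (fun _ => (1 : ℝ≥0∞)) (u, θ) := fun u hu => by
    obtain ⟨hbox, harg, hle⟩ := (mem_nearSet_iff hQ).1 hu.1
    -- an interval of length `ε` on the side of the minimizer that faces the centre of `(0,1)`, so that it
    -- stays inside the parameter set
    obtain ⟨I, hIm, hI, hIvol⟩ : ∃ I : Set ℝ, MeasurableSet I ∧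
        (∀ θ ∈ I, |θ - Q u| ≤ ε ∧ θ ∈ Ioo (0 : ℝ) 1) ∧ volume I = ENNReal.ofReal ε := by
      rcases le_or_gt (Q u) (1 / 2) with h | h
      · refine ⟨Ioo (Q u) (Q u + ε), measurableSet_Ioo, fun θ hθ => ⟨?_, ?_⟩, ?_⟩
        · exact abs_le.2 ⟨by linarith [hθ.1], by linarith [hθ.2]⟩
        · exact ⟨harg.1.1.trans hθ.1, by linarith [hθ.2]⟩
        · rw [Real.volume_Ioo]; congr 1; ring
      · refine ⟨Ioo (Q u - ε) (Q u), measurableSet_Ioo, fun θ hθ => ⟨?_, ?_⟩, ?_⟩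
        · exact abs_le.2 ⟨by linarith [hθ.1], by linarith [hθ.2]⟩
        · exact ⟨by linarith [hθ.1], hθ.2.trans harg.1.2⟩
        · rw [Real.volume_Ioo]; congr 1; ring
    have hIT : I ⊆ T ∩ Ioo 0 1 := fun θ hθ => ⟨hST _ hu.2 θ (hI θ hθ).1, (hI θ hθ).2⟩
    rw [← hIvol, ← setLIntegral_one]
    refine le_trans ?_ (lintegral_mono_set hIT)
    refine setLIntegral_mono' hIm fun θ hθ => ?_
    rw [indicator_of_mem]
    change residual y u θ ∈ Metric.closedBall 0 R
    rw [mem_closedBall_zero_iff, hR]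
    have h1 := norm_residual_sub_le (y := y) hbox (hI θ hθ).2 harg.1
    have h2 : (n : ℝ) * |θ - Q u| ≤ n * ε := by
      have := (hI θ hθ).1
      gcongr
    have h3 := norm_sub_norm_le (residual y u θ) (residual y u (Q u))
    rw [misfit_eq_norm] at hle
    linarith
  have hmain : ENNReal.ofReal ε * uniformLaw n A
      ≤ volume (T ∩ Ioo (0 : ℝ) 1) * (2 ^ n * (ENNReal.ofReal (R ^ n) * V₀)) := by
    calc ENNReal.ofReal ε * uniformLaw n A = ∫⁻ _ in A, ENNReal.ofReal ε ∂(uniformLaw n) :=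
          (setLIntegral_const _ _).symm
      _ ≤ ∫⁻ u in A, (∫⁻ θ in T ∩ Ioo 0 1,
          {z : (Fin n → ℝ) × ℝ | residual y z.1 z.2 ∈ Metric.closedBall 0 R}.indicator
            (fun _ => (1 : ℝ≥0∞)) (u, θ)) ∂(uniformLaw n) := setLIntegral_mono' hAm key
      _ ≤ ∫⁻ u, (∫⁻ θ in T ∩ Ioo 0 1,
          {z : (Fin n → ℝ) × ℝ | residual y z.1 z.2 ∈ Metric.closedBall 0 R}.indicator
            (fun _ => (1 : ℝ≥0∞)) (u, θ)) ∂(uniformLaw n) := setLIntegral_le_lintegral _ _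
      _ = ∫⁻ θ in T ∩ Ioo 0 1, (∫⁻ u,
          {z : (Fin n → ℝ) × ℝ | residual y z.1 z.2 ∈ Metric.closedBall 0 R}.indicator
            (fun _ => (1 : ℝ≥0∞)) (u, θ) ∂(uniformLaw n)) :=
          lintegral_lintegral_swap mF.aemeasurable
      _ ≤ ∫⁻ _ in T ∩ Ioo 0 1, 2 ^ n * (ENNReal.ofReal (R ^ n) * V₀) := by
          refine setLIntegral_mono' hTm fun θ hθ => ?_
          have ms : MeasurableSet {u : Fin n → ℝ | residual y u θ ∈ Metric.closedBall 0 R} := by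
            have h : Measurable fun u : Fin n → ℝ => (u, θ) := by fun_prop
            have h2 := h mW
            exact h2
          have e : (fun u => {z : (Fin n → ℝ) × ℝ |
              residual y z.1 z.2 ∈ Metric.closedBall 0 R}.indicator (fun _ => (1 : ℝ≥0∞)) (u, θ))
              = {u : Fin n → ℝ | residual y u θ ∈ Metric.closedBall 0 R}.indicator 1 := by
            ext u; simp [indicator]
          rw [e, lintegral_indicator_one ms]
          refine (uniformLaw_residual_le y hθ.2
            Metric.isClosed_closedBall.measurableSet).trans_eq ?_
          rw [Measure.addHaar_closedBall _ _ hR0.le, finrank_euclideanSpace_fin]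
      _ = _ := by rw [setLIntegral_const, mul_comm]
  have hreal := ENNReal.toReal_mono (by finiteness) hmain
  rw [ENNReal.toReal_mul, ENNReal.toReal_mul, ENNReal.toReal_mul, ENNReal.toReal_mul,
    ENNReal.toReal_pow, ENNReal.toReal_ofNat, ENNReal.toReal_ofReal hε.le,
    ENNReal.toReal_ofReal (by positivity)] at hreal
  have hreal' : ε * (uniformLaw n).real A ≤ volume.real (T ∩ Ioo (0 : ℝ) 1)
      * (2 ^ n * (R ^ n * V₀.toReal)) := hreal
  rw [div_mul_eq_mul_div, div_le_iff₀ (by positivity)]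
  refine hreal'.trans_eq ?_
  rw [hR, mul_pow]; ring

/-! ### The weak limit -/

lemma cylinderMass_nonneg {n : ℕ} (y : Fin n → ℝ) {ψ : ℝ → ℝ} (h0 : ∀ θ, 0 ≤ ψ θ) (r : ℝ)
    (u : Fin n → ℝ) : 0 ≤ cylinderMass y ψ r u :=
  integral_nonneg fun _ => indicator_nonneg (fun θ _ => h0 θ) _

lemma integrable_cylinder_indicator_right {n : ℕ} (y : Fin n → ℝ) {ψ : ℝ → ℝ} (hψ : Measurable ψ)
    {B : ℝ} (hB : ∀ θ, |ψ θ| ≤ B) (r : ℝ) (u : Fin n → ℝ) : IntegrableOn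
      ({θ | residual y u θ ∈ cylinder (velocity y θ) r}.indicator ψ) (Ioo 0 1) := by
  have m : Measurable ({θ | residual y u θ ∈ cylinder (velocity y θ) r}.indicator ψ) := by
    have h : Measurable (fun θ : ℝ => (u, θ)) := by fun_prop
    have h2 := (measurable_cylinder_indicator y hψ r).comp h
    exact h2
  exact Integrable.of_bound m.aestronglyMeasurable B
    (ae_of_all _ fun z => (norm_indicator_le_norm_self _ _).trans (hB _))

/-- The cylinder integral at a sample `u` is `2 ε ψ(Q u)` on the near set and zero off it, up to a
relative change of order `ε` of the radius. -/
lemma eventually_cylinderMass_sandwich {n : ℕ} (hn : 0 < n) {y : Fin n → ℝ}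
    (hy : ∀ i, y i ∈ Ioo (0 : ℝ) 1) {Q : (Fin n → ℝ) → ℝ}
    (hQ : IsPseudoInverse triDGA (Ioo 0 1) y Q) {a : ℝ} (ha : 0 < a) {ψ : ℝ → ℝ}
    (hψ : Continuous ψ) (h0 : ∀ θ, 0 ≤ ψ θ) {B : ℝ} (hB : ∀ θ, |ψ θ| ≤ B)
    (hsupp : ∀ θ, θ ∉ Icc (2 * a) (1 - 2 * a) → ψ θ = 0) :
    ∃ C : ℝ, 0 ≤ C ∧ ∀ η, 0 < η → ∀ᶠ ε in 𝓝[>] (0 : ℝ), C * ε < 1 ∧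
      ∀ u : Fin n → ℝ, (∀ i, u i ∈ Ioo (0 : ℝ) 1) →
        (nearSet triDGA (Ioo 0 1) y ε).indicator (fun u => 2 * ε * (ψ (Q u) - η)) u
          ≤ cylinderMass y ψ (ε + C * ε ^ 2) u ∧
        cylinderMass y ψ (ε - C * ε ^ 2) u
          ≤ (nearSet triDGA (Ioo 0 1) y ε).indicator (fun u => 2 * ε * (ψ (Q u) + η)) u := by
  obtain ⟨C, hC0, hC⟩ := exists_cylinder_constant hn hy ha
  refine ⟨C, hC0, fun η hη => ?_⟩
  have huc : UniformContinuous ψ := HasCompactSupport.uniformContinuous_of_continuous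
    (HasCompactSupport.intro isCompact_Icc hsupp) hψ
  obtain ⟨δ, hδ, hmod⟩ := Metric.uniformContinuous_iff.1 huc η hη
  filter_upwards [hC, self_mem_nhdsWithin, Ioo_mem_nhdsGT hδ] with ε hε hε0 hεδ
  have hε0' : (0 : ℝ) < ε := hε0
  obtain ⟨hCε, hεa, hε⟩ := hε
  refine ⟨hCε, fun u hu => ?_⟩
  obtain ⟨hup, hlow⟩ := hε u hu
  have hmod' : ∀ s t : ℝ, |s - t| ≤ ε → |ψ s - ψ t| < η := fun s t h =>
    hmod (lt_of_le_of_lt h hεδ.2)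
  have hvol : ∀ q : ℝ, volume.real (Icc (q - ε) (q + ε)) = 2 * ε := fun q => by
    rw [Real.volume_real_Icc_of_le (by linarith)]; ring
  -- lower bound: all parameters within `ε` of `Q u` are counted; upper bound: no others are
  constructor
  · by_cases hA : u ∈ nearSet triDGA (Ioo 0 1) y ε
    swap
    · rw [indicator_of_notMem hA]; exact cylinderMass_nonneg y h0 _ u
    rw [indicator_of_mem hA]
    by_cases hK : Q u ∈ Icc (2 * a) (1 - 2 * a)
    swap
    · rw [hsupp _ hK]
      exact le_trans (by nlinarith) (cylinderMass_nonneg y h0 _ u)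
    obtain ⟨-, harg, hle⟩ := (mem_nearSet_iff hQ).1 hA
    have hsub : Icc (Q u - ε) (Q u + ε) ⊆ Ioo 0 1 := fun θ hθ =>
      ⟨by linarith [hθ.1, hK.1], by linarith [hθ.2, hK.2]⟩
    have hint := integrable_cylinder_indicator_right y hψ.measurable hB (ε + C * ε ^ 2) u
    calc 2 * ε * (ψ (Q u) - η) = ∫ _ in Icc (Q u - ε) (Q u + ε), (ψ (Q u) - η) := by
          rw [setIntegral_const, hvol, smul_eq_mul]
      _ ≤ ∫ θ in Icc (Q u - ε) (Q u + ε),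
          {θ | residual y u θ ∈ cylinder (velocity y θ) (ε + C * ε ^ 2)}.indicator ψ θ := by
          refine setIntegral_mono_on (integrableOn_const (by simp)) (hint.mono_set hsub)
            measurableSet_Icc fun θ hθ => ?_
          have hd : |Q u - θ| ≤ ε := abs_le.2 ⟨by linarith [hθ.2], by linarith [hθ.1]⟩
          rw [indicator_of_mem (show θ ∈ {θ | residual y u θ ∈
            cylinder (velocity y θ) (ε + C * ε ^ 2)} from hup _ hK harg.2 hle θ hd)]
          linarith [(abs_lt.1 (hmod' _ _ hd)).2]
      _ ≤ cylinderMass y ψ (ε + C * ε ^ 2) u :=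
          setIntegral_mono_set hint
            (ae_of_all _ fun θ => indicator_nonneg (fun θ _ => h0 θ) θ) hsub.eventuallyLE
  · by_cases hex : ∃ θ ∈ Icc (2 * a) (1 - 2 * a),
        residual y u θ ∈ cylinder (velocity y θ) (ε - C * ε ^ 2)
    swap
    · have hz : cylinderMass y ψ (ε - C * ε ^ 2) u = 0 := by
        refine integral_eq_zero_of_ae (ae_of_all _ fun θ => ?_)
        by_cases hθ : θ ∈ Icc (2 * a) (1 - 2 * a)
        · exact indicator_of_notMem (show θ ∉ {θ | residual y u θ ∈
            cylinder (velocity y θ) (ε - C * ε ^ 2)} from fun h => hex ⟨θ, hθ, h⟩) _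
        · exact indicator_apply_eq_zero.2 fun _ => hsupp θ hθ
      rw [hz]
      exact indicator_nonneg (fun u _ => by have := h0 (Q u); positivity) _
    obtain ⟨θ₁, hθ₁, hmem₁⟩ := hex
    obtain ⟨hne, hall⟩ := hlow θ₁ hθ₁ hmem₁
    have harg := hQ.2 u hu hne
    have hA : u ∈ nearSet triDGA (Ioo 0 1) y ε :=
      (mem_nearSet_iff hQ).2 ⟨hu, harg, (hall _ harg).1⟩
    rw [indicator_of_mem hA]
    have hc : 0 ≤ ψ (Q u) + η := by have := h0 (Q u); positivity
    calc cylinderMass y ψ (ε - C * ε ^ 2) u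
        ≤ ∫ θ in Ioo 0 1, (Icc (Q u - ε) (Q u + ε)).indicator (fun _ => ψ (Q u) + η) θ := by
          refine integral_mono (integrable_cylinder_indicator_right y hψ.measurable hB _ u)
            ((integrable_const _).indicator measurableSet_Icc) fun θ => ?_
          by_cases hθ : θ ∈ {θ | residual y u θ ∈ cylinder (velocity y θ) (ε - C * ε ^ 2)} ∧
            θ ∈ Icc (2 * a) (1 - 2 * a)
          · have hd := ((hlow θ hθ.2 hθ.1).2 _ harg).2
            have hd' := abs_le.1 hd
            rw [indicator_of_mem hθ.1, indicator_of_mem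
              (show θ ∈ Icc (Q u - ε) (Q u + ε) from ⟨by linarith, by linarith⟩)]
            linarith [(abs_lt.1 (hmod' _ _ hd)).1]
          · have hz : {θ | residual y u θ ∈ cylinder (velocity y θ) (ε - C * ε ^ 2)}.indicator ψ θ
                = 0 := indicator_apply_eq_zero.2 fun h => hsupp θ fun h' => hθ ⟨h, h'⟩
            rw [hz]
            exact indicator_nonneg (fun _ _ => hc) _
      _ ≤ ∫ θ, (Icc (Q u - ε) (Q u + ε)).indicator (fun _ => ψ (Q u) + η) θ :=
          setIntegral_le_integral ((integrableOn_const (by simp)).integrable_indicator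
            measurableSet_Icc) (ae_of_all _ fun θ => indicator_nonneg (fun _ _ => hc) _)
      _ = 2 * ε * (ψ (Q u) + η) := by
          rw [integral_indicator measurableSet_Icc, setIntegral_const, hvol, smul_eq_mul]

/-- The limit of the mass of the near set, weighted by a continuous function of the minimizer that
vanishes near the ends of the parameter set. -/
lemma tendsto_nearSet_integral_of_support {n : ℕ} (hn : 0 < n) {κ : ℝ} (hκ : 0 < κ)
    (hvol : ∀ w : EuclideanSpace ℝ (Fin n), w ≠ 0 → ∀ r, 0 < r →
      volume (cylinder w r) = ENNReal.ofReal (κ * ‖w‖ * r ^ n))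
    {y : Fin n → ℝ} (hy : ∀ i, y i ∈ Ioo (0 : ℝ) 1) {Q : (Fin n → ℝ) → ℝ}
    (hQ : IsPseudoInverse triDGA (Ioo 0 1) y Q) {a : ℝ} (ha : 0 < a) {ψ : ℝ → ℝ}
    (hψ : Continuous ψ) (h0 : ∀ θ, 0 ≤ ψ θ) {B : ℝ} (hB : ∀ θ, |ψ θ| ≤ B)
    (hsupp : ∀ θ, θ ∉ Icc (2 * a) (1 - 2 * a) → ψ θ = 0) :
    Tendsto (fun ε => ε / ε ^ n * ∫ u in nearSet triDGA (Ioo 0 1) y ε, ψ (Q u) ∂(uniformLaw n))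
      (𝓝[>] 0) (𝓝 (κ * √n / 2 * ∫ θ, ψ θ * gfdDensity n y θ)) := by
  obtain ⟨C, hC0, hC⟩ := eventually_cylinderMass_sandwich hn hy hQ ha hψ h0 hB hsupp
  obtain ⟨V, hV0, hV⟩ := exists_measure_nearSet_le y
  have hF := tendsto_integral_cylinderMass hn hκ hvol hy hψ.measurable hB
  set F := fun r => ∫ u, cylinderMass y ψ r u ∂(uniformLaw n) with hFdef
  set I := ∫ θ, ψ θ * gfdDensity n y θ with hI
  -- a relative change of the radius of order `ε` does not change the limit
  have hpert : ∀ c : ℝ, Tendsto (fun ε : ℝ => F (ε + c * ε ^ 2) / ε ^ n) (𝓝[>] 0)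
      (𝓝 (κ * √n * I)) := fun c => by
    have t1 : Tendsto (fun ε : ℝ => 1 + c * ε) (𝓝[>] 0) (𝓝 1) := by
      have h : Tendsto (fun ε : ℝ => 1 + c * ε) (𝓝 0) (𝓝 (1 + c * 0)) :=
        (show Continuous fun ε : ℝ => 1 + c * ε by fun_prop).tendsto 0
      rw [mul_zero, add_zero] at h
      exact h.mono_left nhdsWithin_le_nhds
    have t2 : ∀ᶠ ε in 𝓝[>] (0 : ℝ), 0 < 1 + c * ε := t1.eventually (lt_mem_nhds one_pos)
    have t3 : Tendsto (fun ε : ℝ => ε + c * ε ^ 2) (𝓝[>] 0) (𝓝[>] 0) := by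
      refine tendsto_nhdsWithin_iff.2 ⟨?_, ?_⟩
      · have h : Tendsto (fun ε : ℝ => ε + c * ε ^ 2) (𝓝 0) (𝓝 (0 + c * 0 ^ 2)) :=
          (show Continuous fun ε : ℝ => ε + c * ε ^ 2 by fun_prop).tendsto 0
        simp only [ne_eq, OfNat.ofNat_ne_zero, not_false_eq_true, zero_pow, mul_zero, add_zero] at h
        exact h.mono_left nhdsWithin_le_nhds
      · filter_upwards [t2, self_mem_nhdsWithin] with ε h1 h2
        have h2' : (0 : ℝ) < ε := h2
        have : 0 < ε * (1 + c * ε) := mul_pos h2' h1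
        rw [mem_Ioi]
        linarith
    have t4 := (hF.comp t3).mul (t1.pow n)
    rw [one_pow, mul_one] at t4
    refine t4.congr' ?_
    filter_upwards [t2, self_mem_nhdsWithin] with ε h1 h2
    have h2' : (0 : ℝ) < ε := h2
    have e : ε + c * ε ^ 2 = ε * (1 + c * ε) := by ring
    simp only [Function.comp_apply, e, mul_pow, hFdef]
    generalize 1 + c * ε = k at h1 ⊢
    field_simp
  have hA := fun ε => measurableSet_nearSet y ε
  have hψQ : Integrable (fun u => ψ (Q u)) (uniformLaw n) :=
    Integrable.of_bound (hψ.measurable.comp hQ.1).aestronglyMeasurable B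
      (ae_of_all _ fun u => hB _)
  rw [Metric.tendsto_nhds]
  intro τ hτ
  set η := τ / (2 * (V + 1)) with hη
  have hη0 : 0 < η := by positivity
  have hηV : η * V ≤ τ / 2 := by
    rw [hη, div_mul_eq_mul_div, div_le_iff₀ (by positivity)]; nlinarith
  filter_upwards [hC η hη0, self_mem_nhdsWithin, Ioo_mem_nhdsGT (show (0 : ℝ) < 1 / 2 by norm_num),
    (hpert C).eventually (gt_mem_nhds (show κ * √n * I < κ * √n * I + τ by linarith)),
    (hpert (-C)).eventually (lt_mem_nhds (show κ * √n * I - τ < κ * √n * I by linarith))]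
    with ε hε hε0 hε1 hb1 hb2
  have hε0' : (0 : ℝ) < ε := hε0
  have hw := hV Q hQ univ univ MeasurableSet.univ MeasurableSet.univ ε hε0' hε1.2.le
    fun _ _ _ _ => mem_univ _
  rw [preimage_univ, inter_univ, univ_inter, Real.volume_real_Ioo_of_le zero_le_one, sub_zero,
    mul_one] at hw
  set A := nearSet triDGA (Ioo 0 1) y ε with hAdef
  have hint : ∀ c : ℝ, ∫ u, A.indicator (fun u => 2 * ε * (ψ (Q u) + c)) u ∂(uniformLaw n)
      = 2 * ε * (∫ u in A, ψ (Q u) ∂(uniformLaw n)) + 2 * ε * c * (uniformLaw n).real A := fun c => by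
    rw [integral_indicator (hA ε), integral_const_mul, integral_add hψQ.integrableOn
      (integrable_const c), setIntegral_const, smul_eq_mul]
    ring
  have hintg : ∀ c : ℝ, Integrable (A.indicator fun u => 2 * ε * (ψ (Q u) + c)) (uniformLaw n) :=
    fun c => ((hψQ.add (integrable_const c)).const_mul _).indicator (hA ε)
  have hbox := uniformLaw_ae n
  have i1 : 2 * ε * (∫ u in A, ψ (Q u) ∂(uniformLaw n)) + 2 * ε * (-η) * (uniformLaw n).real A
      ≤ F (ε + C * ε ^ 2) := by
    rw [← hint]
    refine integral_mono_ae (hintg _) (integrable_cylinderMass y hψ.measurable hB _) ?_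
    filter_upwards [hbox] with u hu
    exact (hε.2 u hu).1
  have i2 : F (ε + -C * ε ^ 2)
      ≤ 2 * ε * (∫ u in A, ψ (Q u) ∂(uniformLaw n)) + 2 * ε * η * (uniformLaw n).real A := by
    rw [← hint, neg_mul, ← sub_eq_add_neg]
    refine integral_mono_ae (integrable_cylinderMass y hψ.measurable hB _) (hintg _) ?_
    filter_upwards [hbox] with u hu
    exact (hε.2 u hu).2
  have hεn : 0 < ε ^ n := pow_pos hε0' n
  have j1 := (div_le_div_of_nonneg_right i1 hεn.le).trans_lt hb1
  have j2 := hb2.trans_le (div_le_div_of_nonneg_right i2 hεn.le)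
  set W := (uniformLaw n).real A
  set X := ∫ u in A, ψ (Q u) ∂(uniformLaw n)
  have e1 : (2 * ε * X + 2 * ε * (-η) * W) / ε ^ n
      = 2 * (ε / ε ^ n * X) - 2 * (η * (ε / ε ^ n * W)) := by ring
  have e2 : (2 * ε * X + 2 * ε * η * W) / ε ^ n
      = 2 * (ε / ε ^ n * X) + 2 * (η * (ε / ε ^ n * W)) := by ring
  rw [e1] at j1
  rw [e2] at j2
  have hηw : η * (ε / ε ^ n * W) ≤ η * V := mul_le_mul_of_nonneg_left hw hη0.le
  rw [Real.dist_eq, abs_lt]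
  have e3 : κ * √n / 2 * I = κ * √n * I / 2 := by ring
  rw [e3]
  constructor <;> linarith

/-- A continuous cutoff, equal to one at distance `3 a` from the ends of the unit interval and to
zero at distance `2 a`. -/
def cutoff (a θ : ℝ) : ℝ := max 0 (min 1 ((min θ (1 - θ) - 2 * a) / a))

lemma continuous_cutoff (a : ℝ) : Continuous (cutoff a) := by
  unfold cutoff
  fun_prop

lemma cutoff_mem (a θ : ℝ) : cutoff a θ ∈ Icc (0 : ℝ) 1 :=
  ⟨le_max_left _ _, max_le zero_le_one (min_le_left _ _)⟩

lemma cutoff_of_notMem {a θ : ℝ} (ha : 0 < a) (h : θ ∉ Icc (2 * a) (1 - 2 * a)) :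
    cutoff a θ = 0 := by
  refine max_eq_left ((min_le_right _ _).trans (div_nonpos_of_nonpos_of_nonneg ?_ ha.le))
  by_contra hcon
  have hcon' : 2 * a < min θ (1 - θ) := by linarith
  exact h ⟨(lt_min_iff.1 hcon').1.le, by linarith [(lt_min_iff.1 hcon').2]⟩

lemma cutoff_of_mem {a θ : ℝ} (ha : 0 < a) (h : θ ∈ Icc (3 * a) (1 - 3 * a)) :
    cutoff a θ = 1 := by
  have h1 : 3 * a ≤ min θ (1 - θ) := le_min h.1 (by linarith [h.2])
  have h2 : 1 ≤ (min θ (1 - θ) - 2 * a) / a := (one_le_div ha).2 (by linarith)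
  rw [cutoff, min_eq_left h2, max_eq_right zero_le_one]

/-- The length of a neighbourhood of the ends, slightly larger than the set on which the cutoff is
less than one. -/
lemma volume_real_edges_le {a : ℝ} (ha : 0 < a) :
    volume.real ((Icc (4 * a) (1 - 4 * a))ᶜ ∩ Ioo 0 1) ≤ 8 * a := by
  have hsub : (Icc (4 * a) (1 - 4 * a))ᶜ ∩ Ioo 0 1 ⊆ Ioo 0 (4 * a) ∪ Ioo (1 - 4 * a) 1 := by
    rintro θ ⟨h1, h2⟩
    by_cases h : θ < 4 * a
    · exact Or.inl ⟨h2.1, h⟩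
    · refine Or.inr ⟨?_, h2.2⟩
      by_contra h'
      exact h1 ⟨not_lt.1 h, not_lt.1 h'⟩
  refine (measureReal_mono hsub
    (measure_union_lt_top measure_Ioo_lt_top measure_Ioo_lt_top).ne).trans ((measureReal_union_le _ _).trans_eq ?_)
  rw [Real.volume_real_Ioo_of_le (by linarith), Real.volume_real_Ioo_of_le (by linarith)]
  ring

/-- The limit of the mass of the near set, weighted by a nonnegative continuous function of the
minimizer. Truncating the weight at the ends of the parameter set changes both sides by the order of
the width of the truncated edges, uniformly in `ε`. -/
lemma tendsto_nearSet_integral_of_nonneg {n : ℕ} (hn : 0 < n) {κ : ℝ} (hκ : 0 < κ)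
    (hvol : ∀ w : EuclideanSpace ℝ (Fin n), w ≠ 0 → ∀ r, 0 < r →
      volume (cylinder w r) = ENNReal.ofReal (κ * ‖w‖ * r ^ n))
    {y : Fin n → ℝ} (hy : ∀ i, y i ∈ Ioo (0 : ℝ) 1) {Q : (Fin n → ℝ) → ℝ}
    (hQ : IsPseudoInverse triDGA (Ioo 0 1) y Q) {g : ℝ → ℝ}
    (hg : Continuous g) (h0 : ∀ θ, 0 ≤ g θ) {B : ℝ} (hB : ∀ θ, |g θ| ≤ B) :
    Tendsto (fun ε => ε / ε ^ n * ∫ u in nearSet triDGA (Ioo 0 1) y ε, g (Q u) ∂(uniformLaw n))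
      (𝓝[>] 0) (𝓝 (κ * √n / 2 * ∫ θ, g θ * gfdDensity n y θ)) := by
  obtain ⟨V, hV0, hV⟩ := exists_measure_nearSet_le y
  have hB0 : 0 ≤ B := (abs_nonneg _).trans (hB 0)
  set D := κ * √n / 2 with hD
  have hD0 : 0 ≤ D := by positivity
  rw [Metric.tendsto_nhds]
  intro τ hτ
  set c := B * V * 8 + D * (B * 2 ^ n * 8) with hc
  have hc0 : 0 ≤ c := by positivity
  -- the width of the edges is chosen so that they contribute at most half of `τ`
  set a := τ / (2 * (c + 1)) with ha'
  have ha : 0 < a := by positivity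
  have hca : c * a ≤ τ / 2 := by
    rw [ha', mul_div_assoc', div_le_iff₀ (by positivity)]; nlinarith
  have hχ := cutoff_mem a
  have hψc : Continuous fun θ => g θ * cutoff a θ := hg.mul (continuous_cutoff a)
  have hψ0 : ∀ θ, 0 ≤ g θ * cutoff a θ := fun θ => mul_nonneg (h0 θ) (hχ θ).1
  have hψB : ∀ θ, |g θ * cutoff a θ| ≤ B := fun θ => by
    rw [abs_mul, abs_of_nonneg (hχ θ).1]
    exact (mul_le_of_le_one_right (abs_nonneg _) (hχ θ).2).trans (hB θ)
  have hlim := tendsto_nearSet_integral_of_support hn hκ hvol hy hQ ha hψc hψ0 hψB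
    fun θ hθ => by rw [cutoff_of_notMem ha hθ, mul_zero]
  -- the difference of `g` and its truncation is supported on the edges
  have hdiff : ∀ θ, g θ - g θ * cutoff a θ ∈ Icc 0 ((Icc (3 * a) (1 - 3 * a))ᶜ.indicator
      (fun _ => B) θ) := fun θ => by
    by_cases h : θ ∈ Icc (3 * a) (1 - 3 * a)
    · rw [cutoff_of_mem ha h, mul_one, sub_self, indicator_of_notMem
        (show θ ∉ (Icc (3 * a) (1 - 3 * a))ᶜ from fun h' => h' h)]
      exact ⟨le_rfl, le_rfl⟩
    · rw [indicator_of_mem (show θ ∈ (Icc (3 * a) (1 - 3 * a))ᶜ from h)]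
      have h1 := h0 θ
      have h2 := (le_abs_self _).trans (hB θ)
      have h3 := hχ θ
      exact ⟨by nlinarith [h3.2], by nlinarith [h3.1]⟩
  have hρ := integrable_gfdDensity n y
  have hbd : ∀ f : ℝ → ℝ, Continuous f → (∀ θ, |f θ| ≤ B) →
      Integrable (fun θ => f θ * gfdDensity n y θ) := fun f hf hfB =>
    hρ.bdd_mul hf.aestronglyMeasurable (ae_of_all _ hfB)
  have hlimdiff : |(∫ θ, g θ * gfdDensity n y θ) - ∫ θ, g θ * cutoff a θ * gfdDensity n y θ|
      ≤ B * 2 ^ n * (8 * a) := by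
    rw [← integral_sub (hbd g hg hB) (hbd _ hψc hψB)]
    have hmeas : MeasurableSet ((Icc (4 * a) (1 - 4 * a))ᶜ ∩ Ioo (0 : ℝ) 1) :=
      measurableSet_Icc.compl.inter measurableSet_Ioo
    have hfin : volume ((Icc (4 * a) (1 - 4 * a))ᶜ ∩ Ioo (0 : ℝ) 1) ≠ ⊤ :=
      ((measure_mono inter_subset_right).trans_lt measure_Ioo_lt_top).ne
    have hle : ∀ θ, ‖g θ * gfdDensity n y θ - g θ * cutoff a θ * gfdDensity n y θ‖
        ≤ ((Icc (4 * a) (1 - 4 * a))ᶜ ∩ Ioo (0 : ℝ) 1).indicator (fun _ => B * 2 ^ n) θ :=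
        fun θ => by
      have hd := hdiff θ
      rw [← sub_mul, norm_mul, Real.norm_of_nonneg hd.1, Real.norm_of_nonneg gfdDensity_nonneg]
      by_cases hθ : θ ∈ Ioo (0 : ℝ) 1
      swap
      · rw [gfdDensity, indicator_of_notMem hθ, mul_zero]
        exact indicator_nonneg (fun _ _ => by positivity) _
      by_cases h : θ ∈ Icc (4 * a) (1 - 4 * a)
      · have h' : θ ∈ Icc (3 * a) (1 - 3 * a) := ⟨by linarith [h.1], by linarith [h.2]⟩
        rw [cutoff_of_mem ha h', mul_one, sub_self, zero_mul]
        exact indicator_nonneg (fun _ _ => by positivity) _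
      · rw [indicator_of_mem (show θ ∈ (Icc (4 * a) (1 - 4 * a))ᶜ ∩ Ioo (0 : ℝ) 1 from ⟨h, hθ⟩)]
        refine mul_le_mul (hd.2.trans (indicator_le_self' (fun _ _ => hB0) _)) (gfdDensity_le hθ)
          gfdDensity_nonneg hB0
    refine (norm_integral_le_integral_norm _).trans ((integral_mono_of_nonneg
      (ae_of_all _ fun _ => norm_nonneg _)
      ((integrableOn_const hfin).integrable_indicator hmeas) (ae_of_all _ hle)).trans ?_)
    rw [integral_indicator hmeas, setIntegral_const, smul_eq_mul, mul_comm]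
    exact mul_le_mul_of_nonneg_left (volume_real_edges_le ha) (by positivity)
  have hgQ : ∀ f : ℝ → ℝ, Continuous f → (∀ θ, |f θ| ≤ B) →
      Integrable (fun u => f (Q u)) (uniformLaw n) := fun f hf hfB =>
    Integrable.of_bound (hf.measurable.comp hQ.1).aestronglyMeasurable B
      (ae_of_all _ fun u => hfB _)
  filter_upwards [self_mem_nhdsWithin, Ioo_mem_nhdsGT ha,
    Ioo_mem_nhdsGT (show (0 : ℝ) < 1 / 2 by norm_num),
    (Metric.tendsto_nhds.1 hlim) (τ / 2) (half_pos hτ)] with ε hε0 hεa hε1 hdist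
  have hε0' : (0 : ℝ) < ε := hε0
  have hεn : 0 < ε / ε ^ n := by positivity
  set A := nearSet triDGA (Ioo 0 1) y ε with hA
  have hAm : MeasurableSet A := measurableSet_nearSet y ε
  have hw := hV Q hQ (Icc (3 * a) (1 - 3 * a))ᶜ (Icc (4 * a) (1 - 4 * a))ᶜ measurableSet_Icc.compl
    measurableSet_Icc.compl ε hε0' hε1.2.le (fun s hs θ hθ hmem => hs (by
      have h := abs_le.1 hθ
      exact ⟨by linarith [hmem.1, hεa.2], by linarith [hmem.2, hεa.2]⟩))
  have hsmall : |∫ u in A, g (Q u) ∂(uniformLaw n) - ∫ u in A, g (Q u) * cutoff a (Q u)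
      ∂(uniformLaw n)| ≤ B * (uniformLaw n).real (A ∩ Q ⁻¹' (Icc (3 * a) (1 - 3 * a))ᶜ) := by
    rw [← integral_sub (hgQ g hg hB).integrableOn (hgQ _ hψc hψB).integrableOn]
    have hQm : MeasurableSet (Q ⁻¹' (Icc (3 * a) (1 - 3 * a))ᶜ) := hQ.1 measurableSet_Icc.compl
    rw [abs_of_nonneg (integral_nonneg fun u => (hdiff (Q u)).1)]
    calc ∫ u in A, (g (Q u) - g (Q u) * cutoff a (Q u)) ∂(uniformLaw n)
        ≤ ∫ u in A, (Q ⁻¹' (Icc (3 * a) (1 - 3 * a))ᶜ).indicator (fun _ => B) u ∂(uniformLaw n) :=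
          integral_mono_of_nonneg (ae_of_all _ fun u => (hdiff (Q u)).1)
            ((integrable_const B).indicator hQm) (ae_of_all _ fun u => (hdiff (Q u)).2)
      _ = _ := by
          rw [setIntegral_indicator hQm, setIntegral_const, smul_eq_mul, mul_comm]
  have hsmall' : |ε / ε ^ n * ∫ u in A, g (Q u) ∂(uniformLaw n)
      - ε / ε ^ n * ∫ u in A, g (Q u) * cutoff a (Q u) ∂(uniformLaw n)| ≤ B * V * 8 * a := by
    rw [← mul_sub, abs_mul, abs_of_pos hεn]
    calc _ ≤ ε / ε ^ n * (B * (uniformLaw n).real (A ∩ Q ⁻¹' (Icc (3 * a) (1 - 3 * a))ᶜ)) := by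
          gcongr
      _ = B * (ε / ε ^ n * (uniformLaw n).real (A ∩ Q ⁻¹' (Icc (3 * a) (1 - 3 * a))ᶜ)) := by ring
      _ ≤ B * (V * (8 * a)) := mul_le_mul_of_nonneg_left
          (hw.trans (mul_le_mul_of_nonneg_left (volume_real_edges_le ha) hV0)) hB0
      _ = _ := by ring
  have hlimdiff' : |D * (∫ θ, g θ * gfdDensity n y θ)
      - D * ∫ θ, g θ * cutoff a θ * gfdDensity n y θ|
      ≤ D * (B * 2 ^ n * 8) * a := by
    rw [← mul_sub, abs_mul, abs_of_nonneg hD0]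
    refine (mul_le_mul_of_nonneg_left hlimdiff hD0).trans_eq ?_
    ring
  rw [Real.dist_eq, ← hD] at hdist
  rw [Real.dist_eq]
  have hsum : B * V * 8 * a + D * (B * 2 ^ n * 8) * a ≤ τ / 2 := by
    rw [← add_mul]; exact hca
  have k1 := abs_le.1 hsmall'
  have k2 := abs_le.1 hlimdiff'
  have k3 := abs_lt.1 hdist
  rw [abs_lt]
  constructor <;> linarith

/-- The law of the pseudo-inverse, given a small misfit, converges weakly to the distribution with
density proportional to the likelihood times the Jacobian: the expectation of `g (Q U)` is the
quotient of two weighted masses of the near set. -/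
lemma isGFD_triGFD {n : ℕ} (hn : 0 < n) {y : Fin n → ℝ} (hy : ∀ i, y i ∈ Ioo (0 : ℝ) 1) :
    IsGFD triDGA (Ioo 0 1) y (triGFD n y) := by
  refine ⟨isProbabilityMeasure_triGFD hn hy, exists_isPseudoInverse y, fun Q hQ g => ?_⟩
  obtain ⟨κ, hκ, hvol⟩ := exists_volume_cylinder hn
  have hn0 : (0 : ℝ) < n := by exact_mod_cast hn
  set D := κ * √n / 2 with hD
  have hD0 : 0 < D := by positivity
  have hZ := integral_gfdDensity_pos hn hy
  set Z := ∫ θ, gfdDensity n y θ with hZdef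
  have hρ := integrable_gfdDensity n y
  have hgb : ∀ θ, |g θ| ≤ ‖g‖ := fun θ => g.norm_coe_le_norm θ
  have hconst : ∀ c : ℝ, 0 ≤ c → Tendsto (fun ε => ε / ε ^ n *
      ∫ _ in nearSet triDGA (Ioo 0 1) y ε, c ∂(uniformLaw n)) (𝓝[>] 0) (𝓝 (D * (c * Z))) :=
      fun c hc => by
    have h := tendsto_nearSet_integral_of_nonneg hn hκ hvol hy hQ (g := fun _ => c)
      continuous_const (fun _ => hc) (B := c) (fun _ => (abs_of_nonneg hc).le)
    rwa [integral_const_mul] at h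
  have hgρ : Integrable (fun θ => g θ * gfdDensity n y θ) :=
    hρ.bdd_mul g.continuous.aestronglyMeasurable (ae_of_all _ hgb)
  have hnum : Tendsto (fun ε => ε / ε ^ n *
      ∫ u in nearSet triDGA (Ioo 0 1) y ε, g (Q u) ∂(uniformLaw n)) (𝓝[>] 0)
      (𝓝 (D * ∫ θ, g θ * gfdDensity n y θ)) := by
    -- the test function is made nonnegative by adding a constant
    have h := (tendsto_nearSet_integral_of_nonneg hn hκ hvol hy hQ (g := fun θ => g θ + ‖g‖)
      (g.continuous.add continuous_const) (fun θ => by linarith [(abs_le.1 (hgb θ)).1])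
      (B := ‖g‖ + ‖g‖) (fun θ => (abs_add_le _ _).trans (add_le_add (hgb θ)
        (abs_of_nonneg (norm_nonneg g)).le))).sub (hconst ‖g‖ (norm_nonneg g))
    have e : D * (∫ θ, (g θ + ‖g‖) * gfdDensity n y θ) - D * (‖g‖ * Z)
        = D * ∫ θ, g θ * gfdDensity n y θ := by
      simp_rw [add_mul]
      rw [integral_add hgρ (hρ.const_mul _), integral_const_mul]
      ring
    rw [← hD, e] at h
    refine h.congr fun ε => ?_
    have hgQ : Integrable (fun u => g (Q u)) (uniformLaw n) :=
      Integrable.of_bound (g.continuous.measurable.comp hQ.1).aestronglyMeasurable ‖g‖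
        (ae_of_all _ fun u => hgb _)
    rw [integral_add hgQ.integrableOn (integrable_const _)]
    ring
  have hden := hconst 1 zero_le_one
  rw [one_mul] at hden
  have hlim := hnum.div hden (by positivity)
  have e1 : ∫ θ, g θ ∂(triGFD n y) = (D * ∫ θ, g θ * gfdDensity n y θ) / (D * Z) := by
    have hm : Measurable fun θ => gfdDensity n y θ / Z :=
      (measurable_gfdDensity_right n y).div_const _
    rw [triGFD_eq hy, integral_withDensity_eq_integral_toReal_smul hm.ennreal_ofReal
      (ae_of_all _ fun _ => ENNReal.ofReal_lt_top), mul_div_mul_left _ _ hD0.ne', ← integral_div]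
    refine integral_congr_ae (ae_of_all _ fun θ => ?_)
    dsimp only
    rw [ENNReal.toReal_ofReal (div_nonneg gfdDensity_nonneg hZ.le), smul_eq_mul]
    ring
  rw [e1]
  refine hlim.congr' ?_
  filter_upwards [self_mem_nhdsWithin] with ε hε
  have hε' : (0 : ℝ) < ε := hε
  have hεn : ε / ε ^ n ≠ 0 := by positivity
  rw [Pi.div_apply, mul_div_mul_left _ _ hεn, setIntegral_const, smul_eq_mul, mul_one, ProbabilityTheory.cond,
    integral_smul_measure, ENNReal.toReal_inv, smul_eq_mul, ← Measure.real]
  ring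

end

end Fiducial

theorem mainTheorem2 :
    -- for each mode, the density is a probability density, and the algorithm generates its law
    (∀ θ ∈ Set.Ioo (0 : ℝ) 1,
      MeasureTheory.IsProbabilityMeasure (Fiducial.law Fiducial.triDensity θ) ∧
      (MeasureTheory.volume.restrict (Set.Ioo (0 : ℝ) 1)).map (fun u => Fiducial.triDGA u θ)
        = Fiducial.law Fiducial.triDensity θ) ∧
    -- the algorithm can be inverted in `u`, is differentiable in `θ`, and has the stated gradient
    (∀ θ ∈ Set.Ioo (0 : ℝ) 1, ∀ y ∈ Set.Ioo (0 : ℝ) 1,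
      (∃! u : ℝ, u ∈ Set.Ioo (0 : ℝ) 1 ∧ Fiducial.triDGA u θ = y) ∧
      HasDerivAt (fun t => Fiducial.triDGA (Fiducial.dgaInverse Fiducial.triDGA y θ) t)
        (Fiducial.triGradient y θ) θ) ∧
    -- the explicit Jacobian, and the generalized fiducial distribution
    (∀ n : ℕ, 0 < n → ∀ y : Fin n → ℝ, (∀ i, y i ∈ Set.Ioo (0 : ℝ) 1) →
      (∀ θ ∈ Set.Ioo (0 : ℝ) 1, Fiducial.jacobian Fiducial.triDGA n y θ =
        √(1 / (n : ℝ) * ∑ i, (y i / (2 * θ)) ^ 2 * (Set.Ioc 0 θ).indicator 1 (y i)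
          + 1 / (n : ℝ) * ∑ i,
            ((1 - y i) / (2 * (1 - θ))) ^ 2 * (Set.Ioo θ 1).indicator 1 (y i))) ∧
      Fiducial.IsGFD Fiducial.triDGA (Set.Ioo 0 1) y (Fiducial.triGFD n y)) ∧
    -- the five assumptions and the Bernstein–von Mises property at every true mode
    (∀ θ₀ ∈ Set.Ioo (0 : ℝ) 1,
      Fiducial.fisherInfo Fiducial.triDensity θ₀ (Fiducial.triScore θ₀) = (θ₀ * (1 - θ₀))⁻¹ ∧
      Fiducial.triLimit θ₀ θ₀ = √(1 / 8) ∧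
      Fiducial.BvMAssumptions Fiducial.triDensity (Fiducial.jacobian Fiducial.triDGA)
        (Set.Ioo 0 1) θ₀ (Fiducial.triScore θ₀) (Fiducial.triLimit θ₀) ∧
      Fiducial.BernsteinVonMises Fiducial.triDensity Fiducial.triGFD θ₀
        (Fiducial.triScore θ₀)) ∧
    -- the modified distribution is close to the unmodified one
    (∀ n : ℕ, 0 < n → ∀ y : Fin n → ℝ, (∀ i, y i ∈ Set.Ioo (0 : ℝ) 1) →
      MeasureTheory.IsProbabilityMeasure (Fiducial.triModGFD n y) ∧
      Fiducial.tvDist (Fiducial.triModGFD n y) (Fiducial.triGFD n y)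
        ≤ Fiducial.minSq y + Fiducial.minSqCompl y) ∧
    -- the bound tends to zero almost surely, and the Bernstein–von Mises property is kept
    (∀ θ₀ ∈ Set.Ioo (0 : ℝ) 1,
      (∀ᵐ y ∂(MeasureTheory.Measure.infinitePi
          (fun _ : ℕ => Fiducial.law Fiducial.triDensity θ₀)),
        Filter.Tendsto (fun n : ℕ => Fiducial.minSq (fun i : Fin n => y i)
          + Fiducial.minSqCompl (fun i : Fin n => y i)) Filter.atTop (nhds 0)) ∧
      Fiducial.BernsteinVonMises Fiducial.triDensity Fiducial.triModGFD θ₀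
        (Fiducial.triScore θ₀)) := by
  open Fiducial in
  refine ⟨fun θ hθ => ⟨isProbabilityMeasure_law hθ, map_triDGA hθ⟩,
    fun θ hθ y hy => ⟨triDGA_existsUnique hθ hy, hasDerivAt_triDGA_inverse hθ hy⟩,
    fun n hn y hy => ⟨fun θ hθ => (jacobian_triDGA hy hθ).trans triJac_explicit,
      isGFD_triGFD hn hy⟩,
    fun θ₀ hθ₀ => ⟨fisherInfo_tri hθ₀, triLimit_self hθ₀, bvMAssumptions_tri hθ₀,
      bernsteinVonMises_triGFD hθ₀⟩,
    fun n hn y hy => ⟨isProbabilityMeasure_triModGFD hn hy, tvDist_triModGFD_le hn hy⟩,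
    fun θ₀ hθ₀ => ⟨tendsto_minSq_add_minSqCompl_ae hθ₀, bernsteinVonMises_triModGFD hθ₀⟩⟩
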